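/- **Definitions.** Inputs are strings over $\{0,1\}$; $n=|x|\in\{0,1,2,\dots\}$ denotes input length. A function $f$ of $n$ with values in the nonnegative integers is polynomially bounded if $f(n)\le p(n)$ for some polynomial $p$ and all $n$. For a polynomially bounded $k$ with positive values, a $k$-proof quantum verifier $V$ is a deterministic polynomial-time computable map that takes each input $x$ to a description of a quantum circuit $V(x)$ over the finite universal gate set $\{X,H,T,\mathrm{CNOT},\mathrm{Toffoli}\}$. The circuit acts on $q_V(|x|)\ge 1$ work qubits and $k(|x|)$ witness registers of $q_M(|x|)\ge 1$ qubits each, where $q_V,q_M$ are polynomially bounded; one work qubit is the output qubit. The probability that $V$ accepts $x$ with quantum proofs $|\phi_1\rangle,\dots,|\phi_{k(|x|)}\rangle$ (pure states of $q_M(|x|)$ qubits) is the probability that measuring the output qubit in the computational basis yields $1$ after $V(x)$ is applied to $|0\cdots0\rangle\otimes|\phi_1\rangle\otimes\cdots\otimes|\phi_{k(|x|)}\rangle$. A promise problem $A=(A_{\mathrm{yes}},A_{\mathrm{no}})$ (a pair of disjoint sets of strings) is in $\mathrm{QMA}(k,c,s)$ if there is a $k$-proof quantum verifier $V$ such that for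 every $x\in A_{\mathrm{yes}}$ some $k(|x|)$ quantum proofs make $V$ accept $x$ with probability at least $c(|x|)$, and for every $x\in A_{\mathrm{no}}$ and all $k(|x|)$ quantum proofs $V$ accepts $x$ with probability at most $s(|x|)$. A pair $(c,s)$ of functions of $n$ with values in $[0,1]$ is a *two-sided bounded error probability* if $c-s\ge 1/q$ for some polynomially bounded $q$ with positive values, and $c$ and $s$ are polynomial-time computable, i.e. from $1^n$ and $1^m$ one can compute in polynomial time a nonnegative integer $a$ with $|c(n)-a/2^m|\le 2^{-m}$, and similarly for $s$. It is so *in the strict sense* if moreover $s\ge 2^{-p}$ and $1-c\ge 2^{-p}$ for some polynomially bounded $p$ (so that neither error vanishes). **Theorem.** Let $\mathcal E$ be the class of all two-sided bounded error probabilities, or the class of all two-sided bounded error probabilities in the strict sense. The equality $$\mathrm{QMA}(k,c,s)=\mathrm{QMA}\bigl(2,\tfrac23,\tfrac13\bigr)$$ holds for every polynomially bounded function $k\ge 2$ and every $(c,s)\in\mathcal E$ if and only if the following condition holds: $(\ast)$ for every $(c,s)\in\mathcal E$, $\ \mathrm{QMA}(2,c,s)=\mathrm{QMA}\bigl(2,\tfrac23,\tfrac13\bigr)$.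 -/

import Mathlib

noncomputable section

namespace MultiMerlin

/-- A function on input lengths is polynomially bounded. -/
def PolynomiallyBounded (f : ℕ → ℕ) : Prop :=
  ∃ p : Polynomial ℕ, ∀ n, f n ≤ p.eval n

/-- A function on bit strings is computed by a deterministic Turing machine in time polynomial in
the length of its argument. -/
def PolyTimeComputable (f : List Bool → List Bool) : Prop :=
  Nonempty (Turing.TM2ComputableInPolyTime (id : List Bool → List Bool)
    (id : List Bool → List Bool) f)

/-- A promise problem over the alphabet `{0, 1}`. -/
structure PromiseProblem where
  yes : Set (List Bool)
  no : Set (List Bool)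
  disjoint : Disjoint yes no

/-! ### Quantum circuits -/

/-- Gates from the finite universal set `{X, H, T, CNOT, Toffoli}`, acting on qubits that are
labelled by the elements of `Q`.  The operands of a gate are pairwise distinct; the last operand of
`cnot` and of `toffoli` is the target. -/
inductive Gate (Q : Type) : Type
  | pauliX (t : Q)
  | hadamard (t : Q)
  | phaseT (t : Q)
  | cnot (c t : Q) (hct : c ≠ t)
  | toffoli (c₁ c₂ t : Q) (hcc : c₁ ≠ c₂) (h₁ : c₁ ≠ t) (h₂ : c₂ ≠ t)

/-- A vector of amplitudes in the computational basis of the qubits `Q`. -/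
abbrev Amplitudes (Q : Type) : Type := (Q → Bool) → ℂ

/-- The unitary operator of a gate, in the computational basis. -/
def Gate.apply {Q : Type} [DecidableEq Q] : Gate Q → Amplitudes Q → Amplitudes Q
  | .pauliX t, ψ => fun b => ψ (Function.update b t (!b t))
  | .hadamard t, ψ => fun b =>
      ((Real.sqrt 2 : ℝ) : ℂ)⁻¹ *
        (ψ (Function.update b t false) +
          (if b t then -1 else 1) * ψ (Function.update b t true))
  | .phaseT t, ψ => fun b =>
      (if b t then Complex.exp (((Real.pi / 4 : ℝ) : ℂ) * Complex.I) else 1) * ψ b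
  | .cnot c t _, ψ => fun b => ψ (Function.update b t (xor (b t) (b c)))
  | .toffoli c₁ c₂ t _ _ _, ψ => fun b => ψ (Function.update b t (xor (b t) (b c₁ && b c₂)))

/-- A circuit is a list of gates; its head is applied first. -/
abbrev Circuit (Q : Type) : Type := List (Gate Q)

/-- The unitary operator of a circuit. -/
def Circuit.apply {Q : Type} [DecidableEq Q] (C : Circuit Q) (ψ : Amplitudes Q) : Amplitudes Q :=
  C.foldl (fun φ g => g.apply φ) ψ

/-- The qubits of a verification circuit: `v` qubits of work space, and `k` witness spaces of `m`
qubits each. -/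
abbrev Qubit (v k m : ℕ) : Type := Fin v ⊕ (Fin k × Fin m)

/-! ### Descriptions of circuits as bit strings -/

/-- The self-delimiting description `1ⁿ0` of `n`. -/
def describeNat (n : ℕ) : List Bool := List.replicate n true ++ [false]

/-- A qubit is described by its register (work or witness) and by its position there. -/
def describeQubit {v k m : ℕ} : Qubit v k m → List Bool
  | .inl i => false :: describeNat i
  | .inr (j, i) => true :: (describeNat j ++ describeNat i)

/-- A gate is described by its kind followed by its operands. -/
def describeGate {v k m : ℕ} : Gate (Qubit v k m) → List Bool
  | .pauliX t => describeNat 0 ++ describeQubit t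
  | .hadamard t => describeNat 1 ++ describeQubit t
  | .phaseT t => describeNat 2 ++ describeQubit t
  | .cnot c t _ => describeNat 3 ++ describeQubit c ++ describeQubit t
  | .toffoli c₁ c₂ t _ _ _ =>
      describeNat 4 ++ describeQubit c₁ ++ describeQubit c₂ ++ describeQubit t

/-- The description of a circuit: the concatenation of the (self-delimiting) descriptions of its
gates. -/
def describeCircuit {v k m : ℕ} (C : Circuit (Qubit v k m)) : List Bool :=
  C.flatMap describeGate

/-! ### Multi-proof quantum Merlin-Arthur proof systems -/

/-- A quantum verifier for `k`-proof quantum Merlin-Arthur proof systems, where the number `k` of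
proofs, the size `qV` of the work space and the size `qM` of each quantum proof are functions of the
input length: a polynomial-time computable map from inputs to descriptions of circuits. -/
structure QuantumVerifier (k : ℕ → ℕ) where
  qV : ℕ → ℕ
  qM : ℕ → ℕ
  qV_pos : ∀ n, 0 < qV n
  qM_pos : ∀ n, 0 < qM n
  qV_bounded : PolynomiallyBounded qV
  qM_bounded : PolynomiallyBounded qM
  circuit : ∀ x : List Bool, Circuit (Qubit (qV x.length) (k x.length) (qM x.length))
  polyTime : PolyTimeComputable fun x => describeCircuit (circuit x)

/-- A quantum proof of size `m`: a pure state of `m` qubits. -/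
def QuantumProof (m : ℕ) : Type :=
  {φ : EuclideanSpace ℂ (Fin m → Bool) // ‖φ‖ = 1}

/-- The amplitudes of `|0…0⟩ ⊗ |φ₁⟩ ⊗ ⋯ ⊗ |φₖ⟩`, the first factor being the work space. -/
def initialState {v k m : ℕ} (φ : Fin k → QuantumProof m) : Amplitudes (Qubit v k m) :=
  fun b => (if ∀ i : Fin v, b (.inl i) = false then 1 else 0) *
    ∏ j : Fin k, (φ j).1 (fun i => b (.inr (j, i)))

/-- The probability that a measurement of the qubit `o` in the computational basis yields `1`. -/
def probOne {Q : Type} [Fintype Q] [DecidableEq Q] (o : Q) (ψ : Amplitudes Q) : ℝ :=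
  ∑ b : Q → Bool, if b o then ‖ψ b‖ ^ 2 else 0

namespace QuantumVerifier

variable {k : ℕ → ℕ}

/-- The output qubit: the first qubit of the work space. -/
def output (V : QuantumVerifier k) (n : ℕ) : Qubit (V.qV n) (k n) (V.qM n) :=
  .inl ⟨0, V.qV_pos n⟩

/-- The probability that `V` accepts `x`, given the quantum proofs `φ`. -/
def acceptProb (V : QuantumVerifier k) (x : List Bool)
    (φ : Fin (k x.length) → QuantumProof (V.qM x.length)) : ℝ :=
  probOne (V.output x.length) (Circuit.apply (V.circuit x) (initialState φ))

end QuantumVerifier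

/-- The class `QMA(k, c, s)` of promise problems. -/
def QMA (k : ℕ → ℕ) (c s : ℕ → ℝ) : Set PromiseProblem :=
  {A | ∃ V : QuantumVerifier k,
    (∀ x ∈ A.yes, ∃ φ : Fin (k x.length) → QuantumProof (V.qM x.length),
      c x.length ≤ V.acceptProb x φ) ∧
    (∀ x ∈ A.no, ∀ φ : Fin (k x.length) → QuantumProof (V.qM x.length),
      V.acceptProb x φ ≤ s x.length)}

/-! ### Error probabilities -/

/-- The number with the given binary digits, the least significant one first. -/
def binaryValue (w : List Bool) : ℕ := Nat.ofDigits 2 (w.map Bool.toNat)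

/-- A sequence of real numbers is polynomial-time computable: on input `1ⁿ01ᵐ` some
polynomial-time machine outputs, in binary, a numerator `a` with `|f n - a / 2ᵐ| ≤ 2⁻ᵐ`. -/
def PolyTimeComputableReal (f : ℕ → ℝ) : Prop :=
  ∃ g : List Bool → List Bool, PolyTimeComputable g ∧ ∀ n m : ℕ,
    |f n - (binaryValue (g (List.replicate n true ++ false :: List.replicate m true)) : ℝ) / 2 ^ m|
      ≤ (1 / 2) ^ m

/-- The two-sided bounded error probabilities `(c, s)`: polynomial-time computable functions with
values in `[0, 1]` and with `c - s ≥ 1 / q` for a polynomially bounded `q`. -/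
def boundedErrors : Set ((ℕ → ℝ) × (ℕ → ℝ)) :=
  {(c, s) | PolyTimeComputableReal c ∧ PolyTimeComputableReal s ∧
    (∀ n, 0 ≤ s n ∧ c n ≤ 1) ∧
    ∃ q : ℕ → ℕ, PolynomiallyBounded q ∧ ∀ n, 0 < q n ∧ 1 / (q n : ℝ) ≤ c n - s n}

/-- The two-sided bounded error probabilities in the strict sense, which excludes one-sided error:
neither of the error probabilities `1 - c` and `s` vanishes, and both are at least `2⁻ᵖ` for a
polynomially bounded `p`. -/
def strictBoundedErrors : Set ((ℕ → ℝ) × (ℕ → ℝ)) :=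
  {(c, s) | (c, s) ∈ boundedErrors ∧
    ∃ p : ℕ → ℕ, PolynomiallyBounded p ∧ ∀ n, (1 / 2) ^ p n ≤ s n ∧ (1 / 2) ^ p n ≤ 1 - c n}

/-- Condition (∗), for a class `E` of error probabilities: two-proof systems can be amplified. -/
def TwoProofAmplification (E : Set ((ℕ → ℝ) × (ℕ → ℝ))) : Prop :=
  ∀ c s : ℕ → ℝ, (c, s) ∈ E →
    QMA (fun _ => 2) c s = QMA (fun _ => 2) (fun _ => 2 / 3) (fun _ => 1 / 3)

end MultiMerlin

end

/-! One direction is the case `k = 2`. For the other, two-proof systems embed in `k`-proof systems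
because proofs may be ignored (`QMA_two_subset`). It remains to simulate `k` proofs by two, with
error probabilities that still belong to the class (`exists_mem_QMA_two`). The new gap may be tiny,
since (∗) applies to every inverse polynomial gap.

Let `N = 2 ^ L` be polynomially large, at least the number and size of the proofs and a multiple of
the inverse gap. Each of the two proofs should be the same product of `N` blocks of `N` qubits. The
verifier swap tests corresponding blocks and rejects unless all tests succeed. It then tosses `4 *
L` coins. Only if all of them show one, which has probability `p = N⁻⁴`, does the verdict of the
given verifier on the blocks of the first proof count; otherwise it accepts. Honest proofs pass all
tests, and acceptance probability `a` becomes `1 - p (1 - a)` (`coinAcceptance_eq`).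

For soundness, suppose that all tests succeed on `A ⊗ B` with probability `1 - δ`. Then each single
test does so at least as often. A swap test measures the overlap of reduced states, so in every
block some rank one projection moves `A` by at most `√(2δ)` (`exists_sqNorm_sub_blockProj_le`). All
these projections together yield a product vector (`exists_eq_mul_prod`) at distance at most `N
√(2δ)` from `A`, while the tests move `A ⊗ B` by at most `N √δ`. So the given verifier accepts with
weight at most `(√s + 3 N √δ)²`. Weighted by `p`, the excess over `s + 1 / N` is outweighed by the
failure of the tests (`acceptance_bound`), and acceptance is at most `1 - p (1 - (s + 1 / N))`
(`coinAcceptance_le`).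

The new error probabilities must be computable and strict. They are built from a numerator `a` with
`|s - a / N| ≤ 1 / N`, with `(a + 3) / N` and `(a + 2) / N` in the roles of `c` and `s + 1 / N`;
their binary digits are `4 * L` ones followed by those of the numerator
(`polyTimeComputableReal_nearOne`).

Uniformity is proved with multi-stack programs whose running times compose (`Fragment.Runs`);
`describeCircuit_twoProofCircuit` identifies their output with the circuit that
`probOne_twoProofCircuit` analyses. -/

noncomputable section

namespace MultiMerlin

open Turing

/-! ### Program fragments for multi-stack machines -/

/-- `b` is reached from `a` by at most `t` steps of `f`. -/
def ReachesWithin {C : Type*} (f : C → Option C) (t : ℕ) (a b : C) : Prop :=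
  ∃ n ≤ t, (flip bind f)^[n] (some a) = some b

namespace ReachesWithin

variable {C : Type*} {f : C → Option C} {t t' : ℕ} {a b c : C}

theorem refl (f : C → Option C) (t : ℕ) (a : C) : ReachesWithin f t a a := ⟨0, t.zero_le, rfl⟩

theorem trans (h : ReachesWithin f t a b) (h' : ReachesWithin f t' b c) :
    ReachesWithin f (t + t') a c := by
  obtain ⟨n, hn, h⟩ := h
  obtain ⟨m, hm, h'⟩ := h'
  exact ⟨m + n, by omega, by rw [Function.iterate_add_apply, h, h']⟩

theorem mono (h : ReachesWithin f t a b) (ht : t ≤ t') : ReachesWithin f t' a b := by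
  obtain ⟨n, hn, h⟩ := h
  exact ⟨n, hn.trans ht, h⟩

theorem single (h : f a = some b) : ReachesWithin f 1 a b := ⟨1, le_rfl, h⟩

theorem head (h : f a = some b) (h' : ReachesWithin f t b c) : ReachesWithin f (t + 1) a c :=
  ((single h).trans h').mono (by omega)

end ReachesWithin

/-- The stack alphabets of a machine with Boolean stacks `κ` and the stacks of `M`. -/
abbrev Alphabet (κ : Type) (M : TM2ComputableAux Bool Bool) : κ ⊕ M.tm.K → Type
  | .inl _ => Bool
  | .inr k => M.tm.Γ k

/-- The internal memory: one Boolean register and the memory of `M`. -/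
abbrev Memory (M : TM2ComputableAux Bool Bool) : Type := Option Bool × M.tm.σ

/-- A program fragment with one entry and one exit, which may call the machine `M`. -/
structure Fragment (κ : Type) (M : TM2ComputableAux Bool Bool) where
  Label : Type
  fin : Fintype Label
  entry : Label
  code : ∀ {L : Type}, (Label → L) → L → Label → TM2.Stmt (Alphabet κ M) L (Memory M)

variable {κ : Type} [DecidableEq κ] {M : TM2ComputableAux Bool Bool}

/-- Juxtaposition of the Boolean stacks and the stacks of `M`. -/
def joinStacks (S : κ → List Bool) (T : ∀ k, List (M.tm.Γ k)) : ∀ k, List (Alphabet κ M k)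
  | .inl k => S k
  | .inr k => T k

theorem joinStacks_update_inl (S : κ → List Bool) (T : ∀ k, List (M.tm.Γ k)) (k : κ)
    (w : List Bool) : Function.update (joinStacks S T) (.inl k) w =
      joinStacks (Function.update S k w) T := by
  funext j
  rcases j with j | j
  · by_cases h : j = k
    · subst h; simp [joinStacks]
    · simp [joinStacks, h]
  · simp [joinStacks]

theorem joinStacks_update_inr (S : κ → List Bool) (T : ∀ k, List (M.tm.Γ k)) (k : M.tm.K)
    (w : List (M.tm.Γ k)) : Function.update (joinStacks S T) (.inr k) w =
      joinStacks S (Function.update T k w) := by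
  funext j
  rcases j with j | j
  · simp [joinStacks]
  · by_cases h : j = k
    · subst h; simp [joinStacks]
    · simp [joinStacks, h]

/-- A configuration between two fragments. -/
def idleCfg {L : Type} (l : L) (S : κ → List Bool) :
    TM2.Cfg (Alphabet κ M) L (Memory M) :=
  ⟨some l, (none, M.tm.initialState), joinStacks S fun _ => []⟩

theorem step_some {K : Type} [DecidableEq K] {Γ : K → Type} {Λ σ : Type}
    {m : Λ → TM2.Stmt Γ Λ σ} {l : Λ} {q : TM2.Stmt Γ Λ σ} (h : m l = q) (v : σ)
    (T : ∀ k, List (Γ k)) : TM2.step m ⟨some l, v, T⟩ = some (TM2.stepAux q v T) := by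
  rw [← h]; rfl

namespace Fragment

/-- Started on the stacks `S`, the fragment ends within `t` steps on the stacks `S'`. -/
structure Runs (F : Fragment κ M) (S S' : κ → List Bool) (t : ℕ) : Prop where
  reaches : ∀ {L : Type} (m : L → TM2.Stmt (Alphabet κ M) L (Memory M)) (emb : F.Label → L) (exit : L),
    (∀ l, m (emb l) = F.code emb exit l) →
    ReachesWithin (TM2.step m) t (idleCfg (emb F.entry) S) (idleCfg exit S')

variable {S S' S'' : κ → List Bool} {t t' : ℕ}

theorem Runs.mono {F : Fragment κ M} (h : F.Runs S S' t) (ht : t ≤ t') : F.Runs S S' t' :=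
  ⟨fun m emb exit hm => (h.reaches m emb exit hm).mono ht⟩

/-- Do nothing. -/
def skip : Fragment κ M where
  Label := Unit
  fin := inferInstance
  entry := ()
  code _ exit _ := .goto fun _ => exit

theorem runs_skip : (skip : Fragment κ M).Runs S S 1 := by
  constructor
  intro L m emb exit hm
  exact .single (step_some (hm _) _ _)

/-- Push `b` on the stack `k`. -/
def push (k : κ) (b : Bool) : Fragment κ M where
  Label := Unit
  fin := inferInstance
  entry := ()
  code _ exit _ := .push (.inl k) (fun _ => b) (.goto fun _ => exit)

theorem runs_push (k : κ) (b : Bool) :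
    (push k b : Fragment κ M).Runs S (Function.update S k (b :: S k)) 1 := by
  constructor
  intro L m emb exit hm
  refine .single ((step_some (hm _) _ _).trans ?_)
  simp only [push, TM2.stepAux]
  rw [joinStacks_update_inl]
  rfl

/-- Run `F`, then `G`. -/
def seq (F G : Fragment κ M) : Fragment κ M where
  Label := F.Label ⊕ G.Label
  fin := haveI := F.fin; haveI := G.fin; inferInstance
  entry := .inl F.entry
  code emb exit
    | .inl l => F.code (emb ∘ .inl) (emb (.inr G.entry)) l
    | .inr l => G.code (emb ∘ .inr) exit l

/-- `Runs` quantifies over every host machine that contains the code, so both fragments may be run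
inside the host of the composite, with the entry of `G` as the exit of `F`. -/
theorem Runs.seq {F G : Fragment κ M} (h : F.Runs S S' t) (h' : G.Runs S' S'' t') :
    (F.seq G).Runs S S'' (t + t') := by
  constructor
  intro L m emb exit hm
  exact (h.reaches m (emb ∘ .inl) _ fun l => hm _).trans (h'.reaches m (emb ∘ .inr) _ fun l => hm _)

/-- Pop the stack `k` into the register, and jump accordingly. -/
def popJump {L : Type} (k : κ) (ln lt lf : L) : TM2.Stmt (Alphabet κ M) L (Memory M) :=
  .pop (.inl k) (fun v s => (s, v.2)) <|
    .branch (fun v => v.1.isSome)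
      (.branch (fun v => v.1.getD false)
        (.load (fun v => (none, v.2)) (.goto fun _ => lt))
        (.load (fun v => (none, v.2)) (.goto fun _ => lf)))
      (.goto fun _ => ln)

/-- On every branch the register is `none` again after the step, so idle configurations lead to idle
configurations. -/
theorem step_popJump_nil {L : Type} {m : L → TM2.Stmt (Alphabet κ M) L (Memory M)} {l : L} {k : κ}
    {ln lt lf : L} (hm : m l = popJump k ln lt lf) (hS : S k = []) :
    TM2.step m (idleCfg l S) = some (idleCfg ln S) := by
  simp only [idleCfg, TM2.step, hm, popJump, TM2.stepAux]
  rw [joinStacks_update_inl]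
  have hS' : Function.update S k (S k).tail = S := by
    conv_rhs => rw [← Function.update_eq_self k S]
    rw [hS]; rfl
  simp only [joinStacks, hS']
  simp [hS]

theorem step_popJump_cons {L : Type} {m : L → TM2.Stmt (Alphabet κ M) L (Memory M)} {l : L} {k : κ}
    {ln lt lf : L} {b : Bool} {w : List Bool} (hm : m l = popJump k ln lt lf)
    (hS : S k = b :: w) :
    TM2.step m (idleCfg l S) = some (idleCfg (cond b lt lf) (Function.update S k w)) := by
  simp only [idleCfg, TM2.step, hm, popJump, TM2.stepAux]
  rw [joinStacks_update_inl]
  simp only [joinStacks, hS]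
  cases b <;> simp

/-- Pop the stack `k`, and continue with `F` if it was empty, and with `G true` or `G false`
according to the popped symbol otherwise. -/
def cases (k : κ) (F : Fragment κ M) (G : Bool → Fragment κ M) : Fragment κ M where
  Label := Option (F.Label ⊕ (G true).Label ⊕ (G false).Label)
  fin := haveI := F.fin; haveI := (G true).fin; haveI := (G false).fin; inferInstance
  entry := none
  code emb exit
    | none => popJump k (emb (some (.inl F.entry))) (emb (some (.inr (.inl (G true).entry))))
        (emb (some (.inr (.inr (G false).entry))))
    | some (.inl l) => F.code (fun l => emb (some (.inl l))) exit l
    | some (.inr (.inl l)) => (G true).code (fun l => emb (some (.inr (.inl l)))) exit l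
    | some (.inr (.inr l)) => (G false).code (fun l => emb (some (.inr (.inr l)))) exit l

theorem Runs.cases_nil {k : κ} {F : Fragment κ M} {G : Bool → Fragment κ M} (hS : S k = [])
    (h : F.Runs S S' t) : (cases k F G).Runs S S' (t + 1) := by
  constructor
  intro L m emb exit hm
  exact .head (step_popJump_nil (hm none) hS) (h.reaches m _ _ fun l => hm (some (.inl l)))

theorem Runs.cases_cons {k : κ} {F : Fragment κ M} {G : Bool → Fragment κ M} {b : Bool}
    {w : List Bool} (hS : S k = b :: w) (h : (G b).Runs (Function.update S k w) S' t) :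
    (cases k F G).Runs S S' (t + 1) := by
  constructor
  intro L m emb exit hm
  refine .head (step_popJump_cons (hm none) hS) ?_
  cases b
  · exact h.reaches m _ _ fun l => hm (some (.inr (.inr l)))
  · exact h.reaches m _ _ fun l => hm (some (.inr (.inl l)))

/-- Empty the stack `k`, running `G b` for each popped symbol `b`. -/
def loop (k : κ) (G : Bool → Fragment κ M) : Fragment κ M where
  Label := Option ((G true).Label ⊕ (G false).Label)
  fin := haveI := (G true).fin; haveI := (G false).fin; inferInstance
  entry := none
  code emb exit
    | none => popJump k exit (emb (some (.inl (G true).entry)))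
        (emb (some (.inr (G false).entry)))
    | some (.inl l) => (G true).code (fun l => emb (some (.inl l))) (emb none) l
    | some (.inr l) => (G false).code (fun l => emb (some (.inr l))) (emb none) l

theorem Runs.loop_nil {k : κ} {G : Bool → Fragment κ M} (hS : S k = []) :
    (loop k G).Runs S S 1 := by
  constructor
  intro L m emb exit hm
  exact .single (step_popJump_nil (hm none) hS)

theorem Runs.loop_cons {k : κ} {G : Bool → Fragment κ M} {b : Bool} {w : List Bool}
    (hS : S k = b :: w) (h : (G b).Runs (Function.update S k w) S' t)
    (h' : (loop k G).Runs S' S'' t') : (loop k G).Runs S S'' (t + t' + 1) := by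
  constructor
  intro L m emb exit hm
  refine .head (step_popJump_cons (hm none) hS) (.trans ?_ (h'.reaches m emb exit hm))
  cases b
  · exact h.reaches m _ _ fun l => hm (some (.inr l))
  · exact h.reaches m _ _ fun l => hm (some (.inl l))

/-- Pop the stack `k` until a symbol other than `true` is popped, running `F` for each `true`. -/
def unary (k : κ) (F : Fragment κ M) : Fragment κ M where
  Label := Option F.Label
  fin := haveI := F.fin; inferInstance
  entry := none
  code emb exit
    | none => popJump k exit (emb (some F.entry)) exit
    | some l => F.code (fun l => emb (some l)) (emb none) l

theorem Runs.unary_nil {k : κ} {F : Fragment κ M} (hS : S k = []) : (unary k F).Runs S S 1 := by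
  constructor
  intro L m emb exit hm
  exact .single (step_popJump_nil (hm none) hS)

theorem Runs.unary_false {k : κ} {F : Fragment κ M} {w : List Bool} (hS : S k = false :: w) :
    (unary k F).Runs S (Function.update S k w) 1 := by
  constructor
  intro L m emb exit hm
  exact .single (step_popJump_cons (hm none) hS)

theorem Runs.unary_true {k : κ} {F : Fragment κ M} {w : List Bool}
    (hS : S k = true :: w) (h : F.Runs (Function.update S k w) S' t)
    (h' : (unary k F).Runs S' S'' t') : (unary k F).Runs S S'' (t + t' + 1) := by
  constructor
  intro L m emb exit hm
  exact .head (step_popJump_cons (hm none) hS)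
    (.trans (h.reaches m _ _ fun l => hm (some l)) (h'.reaches m emb exit hm))

/-! #### Calling the machine `M` -/

/-- The statements of `M`, as statements of a larger machine in which `exit` replaces the halting
state. -/
def embedStmt (κ : Type) {L : Type} (run : M.tm.Λ → L) (exit : L) :
    TM2.Stmt M.tm.Γ M.tm.Λ M.tm.σ → TM2.Stmt (Alphabet κ M) L (Memory M)
  | .push k f q => .push (.inr k) (fun v => f v.2) (embedStmt κ run exit q)
  | .peek k f q => .peek (.inr k) (fun v s => (v.1, f v.2 s)) (embedStmt κ run exit q)
  | .pop k f q => .pop (.inr k) (fun v s => (v.1, f v.2 s)) (embedStmt κ run exit q)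
  | .load f q => .load (fun v => (v.1, f v.2)) (embedStmt κ run exit q)
  | .branch f q r => .branch (fun v => f v.2) (embedStmt κ run exit q) (embedStmt κ run exit r)
  | .goto f => .goto fun v => run (f v.2)
  | .halt => .goto fun _ => exit

/-- The configurations of `M`, as configurations of a larger machine. -/
def embedCfg {L : Type} (run : M.tm.Λ → L) (exit : L) (S : κ → List Bool)
    (c : TM2.Cfg M.tm.Γ M.tm.Λ M.tm.σ) : TM2.Cfg (Alphabet κ M) L (Memory M) :=
  ⟨some (c.l.elim exit run), (none, c.var), joinStacks S c.stk⟩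

/-- The statements of `M` touch only the stacks of `M` and its component of the memory, and halting
becomes a jump. The simulation is therefore step by step, without overhead. -/
theorem stepAux_embedStmt {L : Type} (run : M.tm.Λ → L) (exit : L)
    (q : TM2.Stmt M.tm.Γ M.tm.Λ M.tm.σ) (v : M.tm.σ) (T : ∀ k, List (M.tm.Γ k)) :
    TM2.stepAux (embedStmt κ run exit q) (none, v) (joinStacks S T) =
      embedCfg run exit S (TM2.stepAux q v T) := by
  induction q generalizing v T with
  | push k f q ih =>
    simp only [embedStmt, TM2.stepAux]
    rw [joinStacks_update_inr]
    exact ih _ _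
  | peek k f q ih => exact ih _ _
  | pop k f q ih =>
    simp only [embedStmt, TM2.stepAux]
    rw [joinStacks_update_inr]
    exact ih _ _
  | load f q ih => exact ih _ _
  | branch f q r ihq ihr =>
    simp only [embedStmt, TM2.stepAux]
    cases f v
    · exact ihr _ _
    · exact ihq _ _
  | goto f => rfl
  | halt => rfl

theorem reachesWithin_embed {L : Type} {m : L → TM2.Stmt (Alphabet κ M) L (Memory M)}
    {run : M.tm.Λ → L} {exit : L} (hm : ∀ l, m (run l) = embedStmt κ run exit (M.tm.m l))
    (n : ℕ) (c c' : TM2.Cfg M.tm.Γ M.tm.Λ M.tm.σ)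
    (h : (flip bind (TM2.step M.tm.m))^[n] (some c) = some c') :
    ReachesWithin (TM2.step m) n (embedCfg run exit S c) (embedCfg run exit S c') := by
  induction n generalizing c with
  | zero =>
    obtain rfl : c = c' := by simpa using h
    exact .refl _ _ _
  | succ n ih =>
    obtain ⟨_ | l, v, T⟩ := c
    -- A halted configuration has no successor, so it cannot start a run of positive length.
    · exfalso
      rw [Function.iterate_succ_apply] at h
      have : ∀ n, (flip bind (TM2.step M.tm.m))^[n] none = none := by
        intro n
        induction n with
        | zero => rfl
        | succ n ih => rw [Function.iterate_succ_apply]; exact ih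
      exact absurd ((this n).symm.trans h) (by simp)
    · refine .head ?_ (ih (TM2.stepAux (M.tm.m l) v T) h)
      simp only [embedCfg, TM2.step, Option.elim, hm]
      exact congrArg some (stepAux_embedStmt _ _ _ _ _)

/-- Empty the stack `a` to the input stack of `M`, run `M`, and empty its output stack to `b`. -/
def call (a b : κ) : Fragment κ M where
  Label := Option (Option M.tm.Λ)
  fin := haveI := M.tm.ΛFin; inferInstance
  entry := none
  code emb exit
    | none => .pop (.inl a) (fun v s => (s, v.2)) <|
        .branch (fun v => v.1.isSome)
          (.push (.inr M.tm.k₀) (fun v => M.inputAlphabet.symm (v.1.getD false))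
            (.load (fun v => (none, v.2)) (.goto fun _ => emb none)))
          (.goto fun _ => emb (some (some M.tm.main)))
    | some none => .pop (.inr M.tm.k₁) (fun v s => (s.map M.outputAlphabet, v.2)) <|
        .branch (fun v => v.1.isSome)
          (.push (.inl b) (fun v => v.1.getD false)
            (.load (fun v => (none, v.2)) (.goto fun _ => emb (some none))))
          (.goto fun _ => exit)
    | some (some l) => embedStmt κ (fun l => emb (some (some l))) (emb (some none)) (M.tm.m l)

theorem initList_eq (w : List (M.tm.Γ M.tm.k₀)) :
    initList M.tm w = ⟨some M.tm.main, M.tm.initialState, Function.update (fun _ => []) M.tm.k₀ w⟩ := by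
  unfold initList
  congr 1
  funext k
  by_cases h : k = M.tm.k₀
  · subst h; simp
  · simp [h]

theorem haltList_eq (w : List (M.tm.Γ M.tm.k₁)) :
    haltList M.tm w = ⟨none, M.tm.initialState, Function.update (fun _ => []) M.tm.k₁ w⟩ := by
  unfold haltList
  congr 1
  funext k
  by_cases h : k = M.tm.k₁
  · subst h; simp
  · simp [h]

/-- Emptying one stack onto another reverses it, whence the reversals of `w` and `y`. A machine that
halts as `haltList` prescribes has restored its memory and emptied all stacks but the output stack,
which is then popped; so a call leads back to an idle configuration. -/
theorem runs_call {a b : κ} {w y : List Bool} {n : ℕ}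
    (h : TM2OutputsInTime M.tm (w.map M.inputAlphabet.invFun)
      (some (y.map M.outputAlphabet.invFun)) n) (hS : S a = w.reverse) :
    (call a b : Fragment κ M).Runs S
      (Function.update (Function.update S a []) b (y.reverse ++ Function.update S a [] b))
      (w.length + n + y.length + 2) := by
  constructor
  intro L m emb exit hm
  have key1 : ∀ (u v : List Bool) (S : κ → List Bool), S a = u →
      ReachesWithin (TM2.step m) (u.length + 1)
        ⟨some (emb none), (none, M.tm.initialState),
          joinStacks S (Function.update (fun _ => []) M.tm.k₀ (v.map M.inputAlphabet.invFun))⟩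
        ⟨some (emb (some (some M.tm.main))), (none, M.tm.initialState),
          joinStacks (Function.update S a []) (Function.update (fun _ => []) M.tm.k₀
            ((u.reverse ++ v).map M.inputAlphabet.invFun))⟩ := by
    intro u
    induction u with
    | nil =>
      intro v S hS
      refine .single ((step_some (hm _) _ _).trans ?_)
      simp only [call, TM2.stepAux]
      rw [joinStacks_update_inl]
      simp [joinStacks, hS]
    | cons c u ih =>
      intro v S hS
      have := ih (c :: v) (Function.update S a u) (by simp)
      simp only [Function.update_idem] at this
      refine .head ((step_some (hm _) _ _).trans ?_) (by simpa using this)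
      simp only [call, TM2.stepAux]
      rw [joinStacks_update_inl]
      simp only [joinStacks, hS]
      simp only [List.head?_cons, Option.isSome_some, cond_true, Option.getD_some, List.tail_cons]
      rw [joinStacks_update_inr]
      simp
  have key2 : ∀ (u v : List Bool) (S : κ → List Bool), S b = v →
      ReachesWithin (TM2.step m) (u.length + 1)
        ⟨some (emb (some none)), (none, M.tm.initialState),
          joinStacks S (Function.update (fun _ => []) M.tm.k₁ (u.map M.outputAlphabet.invFun))⟩
        (idleCfg exit (Function.update S b (u.reverse ++ v))) := by
    intro u
    induction u with
    | nil =>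
      intro v S hS
      refine .single ((step_some (hm _) _ _).trans ?_)
      simp only [call, TM2.stepAux]
      rw [joinStacks_update_inr]
      simp [joinStacks, ← hS, idleCfg]
    | cons c u ih =>
      intro v S hS
      have := ih (c :: v) (Function.update S b (c :: v)) (by simp)
      simp only [Function.update_idem] at this
      refine .head ((step_some (hm _) _ _).trans ?_) (by simpa using this)
      simp only [call, TM2.stepAux]
      rw [joinStacks_update_inr]
      simp only [joinStacks]
      simp only [Function.update_self, List.map_cons, List.head?_cons, Option.map_some,
        Option.isSome_some, cond_true, Option.getD_some, List.tail_cons]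
      rw [joinStacks_update_inl]
      simp [hS]
  obtain ⟨⟨n', hn'⟩, hn⟩ := h
  simp only [Option.map_some] at hn'
  rw [initList_eq, haltList_eq] at hn'
  have hrun := reachesWithin_embed (S := Function.update S a []) (m := m)
    (run := fun l => emb (some (some l))) (exit := emb (some none))
    (fun l => hm (some (some l))) n' _ _ hn'
  have h1 := key1 _ [] S hS
  have h2 := key2 y _ (Function.update S a []) rfl
  simp only [List.map_nil, Function.update_eq_self, List.reverse_reverse, List.append_nil,
    List.length_reverse] at h1
  exact ((h1.trans hrun).trans h2).mono (by dsimp only at hn; omega)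

/-! #### The machine of a fragment -/

/-- The stacks that are empty except for `w` on the stack `k`. -/
def oneStack (k : κ) (w : List Bool) : κ → List Bool := Function.update (fun _ => []) k w

/-- An additional label `none` halts the machine and serves as the exit of the fragment; it accounts
for the one extra step of time. -/
theorem polyTimeComputable {κ : Type} [DecidableEq κ] [Fintype κ] (F : Fragment κ M) (i o : κ)
    {g : List Bool → List Bool} (t : Polynomial ℕ)
    (hF : ∀ x, F.Runs (oneStack i x) (oneStack o (g x)) (t.eval x.length)) :
    PolyTimeComputable g := by
  have := F.fin
  have := M.tm.kFin
  have := M.tm.σFin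
  let tm : FinTM2 :=
    { K := κ ⊕ M.tm.K
      k₀ := .inl i
      k₁ := .inl o
      Γ := Alphabet κ M
      Λ := Option F.Label
      main := some F.entry
      σ := Memory M
      initialState := (none, M.tm.initialState)
      Γk₀Fin := inferInstanceAs (Fintype Bool)
      m := fun l => match l with
        | none => .halt
        | some l => F.code some none l }
  refine ⟨{ tm := tm, inputAlphabet := Equiv.refl Bool, outputAlphabet := Equiv.refl Bool,
            time := t + 1, outputsFun := fun x => ?_ }⟩
  have h : ReachesWithin tm.step (t.eval x.length + 1)
      (idleCfg (M := M) (some F.entry) (oneStack i x))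
      ⟨none, (none, M.tm.initialState), joinStacks (oneStack o (g x)) fun _ => []⟩ :=
    ((hF x).reaches tm.m some none fun l => rfl).trans (.single rfl)
  have hi : initList tm (x.map (Equiv.refl Bool).invFun) =
      idleCfg (M := M) (some F.entry) (oneStack i x) := by
    unfold initList idleCfg
    congr 1
    funext k
    rcases k with k | k
    · by_cases hk : k = i
      · subst hk
        simp [tm, joinStacks, oneStack]
      · simp [tm, hk, joinStacks, oneStack]
    · simp [tm, joinStacks]
  have ho : haltList tm ((g x).map (Equiv.refl Bool).invFun) =
      ⟨none, (none, M.tm.initialState), joinStacks (oneStack o (g x)) fun _ => []⟩ := by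
    unfold haltList
    congr 1
    funext k
    rcases k with k | k
    · by_cases hk : k = o
      · subst hk
        simp [tm, joinStacks, oneStack]
      · simp [tm, hk, joinStacks, oneStack]
    · simp [tm, joinStacks]
  have h' : ∃ n ≤ t.eval x.length + 1, (flip bind tm.step)^[n]
      (some (initList tm (x.map (Equiv.refl Bool).invFun))) =
      some (haltList tm ((g x).map (Equiv.refl Bool).invFun)) := by
    rw [hi, ho]
    exact h
  refine ⟨⟨h'.choose, h'.choose_spec.2⟩, ?_⟩
  have := h'.choose_spec.1
  simpa using this

/-! #### The length of the output of a machine -/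

/-- A bound for the number of symbols that a statement pushes. -/
def pushCount {K : Type} {Γ : K → Type} {Λ σ : Type} : TM2.Stmt Γ Λ σ → ℕ
  | .push _ _ q => pushCount q + 1
  | .peek _ _ q => pushCount q
  | .pop _ _ q => pushCount q
  | .load _ q => pushCount q
  | .branch _ q r => pushCount q + pushCount r
  | .goto _ => 0
  | .halt => 0

theorem length_stk_stepAux {K : Type} [DecidableEq K] {Γ : K → Type} {Λ σ : Type}
    (q : TM2.Stmt Γ Λ σ) (v : σ) (T : ∀ k, List (Γ k)) (j : K) :
    ((TM2.stepAux q v T).stk j).length ≤ (T j).length + pushCount q := by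
  induction q generalizing v T with
  | push k f q ih =>
    refine (ih _ _).trans ?_
    by_cases h : j = k
    · subst h; simp [pushCount]; omega
    · simp [h, pushCount]
  | peek k f q ih => exact ih _ _
  | pop k f q ih =>
    refine (ih _ _).trans ?_
    by_cases h : j = k
    · subst h; simp [pushCount]
    · simp [h, pushCount]
  | load f q ih => exact ih _ _
  | branch f q r ihq ihr =>
    simp only [TM2.stepAux, pushCount]
    cases f v
    · exact (ihr _ _).trans (by omega)
    · exact (ihq _ _).trans (by omega)
  | goto f => simp [TM2.stepAux]
  | halt => simp [TM2.stepAux]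

/-- A step pushes a bounded number of symbols, so the time bounds the growth of every stack. This
limits the cost of processing the output of a called machine. -/
theorem exists_length_output_le {f : List Bool → List Bool}
    (h : TM2ComputableInPolyTime (id : List Bool → List Bool) (id : List Bool → List Bool) f) :
    ∃ C : ℕ, ∀ x, (f x).length ≤ x.length + C * h.time.eval x.length := by
  have := h.tm.ΛFin
  refine ⟨∑ l, pushCount (h.tm.m l), fun x => ?_⟩
  have key : ∀ (n : ℕ) (c c' : TM2.Cfg h.tm.Γ h.tm.Λ h.tm.σ) (j : h.tm.K),
      (flip bind (TM2.step h.tm.m))^[n] (some c) = some c' →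
      (c'.stk j).length ≤ (c.stk j).length + (∑ l, pushCount (h.tm.m l)) * n := by
    intro n
    induction n with
    | zero =>
      intro c c' j hc
      obtain rfl : c = c' := by simpa using hc
      simp
    | succ n ih =>
      intro c c' j hc
      rw [Function.iterate_succ_apply'] at hc
      rcases hd : (flip bind (TM2.step h.tm.m))^[n] (some c) with _ | d
      · rw [hd] at hc; simp [flip] at hc
      · rw [hd] at hc
        have h1 := ih c d j hd
        obtain ⟨_ | l, v, T⟩ := d
        · simp [flip] at hc
        · replace hc : TM2.stepAux (h.tm.m l) v T = c' := by simpa [flip] using hc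
          have h2 := length_stk_stepAux (h.tm.m l) v T j
          rw [hc] at h2
          have h3 : pushCount (h.tm.m l) ≤ ∑ l, pushCount (h.tm.m l) :=
            Finset.single_le_sum (f := fun l => pushCount (h.tm.m l)) (fun _ _ => Nat.zero_le _)
              (Finset.mem_univ l)
          simp only at h1
          rw [mul_add, mul_one]
          omega
  obtain ⟨⟨n', hn'⟩, h4⟩ := h.outputsFun x
  simp only [Option.map_some] at hn'
  rw [initList_eq (M := h.toTM2ComputableAux), haltList_eq (M := h.toTM2ComputableAux)] at hn'
  have hx := key _ _ _ h.tm.k₁ hn'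
  have h5 : ((Function.update (fun _ => []) h.tm.k₀ (x.map h.inputAlphabet.invFun) :
      ∀ k, List (h.tm.Γ k)) h.tm.k₁).length ≤ x.length := by
    -- Input and output may share a stack, which then holds the input at the start.
    by_cases hk : h.tm.k₁ = h.tm.k₀
    · have : ∀ j, ((Function.update (fun _ => []) h.tm.k₀ (x.map h.inputAlphabet.invFun) :
        ∀ k, List (h.tm.Γ k)) j).length ≤ x.length := by
        intro j
        by_cases hj : j = h.tm.k₀
        · subst hj; simp
        · simp [hj]
      exact this _
    · simp [hk]
  simp only [Function.update_self, List.length_map, id] at hx h5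
  refine hx.trans (add_le_add h5 (Nat.mul_le_mul_left _ h4))

end Fragment

end MultiMerlin

/-! ### Elementary stack programs and their running times -/

noncomputable section

namespace MultiMerlin

open Turing

/-- The unary representation of `n`. -/
abbrev ones (n : ℕ) : List Bool := List.replicate n true

theorem ones_append (m n : ℕ) : ones m ++ ones n = ones (m + n) := by simp [ones]

theorem ones_succ (n : ℕ) : ones (n + 1) = true :: ones n := rfl

namespace Fragment

variable {κ : Type} [DecidableEq κ] {M : TM2ComputableAux Bool Bool}
variable {S S' : κ → List Bool} {t t' : ℕ}

theorem Runs.congr {F : Fragment κ M} (h : F.Runs S S' t) {R R' : κ → List Bool} (hS : R = S)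
    (hS' : S' = R') (ht : t ≤ t') : F.Runs R R' t' := by
  subst hS hS'; exact h.mono ht

theorem Runs.to {F : Fragment κ M} {R' : κ → List Bool} (h : F.Runs S S' t) (hS' : S' = R')
    (ht : t ≤ t') : F.Runs S R' t' := h.congr rfl hS' ht

/-! #### Elementary programs -/

/-- `σ m` holds the stacks after `m` rounds. The loop pops before it runs its body, hence the `n - m
- 1` symbols at the start of the body. -/
theorem runs_loop_ones {k : κ} {G : Bool → Fragment κ M} {n c : ℕ} (σ : ℕ → κ → List Bool)
    (hk : ∀ m ≤ n, σ m k = ones (n - m))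
    (h : ∀ m < n, (G true).Runs (Function.update (σ m) k (ones (n - m - 1))) (σ (m + 1)) c) :
    (loop k G).Runs (σ 0) (σ n) (n * (c + 1) + 1) := by
  induction n generalizing σ with
  | zero => exact (Runs.loop_nil (by simpa using hk 0 le_rfl)).mono (by omega)
  | succ n ih =>
    have h0 := h 0 (by omega)
    have h1 := ih (fun m => σ (m + 1))
      (fun m hm => by simpa [Nat.add_sub_add_right] using hk (m + 1) (by omega))
      (fun m hm => by simpa [Nat.add_sub_add_right] using h (m + 1) (by omega))
    refine (Runs.loop_cons (b := true) (w := ones n) ?_ (by simpa using h0) h1).mono ?_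
    · simpa [ones_succ] using hk 0 (by omega)
    · rw [Nat.add_mul]; omega

theorem runs_unary_ones {k : κ} {F : Fragment κ M} {n c : ℕ} {w : List Bool}
    (σ : ℕ → κ → List Bool) (hk : ∀ m ≤ n, σ m k = ones (n - m) ++ false :: w)
    (h : ∀ m < n, F.Runs (Function.update (σ m) k (ones (n - m - 1) ++ false :: w))
      (σ (m + 1)) c) :
    (unary k F).Runs (σ 0) (Function.update (σ n) k w) (n * (c + 1) + 1) := by
  induction n generalizing σ with
  | zero => exact (Runs.unary_false (by simpa using hk 0 le_rfl)).mono (by omega)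
  | succ n ih =>
    have h0 := h 0 (by omega)
    have h1 := ih (fun m => σ (m + 1))
      (fun m hm => by simpa [Nat.add_sub_add_right] using hk (m + 1) (by omega))
      (fun m hm => by simpa [Nat.add_sub_add_right] using h (m + 1) (by omega))
    refine (Runs.unary_true (w := ones n ++ false :: w) ?_ (by simpa using h0) h1).mono ?_
    · simpa [ones_succ] using hk 0 (by omega)
    · rw [Nat.add_mul]; omega

/-- Empty the stack `k`. -/
def discard (k : κ) : Fragment κ M := loop k fun _ => skip

theorem runs_discard (k : κ) :
    (discard k : Fragment κ M).Runs S (Function.update S k []) (2 * (S k).length + 1) := by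
  generalize hw : S k = w
  induction w generalizing S with
  | nil =>
    refine (Runs.loop_nil hw).congr rfl ?_ (by simp)
    rw [← hw]; simp
  | cons b w ih =>
    have := ih (S := Function.update S k w) (by simp)
    refine (Runs.loop_cons hw runs_skip this).congr rfl (by simp) (by simp; omega)

/-- Move the content of the stack `a` to the stack `b`, in reverse order. -/
def move (a b : κ) : Fragment κ M := loop a fun c => push b c

theorem runs_move {a b : κ} (hab : a ≠ b) :
    (move a b : Fragment κ M).Runs S
      (Function.update (Function.update S a []) b ((S a).reverse ++ S b))
      (2 * (S a).length + 1) := by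
  generalize hw : S a = w
  induction w generalizing S with
  | nil =>
    have hu : Function.update S a [] = S := by rw [← hw]; simp
    exact (Runs.loop_nil hw).congr rfl (by simp [hu]) (by simp)
  | cons c w ih =>
    have := ih (S := Function.update (Function.update S a w) b
      (c :: Function.update S a w b)) (by simp [hab])
    refine (Runs.loop_cons hw (runs_push b c) this).congr rfl ?_ (by simp; omega)
    funext j
    by_cases hb : j = b
    · subst hb; simp [hab.symm]
    · by_cases ha : j = a
      · subst ha; simp [hab]
      · simp [ha, hb]

/-- Push the symbols of `w`, the first one first. -/
def pushList (k : κ) : List Bool → Fragment κ M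
  | [] => skip
  | b :: w => (push k b).seq (pushList k w)

theorem runs_pushList (k : κ) (w : List Bool) :
    (pushList k w : Fragment κ M).Runs S (Function.update S k (w.reverse ++ S k))
      (w.length + 1) := by
  induction w generalizing S with
  | nil => exact runs_skip.congr rfl (by simp) le_rfl
  | cons b w ih => exact ((runs_push k b).seq ih).congr rfl (by simp) (by simp; omega)

/-- Push on the stack `o` as many symbols `true` as there are symbols on the stack `k`. -/
def copy (k tmp o : κ) : Fragment κ M :=
  (loop k fun c => (push tmp c).seq (push o true)).seq (move tmp k)

theorem runs_copy {k tmp o : κ} (hkt : k ≠ tmp) (hko : k ≠ o) (hto : tmp ≠ o)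
    (htmp : S tmp = []) :
    (copy k tmp o : Fragment κ M).Runs S (Function.update S o (ones (S k).length ++ S o))
      (5 * (S k).length + 2) := by
  have key : ∀ (w : List Bool) (S : κ → List Bool), S k = w →
      (loop k fun c => (push tmp c).seq (push o true) : Fragment κ M).Runs S
        (Function.update (Function.update (Function.update S k []) tmp (w.reverse ++ S tmp)) o
          (ones w.length ++ S o)) (3 * w.length + 1) := by
    intro w
    induction w with
    | nil =>
      intro S hw
      have hu : Function.update S k [] = S := by rw [← hw]; simp
      exact (Runs.loop_nil hw).congr rfl (by simp [hu]) (by simp)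
    | cons c w ih =>
      intro S hw
      refine (Runs.loop_cons hw ((runs_push tmp c).seq (runs_push o true))
        (ih _ (by simp [hkt, hko]))).congr rfl ?_ (by simp; omega)
      funext j
      by_cases h1 : j = o
      · subst h1
        simp [hko.symm, hto.symm, List.replicate_succ', List.append_assoc]
      · by_cases h2 : j = tmp
        · subst h2; simp [hkt.symm, hto]
        · by_cases h3 : j = k
          · subst h3; simp [hko, hkt]
          · simp [h1, h2, h3]
  -- The second reversal restores the order on `k`; this needs `tmp` to be empty at the start.
  refine ((key _ S rfl).seq (runs_move hkt.symm)).congr rfl ?_ ?_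
  · funext j
    by_cases h1 : j = o
    · subst h1
      simp [hko.symm, hto.symm]
    · by_cases h2 : j = tmp
      · subst h2; simp [hkt.symm, hto, htmp]
      · by_cases h3 : j = k
        · subst h3; simp [hko, hkt, hto, htmp]
        · simp [h1, h2, h3]
  · simp [hto, htmp]; omega

/-- Push a text with unary counters on the stack `o`. -/
def emit (tmp o : κ) : List (Bool ⊕ κ) → Fragment κ M
  | [] => skip
  | .inl b :: w => (push o b).seq (emit tmp o w)
  | .inr k :: w => (copy k tmp o).seq (emit tmp o w)

/-- The text that is described by a template, each stack standing for its length in unary. -/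
def textOf (S : κ → List Bool) (w : List (Bool ⊕ κ)) : List Bool :=
  w.flatMap (Sum.elim (fun b => [b]) fun k => ones (S k).length)

theorem runs_emit {tmp o : κ} (hto : tmp ≠ o) (w : List (Bool ⊕ κ)) (B : ℕ)
    (htmp : S tmp = []) (hw : ∀ k, .inr k ∈ w → k ≠ tmp ∧ k ≠ o ∧ (S k).length ≤ B) :
    (emit tmp o w : Fragment κ M).Runs S (Function.update S o ((textOf S w).reverse ++ S o))
      (w.length * (5 * B + 2) + 1) := by
  induction w generalizing S with
  | nil => exact runs_skip.congr rfl (by simp [textOf]) (by simp)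
  | cons a w ih =>
    have hT : ∀ x, textOf (Function.update S o x) w = textOf S w := by
      intro x
      refine List.flatMap_congr fun a ha => ?_
      rcases a with b | k
      · rfl
      · simp [(hw k (by simp [ha])).2.1]
    have hi := fun x => ih (S := Function.update S o x) (by simp [hto, htmp])
      (fun k hk => by
        have := hw k (by simp [hk])
        refine ⟨this.1, this.2.1, ?_⟩
        simpa [this.2.1] using this.2.2)
    rcases a with b | k
    · refine ((runs_push o b).seq (hi _)).congr rfl ?_ ?_
      · rw [hT]
        simp [textOf]
      · simp only [List.length_cons, Nat.add_mul]; omega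
    · obtain ⟨h1, h2, h3⟩ := hw k (by simp)
      refine ((runs_copy h1 h2 hto htmp).seq (hi _)).congr rfl ?_ ?_
      · rw [hT]
        simp [textOf]
      · simp only [List.length_cons, Nat.add_mul]; omega

/-- Run `F` as often as there are symbols on the stack `k`, whose content is saved. -/
def forEach (k save : κ) (F : Fragment κ M) : Fragment κ M :=
  (loop k fun _ => (push save true).seq F).seq (move save k)

/-- Separating the number `m` of completed rounds from the contents `r` and `s` of the counter and
its backup lets such loops be nested. A round costs four steps besides the body: one to pop, one to
save and two to move the symbol back. -/
theorem runs_forEach {k save : κ} {F : Fragment κ M} (hks : k ≠ save) {n c : ℕ}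
    (σ : ℕ → List Bool → List Bool → κ → List Bool)
    (hk : ∀ m r s, σ m r s k = r) (hs : ∀ m r s, σ m r s save = s)
    (huk : ∀ m r s r', Function.update (σ m r s) k r' = σ m r' s)
    (hus : ∀ m r s s', Function.update (σ m r s) save s' = σ m r s')
    (h : ∀ m < n, ∀ r s, F.Runs (σ m r s) (σ (m + 1) r s) c) :
    (forEach k save F).Runs (σ 0 (ones n) []) (σ n (ones n) []) (n * (c + 4) + 2) := by
  have h1 : (loop k fun _ => (push save true).seq F : Fragment κ M).Runs
      (σ 0 (ones (n - 0)) (ones 0)) (σ n (ones (n - n)) (ones n)) (n * (1 + c + 1) + 1) := by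
    refine runs_loop_ones (fun m => σ m (ones (n - m)) (ones m)) (fun m _ => hk _ _ _) ?_
    intro m hm
    rw [huk]
    refine ((runs_push save true).congr rfl ?_ le_rfl).seq
      (h m hm (ones (n - m - 1)) (ones (m + 1)))
    rw [hus, hs]; rfl
  refine (h1.seq (runs_move hks.symm)).congr (by simp) ?_ ?_
  · rw [hus, huk, hs, hk]; simp
  · rw [hs, List.length_replicate]; ring_nf; omega

end Fragment

end MultiMerlin

/-! ### Computing the size parameters in unary -/

noncomputable section

namespace MultiMerlin

open Turing

/-! ### Programs with twelve stacks -/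

/-- The stacks with the given contents. -/
def stk (a b c d e f g h i j k l : List Bool) : Fin 12 → List Bool :=
  ![a, b, c, d, e, f, g, h, i, j, k, l]

section

variable (a b c d e f g h i j k l x : List Bool)

@[simp] theorem stk_0 : stk a b c d e f g h i j k l 0 = a := rfl
@[simp] theorem stk_1 : stk a b c d e f g h i j k l 1 = b := rfl
@[simp] theorem stk_2 : stk a b c d e f g h i j k l 2 = c := rfl
@[simp] theorem stk_3 : stk a b c d e f g h i j k l 3 = d := rfl
@[simp] theorem stk_4 : stk a b c d e f g h i j k l 4 = e := rfl
@[simp] theorem stk_5 : stk a b c d e f g h i j k l 5 = f := rfl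
@[simp] theorem stk_6 : stk a b c d e f g h i j k l 6 = g := rfl
@[simp] theorem stk_7 : stk a b c d e f g h i j k l 7 = h := rfl
@[simp] theorem stk_8 : stk a b c d e f g h i j k l 8 = i := rfl
@[simp] theorem stk_9 : stk a b c d e f g h i j k l 9 = j := rfl
@[simp] theorem stk_10 : stk a b c d e f g h i j k l 10 = k := rfl
@[simp] theorem stk_11 : stk a b c d e f g h i j k l 11 = l := rfl

@[simp] theorem update_stk_0 :
    Function.update (stk a b c d e f g h i j k l) 0 x = stk x b c d e f g h i j k l := by
  funext z; fin_cases z <;> rfl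
@[simp] theorem update_stk_1 :
    Function.update (stk a b c d e f g h i j k l) 1 x = stk a x c d e f g h i j k l := by
  funext z; fin_cases z <;> rfl
@[simp] theorem update_stk_2 :
    Function.update (stk a b c d e f g h i j k l) 2 x = stk a b x d e f g h i j k l := by
  funext z; fin_cases z <;> rfl
@[simp] theorem update_stk_3 :
    Function.update (stk a b c d e f g h i j k l) 3 x = stk a b c x e f g h i j k l := by
  funext z; fin_cases z <;> rfl
@[simp] theorem update_stk_4 :
    Function.update (stk a b c d e f g h i j k l) 4 x = stk a b c d x f g h i j k l := by
  funext z; fin_cases z <;> rfl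
@[simp] theorem update_stk_5 :
    Function.update (stk a b c d e f g h i j k l) 5 x = stk a b c d e x g h i j k l := by
  funext z; fin_cases z <;> rfl
@[simp] theorem update_stk_6 :
    Function.update (stk a b c d e f g h i j k l) 6 x = stk a b c d e f x h i j k l := by
  funext z; fin_cases z <;> rfl
@[simp] theorem update_stk_7 :
    Function.update (stk a b c d e f g h i j k l) 7 x = stk a b c d e f g x i j k l := by
  funext z; fin_cases z <;> rfl
@[simp] theorem update_stk_8 :
    Function.update (stk a b c d e f g h i j k l) 8 x = stk a b c d e f g h x j k l := by
  funext z; fin_cases z <;> rfl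
@[simp] theorem update_stk_9 :
    Function.update (stk a b c d e f g h i j k l) 9 x = stk a b c d e f g h i x k l := by
  funext z; fin_cases z <;> rfl
@[simp] theorem update_stk_10 :
    Function.update (stk a b c d e f g h i j k l) 10 x = stk a b c d e f g h i j x l := by
  funext z; fin_cases z <;> rfl
@[simp] theorem update_stk_11 :
    Function.update (stk a b c d e f g h i j k l) 11 x = stk a b c d e f g h i j k x := by
  funext z; fin_cases z <;> rfl

end

/-- The length of the binary representation of `n`. -/
def binaryLength (n : ℕ) : ℕ := if n = 0 then 0 else binaryLength (n / 2) + 1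

theorem binaryLength_zero : binaryLength 0 = 0 := by rw [binaryLength]; simp

theorem binaryLength_succ (n : ℕ) : binaryLength (n + 1) = binaryLength ((n + 1) / 2) + 1 := by
  conv_lhs => rw [binaryLength]
  simp

theorem lt_two_pow_binaryLength (n : ℕ) : n < 2 ^ binaryLength n := by
  induction n using Nat.strong_induction_on with
  | _ n ih =>
    rcases n with _ | n
    · simp [binaryLength_zero]
    · have := ih ((n + 1) / 2) (by omega)
      rw [binaryLength_succ, pow_succ]
      omega

theorem two_pow_binaryLength_le (n : ℕ) : 2 ^ binaryLength n ≤ 2 * n + 1 := by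
  have key : ∀ n, 0 < n → 2 ^ binaryLength n ≤ 2 * n := by
    intro n
    induction n using Nat.strong_induction_on with
    | _ n ih =>
      intro hn
      obtain ⟨n, rfl⟩ := Nat.exists_eq_succ_of_ne_zero hn.ne'
      rw [Nat.succ_eq_add_one, binaryLength_succ, pow_succ]
      rcases Nat.eq_zero_or_pos ((n + 1) / 2) with h | h
      · rw [h, binaryLength_zero]; omega
      · have := ih ((n + 1) / 2) (by omega) h
        omega
  rcases Nat.eq_zero_or_pos n with h | h
  · simp [h, binaryLength_zero]
  · exact (key n h).trans (by omega)

theorem binaryLength_le (n : ℕ) : binaryLength n ≤ n := by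
  induction n using Nat.strong_induction_on with
  | _ n ih =>
    rcases n with _ | n
    · simp [binaryLength_zero]
    · rw [binaryLength_succ]
      have := ih ((n + 1) / 2) (by omega)
      omega

namespace Fragment

variable {M : TM2ComputableAux Bool Bool}
variable {a b c d e f g h i j k l w x acc : List Bool} {n m N L t t' : ℕ}

/-! #### Parameters -/

/-- Read the input, and push it reversed on the stack `7`, and its length on `5` and `6`. -/
def readInput : Fragment (Fin 12) M :=
  loop 0 fun b => (push 7 b).seq ((push 5 true).seq (push 6 true))

theorem runs_readInput :
    (readInput : Fragment (Fin 12) M).Runs (stk x b c d e (ones n) (ones m) h i j k l)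
      (stk [] b c d e (ones (x.length + n)) (ones (x.length + m)) (x.reverse ++ h) i j k l)
      (4 * x.length + 1) := by
  induction x generalizing n m h with
  | nil => exact (Runs.loop_nil (by simp)).congr rfl (by simp) (by simp)
  | cons y x ih =>
    refine (Runs.loop_cons (b := y) (w := x) (by simp) (((runs_push 7 y).seq ((runs_push 5 true).seq
      (runs_push 6 true))).congr rfl ?_ le_rfl) (ih (n := n + 1) (m := m + 1) (h := y :: h))).congr
      rfl ?_ ?_
    · simp [ones_succ]
    · simp only [List.length_cons, List.reverse_cons, List.append_assoc, List.singleton_append]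
      rw [show x.length + (n + 1) = x.length + 1 + n by ring,
        show x.length + (m + 1) = x.length + 1 + m by ring]
    · simp; omega

/-- Halve the unary number on the stack `5`, rounding up, with the result on the stack `8`. -/
def halve : Fragment (Fin 12) M :=
  loop 5 fun _ => (push 8 true).seq (cases 5 skip fun _ => skip)

theorem runs_halve :
    (halve : Fragment (Fin 12) M).Runs (stk a b c d e (ones n) g h (ones m) j k l)
      (stk a b c d e [] g h (ones ((n + 1) / 2 + m)) j k l) (4 * n + 1) := by
  induction n using Nat.strong_induction_on generalizing m with
  | _ n ih =>
    rcases n with _ | _ | n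
    · exact (Runs.loop_nil (by simp)).congr rfl (by simp) (by simp)
    · have h1 : ((push 8 true).seq (cases 5 skip fun _ => skip) : Fragment (Fin 12) M).Runs
          (stk a b c d e [] g h (ones m) j k l) (stk a b c d e [] g h (ones (m + 1)) j k l) 3 :=
        Runs.to (Runs.seq (runs_push 8 true) (Runs.cases_nil (by simp) runs_skip))
          (by simp [ones_succ]) le_rfl
      refine Runs.to (Runs.loop_cons (b := true) (w := []) (by rfl)
        (h1.congr (by simp) rfl le_rfl) (Runs.loop_nil (by simp))) ?_ (by omega)
      simp [Nat.add_comm 1 m]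
    · have h1 : ((push 8 true).seq (cases 5 skip fun _ => skip) : Fragment (Fin 12) M).Runs
          (stk a b c d e (ones (n + 1)) g h (ones m) j k l)
          (stk a b c d e (ones n) g h (ones (m + 1)) j k l) 3 :=
        Runs.to (Runs.seq (runs_push 8 true) (Runs.cases_cons (b := true) (w := ones n)
          (by simp [ones_succ]) runs_skip)) (by simp [ones_succ]) le_rfl
      refine Runs.to (Runs.loop_cons (b := true) (w := ones (n + 1)) (by rfl)
        (h1.congr (by simp) rfl le_rfl) (ih n (by omega))) ?_ (by omega)
      · rw [show (n + 1) / 2 + (m + 1) = (n + 1 + 1 + 1) / 2 + m by omega]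

/-- Push `r` times the binary length of the unary number on the stack `5` on the stack `3`; the
length of the stack `6` bounds the number of rounds. -/
def logLoop (r : ℕ) : Fragment (Fin 12) M :=
  loop 6 fun _ => cases 5 skip fun _ => (pushList 3 (ones r)).seq (halve.seq (move 8 5))

/-- The stack `6` is fuel. By `hn` the halving reaches zero before it runs out, and the rounds that
are left do nothing. In applications the fuel is `n` itself, by `binaryLength_le`. -/
theorem runs_logLoop {r B : ℕ} (hn : binaryLength n ≤ m) (hB : n ≤ B) :
    (logLoop r : Fragment (Fin 12) M).Runs (stk a b c (ones L) e (ones n) (ones m) h [] j k l)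
      (stk a b c (ones (r * binaryLength n + L)) e [] [] h [] j k l)
      (m * (r + 6 * B + 8) + 1) := by
  induction m generalizing n L with
  | zero =>
    have h0 : n = 0 := by
      rcases n with _ | n
      · rfl
      · rw [binaryLength_succ] at hn; omega
    subst h0
    refine (Runs.loop_nil (by simp)).congr rfl ?_ (by simp)
    simp [binaryLength_zero]
  | succ m ih =>
    rcases n with _ | n
    · refine Runs.to (Runs.loop_cons (b := true) (w := ones m) (by rfl)
        (Runs.cases_nil (by simp) runs_skip)
        ((ih (n := 0) (L := L) (by simp [binaryLength_zero]) (by omega)).congr (by simp) rfl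
          le_rfl)) rfl ?_
      rw [Nat.add_mul]; omega
    -- The test for zero has popped one symbol, so `halve`, which rounds `n / 2` up, produces half
    -- of `n + 1` rounded down, as in `binaryLength_succ`.
    · rw [binaryLength_succ] at hn
      have h1 : ((pushList 3 (ones r)).seq (halve.seq (move 8 5)) : Fragment (Fin 12) M).Runs
          (stk a b c (ones L) e (ones n) (ones m) h [] j k l)
          (stk a b c (ones (r + L)) e (ones ((n + 1) / 2)) (ones m) h [] j k l)
          (r + 6 * B + 5) := by
        refine Runs.to (Runs.seq (Runs.to (R' := stk a b c (ones (r + L)) e (ones n) (ones m) h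
          (ones 0) j k l) (t' := r + 1) (runs_pushList 3 (ones r)) (by simp) (by simp))
          (Runs.seq runs_halve (runs_move (a := 8) (b := 5) (by decide)))) (by simp) ?_
        simp only [stk_8, List.length_replicate]
        omega
      refine Runs.to (Runs.loop_cons (b := true) (w := ones m) (by rfl)
        (Runs.cases_cons (b := true) (w := ones n) (by rfl) (h1.congr (by simp) rfl le_rfl))
        (ih (n := (n + 1) / 2) (L := r + L) (by omega) (by omega))) ?_ ?_
      · rw [binaryLength_succ, show r * binaryLength ((n + 1) / 2) + (r + L) =
          r * (binaryLength ((n + 1) / 2) + 1) + L by ring]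
      · rw [Nat.add_mul]; omega

/-- From `L` on the stack `3`, compute `4 * L` on the stack `3` and `2 ^ L` on `4` and `10`. -/
def powerLoop : Fragment (Fin 12) M :=
  (push 4 true).seq <| (loop 3 fun _ => (pushList 9 (ones 4)).seq <|
    (loop 4 fun _ => pushList 8 (ones 2)).seq (move 8 4)).seq <| (move 9 3).seq (copy 4 8 10)

/-- Each round doubles the stack `4` and puts four symbols on `9`. At the end `9` supplies the
number `4 * L` of coins, and `10` receives a second copy of `N = 2 ^ L`, so that loops over blocks
and over the qubits of a block can be nested. -/
theorem runs_powerLoop :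
    (powerLoop : Fragment (Fin 12) M).Runs (stk a b c (ones L) [] f g h [] [] [] l)
      (stk a b c (ones (4 * L)) (ones (2 ^ L)) f g h [] [] (ones (2 ^ L)) l)
      (L * (8 * 2 ^ L + 8) + 8 * L + 5 * 2 ^ L + 6) := by
  have h1 : (loop 3 fun _ => (pushList 9 (ones 4)).seq <|
      (loop 4 fun _ => pushList 8 (ones 2)).seq (move 8 4) : Fragment (Fin 12) M).Runs
      (stk a b c (ones (L - 0)) (ones (2 ^ 0)) f g h [] (ones (4 * 0)) [] l)
      (stk a b c (ones (L - L)) (ones (2 ^ L)) f g h [] (ones (4 * L)) [] l)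
      (L * (5 + (4 * 2 ^ L + 1 + (4 * 2 ^ L + 1)) + 1) + 1) := by
    refine runs_loop_ones
      (fun m => stk a b c (ones (L - m)) (ones (2 ^ m)) f g h [] (ones (4 * m)) [] l)
      (fun m _ => rfl) ?_
    intro m hm
    have hp : 2 ^ (m + 1) ≤ 2 ^ L := Nat.pow_le_pow_right (by norm_num) hm
    rw [pow_succ] at hp
    rw [update_stk_3]
    have h2 : (loop 4 fun _ => pushList 8 (ones 2) : Fragment (Fin 12) M).Runs
        (stk a b c (ones (L - m - 1)) (ones (2 ^ m - 0)) f g h (ones (2 * 0)) (ones (4 * (m + 1))) [] l)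
        (stk a b c (ones (L - m - 1)) (ones (2 ^ m - 2 ^ m)) f g h (ones (2 * 2 ^ m)) (ones (4 * (m + 1))) [] l)
        (2 ^ m * (3 + 1) + 1) := by
      refine runs_loop_ones
        (fun z => stk a b c (ones (L - m - 1)) (ones (2 ^ m - z)) f g h (ones (2 * z)) (ones (4 * (m + 1))) [] l)
        (fun m _ => rfl) ?_
      intro z hz
      refine (runs_pushList 8 (ones 2)).congr rfl ?_ (by simp)
      simp only [update_stk_4, update_stk_8, stk_8, List.reverse_replicate, ones_append]
      rw [show 2 + 2 * z = 2 * (z + 1) by ring, Nat.sub_sub (2 ^ m)]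
    refine Runs.to (Runs.seq (Runs.to (t' := 5) (runs_pushList 9 (ones 4)) ?_ (by simp))
      (h2.seq (runs_move (a := 8) (b := 4) (by decide)))) ?_ ?_
    · simp only [update_stk_9, stk_9, List.reverse_replicate, ones_append]
      rw [show 4 + 4 * m = 4 * (m + 1) by ring]
      simp
    · simp [pow_succ, Nat.mul_comm, Nat.sub_sub]
    · simp only [stk_8, List.length_replicate]; omega
  refine (((runs_push 4 true).congr rfl ?_ le_rfl).seq (h1.seq
    ((runs_move (a := 9) (b := 3) (by decide)).seq
      (runs_copy (k := 4) (tmp := 8) (o := 10) (by decide) (by decide) (by decide) ?_)))).congr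
    rfl ?_ ?_
  · simp
  · simp
  · simp
  · simp; ring_nf; omega

end Fragment

end MultiMerlin

noncomputable section

namespace MultiMerlin

open Turing

/-! ### Descriptions of relabelled circuits -/

/-- The description of the work qubit `p`. -/
def workText (p : ℕ) : List Bool := false :: describeNat p

/-- The description of the qubit `u` of the quantum proof `c`. -/
def proofText (c u : ℕ) : List Bool := true :: (describeNat c ++ describeNat u)

/-- The description of a qubit after all the `k` quantum proofs, seen as blocks of `N` qubits, have
been put in one, and the work qubits have been spread out. -/
def relabelText {v k m : ℕ} (N : ℕ) : Qubit v k m → List Bool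
  | .inl i => workText (5 * i + 5)
  | .inr (j, i) => proofText 0 (i + N * j)

/-- The kind of a gate, as it appears in its description. -/
def Gate.kind {Q : Type} : Gate Q → ℕ
  | .pauliX _ => 0
  | .hadamard _ => 1
  | .phaseT _ => 2
  | .cnot _ _ _ => 3
  | .toffoli _ _ _ _ _ _ => 4

/-- The operands of a gate. -/
def Gate.operands {Q : Type} : Gate Q → List Q
  | .pauliX t => [t]
  | .hadamard t => [t]
  | .phaseT t => [t]
  | .cnot c t _ => [c, t]
  | .toffoli c₁ c₂ t _ _ _ => [c₁, c₂, t]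

/-- This uniform shape, a unary kind followed by operands, lets one program decode all gates. -/
theorem describeGate_eq {v k m : ℕ} (G : Gate (Qubit v k m)) :
    describeGate G = describeNat G.kind ++ G.operands.flatMap describeQubit := by
  cases G <;> simp [describeGate, Gate.kind, Gate.operands]

/-- The description of a gate after relabelling. -/
def relabelGateText {v k m : ℕ} (N : ℕ) (G : Gate (Qubit v k m)) : List Bool :=
  describeNat G.kind ++ G.operands.flatMap (relabelText N)

namespace Fragment

variable {M : TM2ComputableAux Bool Bool}
variable {a b c d e f g h i j k l w x acc : List Bool} {n m N L t t' : ℕ}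

/-- Relabel a qubit: read its description from the stack `7`, and push the new description on the
stack `2`; the stack `4` contains `N`. -/
def relabelQubit : Fragment (Fin 12) M :=
  cases 7 skip fun b => match b with
    | false => (push 2 false).seq <| (unary 7 (pushList 2 (ones 5))).seq <|
        pushList 2 (ones 5 ++ [false])
    | true => (pushList 2 [true, false]).seq <| (unary 7 (copy 4 8 2)).seq <|
        (unary 7 (push 2 true)).seq (push 2 false)

/-- In unary the new indices need no arithmetic: `5 * i` arises by pushing five symbols for each one
read, and `N * j` by copying the stack `4` for each one read. -/
theorem runs_relabelQubit {v k' m' : ℕ} (q : Qubit v k' m') :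
    (relabelQubit : Fragment (Fin 12) M).Runs
      (stk a b acc d (ones N) f g (describeQubit q ++ w) [] j k l)
      (stk a b ((relabelText N q).reverse ++ acc) d (ones N) f g w [] j k l)
      ((describeQubit q).length * (5 * N + 10)) := by
  rcases q with p | ⟨r, p⟩
  · have h1 : (unary 7 (pushList 2 (ones 5)) : Fragment (Fin 12) M).Runs
        (stk a b (ones (5 * 0) ++ false :: acc) d (ones N) f g
          (ones (p - 0) ++ false :: w) [] j k l)
        (Function.update (stk a b (ones (5 * p) ++ false :: acc) d (ones N) f g
          (ones (p - p) ++ false :: w) [] j k l) 7 w)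
        (p * (6 + 1) + 1) := by
      refine runs_unary_ones (fun z => stk a b (ones (5 * z) ++ false :: acc) d (ones N) f g
          (ones (p - z) ++ false :: w) [] j k l) (fun _ _ => rfl) ?_
      intro z hz
      refine Runs.to (runs_pushList 2 (ones 5)) ?_ (by simp)
      simp only [update_stk_7, update_stk_2, stk_2, List.reverse_replicate, ← List.append_assoc,
        ones_append]
      rw [show 5 + 5 * z = 5 * (z + 1) by ring, Nat.sub_sub]
    refine Runs.to (Runs.cases_cons (b := false) (w := ones p ++ false :: w) ?_ (Runs.seq
      (Runs.to (runs_push 2 false) ?_ le_rfl) (Runs.seq h1 (runs_pushList 2 _)))) ?_ ?_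
    · simp [describeQubit, describeNat]
    · simp
    · simp only [update_stk_7, update_stk_2, stk_2, relabelText, workText, describeNat,
        List.reverse_append, List.reverse_cons, List.reverse_replicate, List.reverse_nil,
        List.nil_append, List.append_assoc, List.cons_append]
      rw [← List.append_assoc (ones 5), ones_append, Nat.add_comm 5]
    · simp [describeQubit, describeNat]
      nlinarith
  · have h1 : (unary 7 (copy 4 8 2) : Fragment (Fin 12) M).Runs
        (stk a b (ones (N * 0) ++ false :: true :: acc) d (ones N) f g
          (ones (r - 0) ++ false :: (describeNat p ++ w)) [] j k l)
        (Function.update (stk a b (ones (N * r) ++ false :: true :: acc) d (ones N) f g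
          (ones (r - r) ++ false :: (describeNat p ++ w)) [] j k l) 7 (describeNat p ++ w))
        (r * (5 * N + 2 + 1) + 1) := by
      refine runs_unary_ones (fun z => stk a b (ones (N * z) ++ false :: true :: acc) d (ones N) f g
          (ones (r - z) ++ false :: (describeNat p ++ w)) [] j k l) (fun _ _ => rfl) ?_
      intro z hz
      refine Runs.to (runs_copy (by decide) (by decide) (by decide) (by simp)) ?_ (by simp)
      simp only [update_stk_7, update_stk_2, stk_2, stk_4, ← List.append_assoc,
        ones_append, List.length_replicate]
      rw [show N + N * z = N * (z + 1) by ring, Nat.sub_sub]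
    have h2 : (unary 7 (push 2 true) : Fragment (Fin 12) M).Runs
        (stk a b (ones (0 + N * r) ++ false :: true :: acc) d (ones N) f g
          (ones (p - 0) ++ false :: w) [] j k l)
        (Function.update (stk a b (ones (p + N * r) ++ false :: true :: acc) d (ones N) f g
          (ones (p - p) ++ false :: w) [] j k l) 7 w)
        (p * (1 + 1) + 1) := by
      refine runs_unary_ones (fun z => stk a b (ones (z + N * r) ++ false :: true :: acc) d (ones N)
          f g (ones (p - z) ++ false :: w) [] j k l) (fun _ _ => rfl) ?_
      intro z hz
      refine Runs.to (runs_push 2 true) ?_ le_rfl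
      simp only [update_stk_7, update_stk_2, stk_2]
      rw [show z + 1 + N * r = (z + N * r) + 1 by ring, ones_succ, Nat.sub_sub, List.cons_append]
    refine Runs.to (Runs.cases_cons (b := true) (w := ones r ++ false :: (describeNat p ++ w)) ?_
      (Runs.seq (Runs.to (t' := 3) (runs_pushList 2 _) ?_ (by simp)) (Runs.seq h1
        (Runs.seq (h2.congr ?_ rfl le_rfl) (runs_push 2 _))))) ?_ ?_
    · simp [describeQubit, describeNat]
    · simp
    · simp [describeNat]
    · simp [relabelText, proofText, describeNat]
    · simp [describeQubit, describeNat]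
      nlinarith

/-- Relabel `n` qubits. -/
def relabelQubits : ℕ → Fragment (Fin 12) M
  | 0 => skip
  | n + 1 => relabelQubit.seq (relabelQubits n)

theorem runs_relabelQubits {v k' m' : ℕ} (qs : List (Qubit v k' m')) :
    (relabelQubits qs.length : Fragment (Fin 12) M).Runs
      (stk a b acc d (ones N) f g (qs.flatMap describeQubit ++ w) [] j k l)
      (stk a b ((qs.flatMap (relabelText N)).reverse ++ acc) d (ones N) f g w [] j k l)
      ((qs.flatMap describeQubit).length * (5 * N + 10) + 1) := by
  induction qs generalizing acc with
  | nil => exact Runs.to (runs_skip.congr (by simp; rfl) rfl le_rfl) (by simp) (by simp)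
  | cons q qs ih =>
    refine Runs.to (Runs.seq ((runs_relabelQubit (acc := acc) q).congr ?_ rfl le_rfl) ih) ?_ ?_
    · simp
    · simp
    · simp only [List.flatMap_cons, List.length_append, Nat.add_mul]; omega

/-- Relabel a gate, the kind `i` of gates having `r[i]` operands. -/
def relabelGate : List ℕ → Fragment (Fin 12) M
  | [] => skip
  | n :: r => cases 7 skip fun b => match b with
    | true => (push 2 true).seq (relabelGate r)
    | false => (push 2 false).seq (relabelQubits n)

/-- Recursion on the list of arities decodes the kind: each `true` moves on to the next entry, and
`false` announces the operands. -/
theorem runs_relabelGate {v k' m' : ℕ} (qs : List (Qubit v k' m')) (r : List ℕ) (i : ℕ)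
    (hi : r[i]? = some qs.length) :
    (relabelGate r : Fragment (Fin 12) M).Runs
      (stk a b acc d (ones N) f g (describeNat i ++ qs.flatMap describeQubit ++ w) [] j k l)
      (stk a b ((describeNat i ++ qs.flatMap (relabelText N)).reverse ++ acc) d (ones N) f g w
        [] j k l)
      (2 * i + (qs.flatMap describeQubit).length * (5 * N + 10) + 3) := by
  induction r generalizing i acc with
  | nil => simp at hi
  | cons n r ih =>
    rcases i with _ | i
    · obtain rfl : n = qs.length := by simpa using hi
      refine Runs.to (Runs.cases_cons (b := false) (w := qs.flatMap describeQubit ++ w) ?_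
        (Runs.seq (Runs.to (R' := stk a b (false :: acc) d (ones N) f g
          (qs.flatMap describeQubit ++ w) [] j k l) (runs_push 2 false) ?_ le_rfl)
          (runs_relabelQubits qs))) ?_ ?_
      · simp [describeNat]
      · simp
      · simp [describeNat]
      · omega
    · refine Runs.to (Runs.cases_cons (b := true)
        (w := describeNat i ++ qs.flatMap describeQubit ++ w) ?_
        (Runs.seq (Runs.to (R' := stk a b (true :: acc) d (ones N) f g
          (describeNat i ++ qs.flatMap describeQubit ++ w) [] j k l) (runs_push 2 true) ?_ le_rfl)
          (ih i (by simpa using hi)))) ?_ ?_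
      · simp [describeNat, ones_succ]
      · simp
      · simp [describeNat, ones_succ]
      · omega

/-- Relabel the gates of a circuit: read its description from the stack `7`, and push the new
description on the stack `2`. -/
def relabelCircuit : Fragment (Fin 12) M :=
  loop 7 fun b => (push 7 b).seq (relabelGate [1, 1, 1, 2, 3])

theorem runs_relabelCircuit {v k' m' : ℕ} (C : Circuit (Qubit v k' m')) :
    (relabelCircuit : Fragment (Fin 12) M).Runs
      (stk a b acc d (ones N) f g (describeCircuit C) [] j k l)
      (stk a b ((C.flatMap (relabelGateText N)).reverse ++ acc) d (ones N) f g [] [] j k l)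
      ((describeCircuit C).length * (5 * N + 10) + 1) := by
  induction C generalizing acc with
  | nil =>
    exact Runs.to (Runs.loop_nil (by simp [describeCircuit])) (by simp [describeCircuit])
      (by simp)
  | cons G C ih =>
    have hG : describeGate G ++ describeCircuit C = describeCircuit (G :: C) := by
      simp [describeCircuit]
    -- The loop pops a symbol merely to detect the end of the description, and the body pushes it
    -- back.
    obtain ⟨y, w, hy⟩ : ∃ y w, describeCircuit (G :: C) = y :: w := by
      rw [← hG, describeGate_eq, describeNat]
      rcases G.kind with _ | _ <;> simp [ones_succ]
    refine Runs.to (Runs.loop_cons (b := y) (w := w) (by simpa using hy)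
      (Runs.seq (Runs.to (R' := stk a b acc d (ones N) f g (describeCircuit (G :: C)) [] j k l)
        (runs_push 7 y) ?_ le_rfl)
        ((runs_relabelGate (acc := acc) (w := describeCircuit C) G.operands [1, 1, 1, 2, 3] G.kind ?_).congr ?_
          rfl le_rfl)) ih) ?_ ?_
    · simp [hy]
    · cases G <;> rfl
    · rw [← hG, describeGate_eq]
    · simp [relabelGateText]
    · rw [← hG, describeGate_eq]
      have : 0 < (G.operands.flatMap describeQubit).length := by
        cases G <;> simp [Gate.operands, describeQubit, List.length_pos_iff] <;> split <;> simp
      simp only [List.length_append, describeNat, List.length_replicate, List.length_singleton]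
      nlinarith

end Fragment

end MultiMerlin

noncomputable section

namespace MultiMerlin

open Turing

/-! ### The description of the two-proof verification circuit -/

/-- The description of a Hadamard gate on each coin. -/
def coinText (i : ℕ) : List Bool := describeNat 1 ++ workText (5 * i + 3)

/-- The description of a swap of the qubits `u` of the two proofs, controlled by the `j`-th test
qubit. -/
def swapText (j u : ℕ) : List Bool :=
  (describeNat 3 ++ proofText 1 u ++ proofText 0 u) ++
    (describeNat 4 ++ workText (5 * j + 1) ++ proofText 0 u ++ proofText 1 u) ++
    (describeNat 3 ++ proofText 1 u ++ proofText 0 u)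

/-- The description of the swap test of the `j`-th blocks of the two proofs. -/
def testText (N j : ℕ) : List Bool :=
  (describeNat 1 ++ workText (5 * j + 1)) ++
    ((List.range N).flatMap fun i => swapText j (i + N * j)) ++
    ((describeNat 1 ++ workText (5 * j + 1)) ++ (describeNat 0 ++ workText (5 * j + 1)))

/-- The description of a step in the conjunction of the test qubits. -/
def testAndText (i : ℕ) : List Bool :=
  describeNat 4 ++ workText (5 * i + 2) ++ workText (5 * i + 1) ++ workText (5 * i + 7)

/-- The description of a step in the conjunction of the coins. -/
def coinAndText (i : ℕ) : List Bool :=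
  describeNat 4 ++ workText (5 * i + 4) ++ workText (5 * i + 3) ++ workText (5 * i + 9)

/-- The description of the gates between the two conjunctions. -/
def linkText (N : ℕ) : List Bool :=
  (describeNat 3 ++ workText (5 * N + 2) ++ workText 0) ++
    (describeNat 3 ++ workText (5 * N + 2) ++ workText 4)

/-- The description of the last gates. -/
def finalText (l : ℕ) : List Bool :=
  (describeNat 0 ++ workText 5) ++
    (describeNat 4 ++ workText (5 * l + 4) ++ workText 5 ++ workText 0)

/-- The description of the two-proof verification circuit that is made of a circuit with the
relabelled description `y`. -/
def twoProofText (N l : ℕ) (y : List Bool) : List Bool :=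
  (List.range l).flatMap coinText ++ (List.range N).flatMap (testText N) ++ y ++
    (describeNat 0 ++ workText 2) ++ (List.range N).flatMap testAndText ++ linkText N ++
    (List.range l).flatMap coinAndText ++ finalText l

namespace Fragment

variable {M : TM2ComputableAux Bool Bool}
variable {a b c d e f g h i j k l w x acc : List Bool} {n m N L t t' : ℕ}

/-! #### Templates -/

/-- A template for the number `n`. -/
def natTemplate (n : ℕ) : List (Bool ⊕ Fin 12) := List.replicate n (.inl true) ++ [.inl false]

/-- A template for the work qubit `5 * i + c`, where `i` is the length of the stack `5`. -/
def workTemplate (c : ℕ) : List (Bool ⊕ Fin 12) :=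
  .inl false :: (List.replicate 5 (.inr 5) ++ natTemplate c)

/-- A template for the work qubit `c`. -/
def constTemplate (c : ℕ) : List (Bool ⊕ Fin 12) := .inl false :: natTemplate c

/-- A template for the qubit `u` of the proof `c`, where `u` is the length of the stack `6`. -/
def proofTemplate (c : ℕ) : List (Bool ⊕ Fin 12) :=
  .inl true :: (natTemplate c ++ .inr 6 :: [.inl false])

variable {S : Fin 12 → List Bool}

theorem textOf_append (w w' : List (Bool ⊕ Fin 12)) :
    textOf S (w ++ w') = textOf S w ++ textOf S w' := by
  simp [textOf]

theorem textOf_natTemplate (n : ℕ) : textOf S (natTemplate n) = describeNat n := by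
  simp [textOf, natTemplate, describeNat, List.flatMap_replicate]

theorem textOf_workTemplate (c : ℕ) :
    textOf S (workTemplate c) = workText (5 * (S 5).length + c) := by
  have : textOf S (workTemplate c) = false :: (textOf S (List.replicate 5 (.inr 5)) ++
      textOf S (natTemplate c)) := by
    rw [← textOf_append]; rfl
  rw [this, textOf_natTemplate]
  simp only [textOf, List.flatMap_replicate, Sum.elim_inr, List.flatten_replicate_replicate,
    workText, describeNat, ← List.append_assoc, ones_append]

theorem textOf_constTemplate (c : ℕ) : textOf S (constTemplate c) = workText c := by
  have : textOf S (constTemplate c) = false :: textOf S (natTemplate c) := by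
    simp [textOf, constTemplate]
  rw [this, textOf_natTemplate, workText]

theorem textOf_proofTemplate (c : ℕ) :
    textOf S (proofTemplate c) = proofText c (S 6).length := by
  have : textOf S (proofTemplate c) = true :: (textOf S (natTemplate c) ++
      (ones (S 6).length ++ [false])) := by simp [textOf, proofTemplate]
  rw [this, textOf_natTemplate, proofText, describeNat, describeNat]

theorem mem_natTemplate {n : ℕ} {z : Fin 12} : .inr z ∈ natTemplate n ↔ False := by
  simp [natTemplate]

theorem mem_workTemplate {n : ℕ} {z : Fin 12} : .inr z ∈ workTemplate n ↔ z = 5 := by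
  simp [workTemplate, natTemplate]

theorem mem_constTemplate {n : ℕ} {z : Fin 12} : .inr z ∈ constTemplate n ↔ False := by
  simp [constTemplate, natTemplate]

theorem mem_proofTemplate {n : ℕ} {z : Fin 12} : .inr z ∈ proofTemplate n ↔ z = 6 := by
  simp [proofTemplate, natTemplate]

theorem length_template {n : ℕ} :
    (natTemplate n).length = n + 1 ∧ (workTemplate n).length = n + 7 ∧
      (constTemplate n).length = n + 2 ∧ (proofTemplate n).length = n + 4 := by
  simp [natTemplate, workTemplate, constTemplate, proofTemplate]

/-- A bound for the time to emit a short text. -/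
def emitTime (B : ℕ) : ℕ := 60 * (5 * B + 2) + 1

/-- Templates refer only to the counters `5` and `6`, so `hy` can be checked with all other stacks
empty. The bound `60` exceeds the length of the longest template, that of a controlled swap. -/
theorem runs_emit_stk {B : ℕ} (w : List (Bool ⊕ Fin 12)) {y : List Bool}
    (hw : ∀ z, .inr z ∈ w → z = 5 ∨ z = 6) (hl : w.length ≤ 60) (hn : n ≤ B) (hm : m ≤ B)
    (hy : textOf (stk [] [] [] [] [] (ones n) (ones m) [] [] [] [] []) w = y) :
    (emit 8 2 w : Fragment (Fin 12) M).Runs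
      (stk a b acc d e (ones n) (ones m) h [] j k l)
      (stk a b (y.reverse ++ acc) d e (ones n) (ones m) h [] j k l) (emitTime B) := by
  have h1 : ∀ z, .inr z ∈ w → z ≠ 8 ∧ z ≠ 2 ∧
      (stk a b acc d e (ones n) (ones m) h [] j k l z).length ≤ B := by
    intro z hz
    rcases hw z hz with rfl | rfl
    · exact ⟨by decide, by decide, by rw [stk_5, List.length_replicate]; exact hn⟩
    · exact ⟨by decide, by decide, by rw [stk_6, List.length_replicate]; exact hm⟩
  have h2 : textOf (stk a b acc d e (ones n) (ones m) h [] j k l) w = y := by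
    rw [← hy]
    refine List.flatMap_congr fun z hz => ?_
    rcases z with z | z
    · simp only [Sum.elim_inl]
    · rcases hw z hz with rfl | rfl
      · simp only [Sum.elim_inr, stk_5]
      · simp only [Sum.elim_inr, stk_6]
  have h3 : w.length * (5 * B + 2) + 1 ≤ emitTime B := by
    unfold emitTime
    gcongr
  have h4 := runs_emit (M := M) (by decide) w B (stk_8 a b acc d e (ones n) (ones m) h [] j k l) h1
  rw [h2, update_stk_2, stk_2] at h4
  exact h4.mono h3

/-- Emit a text for each value of the counter on the stack `5`, up to the length of the stack
`k`. -/
def emitEach (k : Fin 12) (w : List (Bool ⊕ Fin 12)) : Fragment (Fin 12) M :=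
  forEach k 9 ((emit 8 2 w).seq (push 5 true))

theorem runs_emitEach_three {B : ℕ} (w : List (Bool ⊕ Fin 12)) (y : ℕ → List Bool)
    (hw : ∀ z, .inr z ∈ w → z = 5 ∨ z = 6) (hl : w.length ≤ 60) (hn : n ≤ B)
    (hy : ∀ i, textOf (stk [] [] [] [] [] (ones i) [] [] [] [] [] []) w = y i) :
    (emitEach 3 w : Fragment (Fin 12) M).Runs
      (stk a b acc (ones n) e [] [] h [] [] k l)
      (stk a b (((List.range n).flatMap y).reverse ++ acc) (ones n) e (ones n) [] h [] [] k l)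
      (n * (emitTime B + 5) + 2) := by
  exact Runs.congr (runs_forEach (M := M) (F := (emit 8 2 w).seq (push 5 true)) (k := 3) (save := 9)
    (c := emitTime B + 1) (n := n) (by decide)
    (fun z r s => stk a b (((List.range z).flatMap y).reverse ++ acc) r e (ones z) (ones 0)
      h [] s k l) (fun _ _ _ => rfl) (fun _ _ _ => rfl) (fun _ _ _ _ => by simp)
    (fun _ _ _ _ => by simp)
    (fun z hz r s => Runs.to (Runs.seq
      (runs_emit_stk w hw hl (hz.le.trans hn) (Nat.zero_le B) (hy z)) (runs_push 5 true))
      (by simp [List.range_succ, ones_succ]) le_rfl)) (by simp) rfl le_rfl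

theorem runs_emitEach_four {B : ℕ} (w : List (Bool ⊕ Fin 12)) (y : ℕ → List Bool)
    (hw : ∀ z, .inr z ∈ w → z = 5 ∨ z = 6) (hl : w.length ≤ 60) (hn : n ≤ B)
    (hy : ∀ i, textOf (stk [] [] [] [] [] (ones i) [] [] [] [] [] []) w = y i) :
    (emitEach 4 w : Fragment (Fin 12) M).Runs
      (stk a b acc d (ones n) [] [] h [] [] k l)
      (stk a b (((List.range n).flatMap y).reverse ++ acc) d (ones n) (ones n) [] h [] [] k l)
      (n * (emitTime B + 5) + 2) := by
  exact Runs.congr (runs_forEach (M := M) (F := (emit 8 2 w).seq (push 5 true)) (k := 4) (save := 9)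
    (c := emitTime B + 1) (n := n) (by decide)
    (fun z r s => stk a b (((List.range z).flatMap y).reverse ++ acc) d r (ones z) (ones 0)
      h [] s k l) (fun _ _ _ => rfl) (fun _ _ _ => rfl) (fun _ _ _ _ => by simp)
    (fun _ _ _ _ => by simp)
    (fun z hz r s => Runs.to (Runs.seq
      (runs_emit_stk w hw hl (hz.le.trans hn) (Nat.zero_le B) (hy z)) (runs_push 5 true))
      (by simp [List.range_succ, ones_succ]) le_rfl)) (by simp) rfl le_rfl

/-- Emit the descriptions of the swap tests. -/
def emitTests : Fragment (Fin 12) M :=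
  (forEach 4 9 <| (emit 8 2 (natTemplate 1 ++ workTemplate 1)).seq <|
    (forEach 10 11 ((emit 8 2 ((natTemplate 3 ++ proofTemplate 1 ++ proofTemplate 0) ++
      (natTemplate 4 ++ workTemplate 1 ++ proofTemplate 0 ++ proofTemplate 1) ++
      (natTemplate 3 ++ proofTemplate 1 ++ proofTemplate 0))).seq (push 6 true))).seq <|
    (emit 8 2 ((natTemplate 1 ++ workTemplate 1) ++ (natTemplate 0 ++ workTemplate 1))).seq
      (push 5 true)).seq ((discard 5).seq (discard 6))

/-- The counter `6` is not reset between blocks. It stands at `N * j` when block `j` begins and so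
runs through the indices `i + N * j` without any multiplication; it ends at `N * N`, which explains
`hB`. -/
theorem runs_emitTests {B : ℕ} (hB : N * N ≤ B) :
    (emitTests : Fragment (Fin 12) M).Runs
      (stk a b acc d (ones N) [] [] h [] [] (ones N) [])
      (stk a b (((List.range N).flatMap (testText N)).reverse ++ acc) d (ones N) [] [] h [] []
        (ones N) [])
      (N * (2 * emitTime B + N * (emitTime B + 5) + 7) + 2 + (2 * N + 1 + (2 * (N * N) + 1))) := by
  have hNB : ∀ z < N, z ≤ B := fun z hz => by nlinarith
  have h1 : ∀ z < N, ∀ r s acc, (forEach 10 11 ((emit 8 2 ((natTemplate 3 ++ proofTemplate 1 ++ proofTemplate 0) ++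
      (natTemplate 4 ++ workTemplate 1 ++ proofTemplate 0 ++ proofTemplate 1) ++
      (natTemplate 3 ++ proofTemplate 1 ++ proofTemplate 0))).seq (push 6 true)) : Fragment (Fin 12) M).Runs
      (stk a b acc d r (ones z) (ones (N * z)) h [] s (ones N) [])
      (stk a b (((List.range N).flatMap fun i => swapText z (i + N * z)).reverse ++ acc) d r
        (ones z) (ones (N * (z + 1))) h [] s (ones N) [])
      (N * (emitTime B + 1 + 4) + 2) := by
    intro z hz r s acc
    refine Runs.congr (runs_forEach (M := M) (k := 10) (save := 11)
      (c := emitTime B + 1) (n := N) (by decide)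
      (fun q r' s' => stk a b (((List.range q).flatMap fun i => swapText z (i + N * z)).reverse ++ acc)
        d r (ones z) (ones (q + N * z)) h [] s r' s')
      (fun _ _ _ => rfl) (fun _ _ _ => rfl) (fun _ _ _ _ => by simp) (fun _ _ _ _ => by simp)
      (fun q hq r' s' => Runs.to (Runs.seq
        (runs_emit_stk (B := B) (y := swapText z (q + N * z)) _ ?_ ?_ ?_ ?_ ?_) (runs_push 6 true))
        ?_ le_rfl)) (by simp) ?_ le_rfl
    · intro z
      simp only [List.mem_append, mem_natTemplate, mem_workTemplate, mem_proofTemplate]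
      tauto
    · simp [length_template]
    · exact hNB z hz
    · nlinarith
    · simp [textOf_append, textOf_natTemplate, textOf_workTemplate, textOf_proofTemplate, swapText]
    · simp only [update_stk_6, stk_6, List.range_succ, List.flatMap_append, List.flatMap_cons,
        List.flatMap_nil, List.append_nil, List.reverse_append, List.append_assoc, ← ones_succ]
      rw [show q + N * z + 1 = q + 1 + N * z by ring]
    · rw [show N + N * z = N * (z + 1) by ring]
  have h2 := runs_forEach (M := M) (k := 4) (save := 9)
    (F := (emit 8 2 (natTemplate 1 ++ workTemplate 1)).seq <|
    (forEach 10 11 ((emit 8 2 ((natTemplate 3 ++ proofTemplate 1 ++ proofTemplate 0) ++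
      (natTemplate 4 ++ workTemplate 1 ++ proofTemplate 0 ++ proofTemplate 1) ++
      (natTemplate 3 ++ proofTemplate 1 ++ proofTemplate 0))).seq (push 6 true))).seq <|
    (emit 8 2 ((natTemplate 1 ++ workTemplate 1) ++ (natTemplate 0 ++ workTemplate 1))).seq
      (push 5 true))
    (c := emitTime B + ((N * (emitTime B + 1 + 4) + 2) + (emitTime B + 1))) (n := N) (by decide)
    (fun z r s => stk a b (((List.range z).flatMap (testText N)).reverse ++ acc) d r (ones z)
      (ones (N * z)) h [] s (ones N) [])
    (fun _ _ _ => rfl) (fun _ _ _ => rfl) (fun _ _ _ _ => by simp) (fun _ _ _ _ => by simp)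
    (fun z hz r s => Runs.to (Runs.seq
        (runs_emit_stk (B := B) (y := describeNat 1 ++ workText (5 * z + 1)) _ ?_ ?_ ?_ ?_ ?_)
        (Runs.seq (h1 z hz r s _) (Runs.seq (runs_emit_stk (B := B)
          (y := (describeNat 1 ++ workText (5 * z + 1)) ++ (describeNat 0 ++ workText (5 * z + 1)))
          _ ?_ ?_ ?_ ?_ ?_) (runs_push 5 true)))) ?_ le_rfl)
  · refine Runs.to (Runs.seq (h2.congr (by simp) rfl le_rfl)
      (Runs.seq (runs_discard 5) (runs_discard 6))) (by simp) ?_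
    simp only [update_stk_5, stk_5, stk_6, List.length_replicate]
    rw [show emitTime B + 1 + 4 = emitTime B + 5 by ring]
    gcongr ?_ + _ + _
    gcongr N * ?_
    omega
  · intro z
    simp only [List.mem_append, mem_natTemplate, mem_workTemplate]
    tauto
  · simp [length_template]
  · exact hNB z hz
  · nlinarith
  · simp [textOf_append, textOf_natTemplate, textOf_workTemplate]
  · intro z
    simp only [List.mem_append, mem_natTemplate, mem_workTemplate]
    tauto
  · simp [length_template]
  · exact hNB z hz
  · nlinarith
  · simp [textOf_append, textOf_natTemplate, textOf_workTemplate]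
  · simp [List.range_succ, testText, ones_succ]

end Fragment

end MultiMerlin

/-! ### Polynomial time bounds and the program that writes the whole circuit -/

noncomputable section

namespace MultiMerlin

open Turing

/-! ### Polynomial bounds -/

theorem eval_mono_nat (p : Polynomial ℕ) {m n : ℕ} (h : m ≤ n) :
    p.eval m ≤ p.eval n := by
  rw [Polynomial.eval_eq_sum, Polynomial.eval_eq_sum]
  exact Finset.sum_le_sum fun i _ => Nat.mul_le_mul_left _ (Nat.pow_le_pow_left h i)

/-- A function on bit strings that is bounded by a polynomial in the length. -/
def LengthBounded (t : List Bool → ℕ) : Prop :=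
  ∃ p : Polynomial ℕ, ∀ x, t x ≤ p.eval x.length

namespace LengthBounded

variable {s t : List Bool → ℕ}

theorem const (c : ℕ) : LengthBounded fun _ => c := ⟨.C c, fun _ => by simp⟩

theorem length : LengthBounded fun x => x.length := ⟨.X, fun _ => by simp⟩

theorem eval (p : Polynomial ℕ) : LengthBounded fun x => p.eval x.length := ⟨p, fun _ => le_rfl⟩

theorem add (hs : LengthBounded s) (ht : LengthBounded t) : LengthBounded fun x => s x + t x := by
  obtain ⟨p, hp⟩ := hs
  obtain ⟨q, hq⟩ := ht
  exact ⟨p + q, fun x => by simpa using add_le_add (hp x) (hq x)⟩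

theorem mul (hs : LengthBounded s) (ht : LengthBounded t) : LengthBounded fun x => s x * t x := by
  obtain ⟨p, hp⟩ := hs
  obtain ⟨q, hq⟩ := ht
  exact ⟨p * q, fun x => by simpa using Nat.mul_le_mul (hp x) (hq x)⟩

theorem mono (ht : LengthBounded t) (h : ∀ x, s x ≤ t x) : LengthBounded s := by
  obtain ⟨p, hp⟩ := ht
  exact ⟨p, fun x => (h x).trans (hp x)⟩

end LengthBounded

/-- A logarithmic function of `n`. -/
def logParam (r n : ℕ) : ℕ := r * binaryLength n + r

/-- Rounding `n` to a power of two costs only a constant factor, so for fixed `r` the number of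
blocks is polynomial in `n`. -/
theorem two_pow_logParam_le (r n : ℕ) : 2 ^ logParam r n ≤ (4 * n + 2) ^ r := by
  rw [logParam, show r * binaryLength n + r = (binaryLength n + 1) * r by ring, pow_mul]
  have := two_pow_binaryLength_le n
  gcongr
  rw [pow_succ]
  omega

theorem polynomiallyBounded_two_pow_logParam (r : ℕ) :
    PolynomiallyBounded fun n => 2 ^ logParam r n :=
  ⟨(4 * .X + 2) ^ r, fun n => by simpa using two_pow_logParam_le r n⟩

theorem polynomiallyBounded_logParam (r : ℕ) : PolynomiallyBounded (logParam r) := by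
  obtain ⟨p, hp⟩ := polynomiallyBounded_two_pow_logParam r
  exact ⟨p, fun n => Nat.lt_two_pow_self.le.trans (hp n)⟩

namespace LengthBounded

theorem comp_length {f : ℕ → ℕ} (hf : PolynomiallyBounded f) :
    LengthBounded fun x => f x.length := by
  obtain ⟨p, hp⟩ := hf
  exact ⟨p, fun x => hp _⟩

theorem comp {f : ℕ → ℕ} (hf : PolynomiallyBounded f) {t : List Bool → ℕ} (ht : LengthBounded t) :
    LengthBounded fun x => f (t x) := by
  obtain ⟨p, hp⟩ := hf
  obtain ⟨q, hq⟩ := ht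
  refine ⟨p.comp q, fun x => (hp _).trans ?_⟩
  rw [Polynomial.eval_comp]
  exact eval_mono_nat p (hq x)

theorem emitTime {s : List Bool → ℕ} (hs : LengthBounded s) :
    LengthBounded fun x => Fragment.emitTime (s x) :=
  ((const 60).mul (((const 5).mul hs).add (const 2))).add (const 1)

end LengthBounded

namespace Fragment

variable {M : TM2ComputableAux Bool Bool}

theorem oneStack_zero (x : List Bool) :
    oneStack (0 : Fin 12) x = stk x [] [] [] [] [] [] [] [] [] [] [] := by
  funext z; fin_cases z <;> rfl

theorem oneStack_one (x : List Bool) :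
    oneStack (1 : Fin 12) x = stk [] x [] [] [] [] [] [] [] [] [] [] := by
  funext z; fin_cases z <;> rfl

variable {a b c d e f g h i j k l acc : List Bool} {n : ℕ}

theorem runs_discard_three : (discard 3 : Fragment (Fin 12) M).Runs
    (stk a b c (ones n) e f g h i j k l) (stk a b c [] e f g h i j k l) (2 * n + 1) :=
  Runs.to (runs_discard 3) (by simp) (by simp)

theorem runs_discard_four : (discard 4 : Fragment (Fin 12) M).Runs
    (stk a b c d (ones n) f g h i j k l) (stk a b c d [] f g h i j k l) (2 * n + 1) :=
  Runs.to (runs_discard 4) (by simp) (by simp)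

theorem runs_discard_five : (discard 5 : Fragment (Fin 12) M).Runs
    (stk a b c d e (ones n) g h i j k l) (stk a b c d e [] g h i j k l) (2 * n + 1) :=
  Runs.to (runs_discard 5) (by simp) (by simp)

theorem runs_discard_ten : (discard 10 : Fragment (Fin 12) M).Runs
    (stk a b c d e f g h i j (ones n) l) (stk a b c d e f g h i j [] l) (2 * n + 1) :=
  Runs.to (runs_discard 10) (by simp) (by simp)

theorem runs_emit_stk_nil {B : ℕ} (w : List (Bool ⊕ Fin 12)) {y : List Bool}
    (hw : ∀ z, .inr z ∈ w → z = 5 ∨ z = 6) (hl : w.length ≤ 60) (hn : n ≤ B)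
    (hy : textOf (stk [] [] [] [] [] (ones n) [] [] [] [] [] []) w = y) :
    (emit 8 2 w : Fragment (Fin 12) M).Runs
      (stk a b acc d e (ones n) [] h [] j k l)
      (stk a b (y.reverse ++ acc) d e (ones n) [] h [] j k l) (emitTime B) :=
  runs_emit_stk (m := 0) w hw hl hn (Nat.zero_le B) hy

/-- Emit the description of a two-proof verification circuit, from the description of a circuit on
the stack `7`, and clean up. -/
def emitTwoProof : Fragment (Fin 12) M :=
  (emitEach 3 (natTemplate 1 ++ workTemplate 3)).seq <| (discard 5).seq <|
  emitTests.seq <| relabelCircuit.seq <| (emit 8 2 (natTemplate 0 ++ constTemplate 2)).seq <|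
  (emitEach 4 (natTemplate 4 ++ workTemplate 2 ++ workTemplate 1 ++ workTemplate 7)).seq <|
  (emit 8 2 ((natTemplate 3 ++ workTemplate 2 ++ constTemplate 0) ++
    (natTemplate 3 ++ workTemplate 2 ++ constTemplate 4))).seq <| (discard 5).seq <|
  (emitEach 3 (natTemplate 4 ++ workTemplate 4 ++ workTemplate 3 ++ workTemplate 9)).seq <|
  (emit 8 2 ((natTemplate 0 ++ constTemplate 5) ++
    (natTemplate 4 ++ workTemplate 4 ++ constTemplate 5 ++ constTemplate 0))).seq <|
  (discard 3).seq <| (discard 4).seq <| (discard 5).seq <| (discard 10).seq (move 2 1)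

/-- The text accumulates in reverse on the stack `2`, and the last move reverses it onto the output
stack. All other stacks are emptied, as the output convention requires. -/
theorem runs_emitTwoProof {v k m N l B : ℕ} (C : Circuit (Qubit v k m)) (hN : N * N ≤ B)
    (hl : l ≤ B) (y : List Bool) (hy : y = twoProofText N l (C.flatMap (relabelGateText N))) :
    (emitTwoProof : Fragment (Fin 12) M).Runs
      (stk [] [] [] (ones l) (ones N) [] [] (describeCircuit C) [] [] (ones N) [])
      (stk [] y [] [] [] [] [] [] [] [] [] [])
      (l * (emitTime B + 5) + 2 + (2 * l + 1 + (N * (2 * emitTime B + N * (emitTime B + 5) + 7) + 2 +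
        (2 * N + 1 + (2 * (N * N) + 1)) + ((describeCircuit C).length * (5 * N + 10) + 1 +
        (emitTime B + (N * (emitTime B + 5) + 2 + (emitTime B + (2 * N + 1 +
        (l * (emitTime B + 5) + 2 + (emitTime B + (2 * l + 1 + (2 * N + 1 + (2 * l + 1 +
        (2 * N + 1 + (2 * y.length + 1))))))))))))))) := by
  have hN' : N ≤ B := by nlinarith
  refine Runs.to (Runs.seq (runs_emitEach_three (B := B) _ coinText ?_ ?_ hl ?_)
    (Runs.seq runs_discard_five (Runs.seq (runs_emitTests hN)
    (Runs.seq (runs_relabelCircuit C) (Runs.seq (runs_emit_stk_nil (n := 0) (B := B)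
      (y := describeNat 0 ++ workText 2) _ ?_ ?_ ?_ ?_)
    (Runs.seq (runs_emitEach_four (B := B) _ testAndText ?_ ?_ hN' ?_)
    (Runs.seq (runs_emit_stk_nil (n := N) (B := B)
      (y := linkText N) _ ?_ ?_ hN' ?_)
    (Runs.seq runs_discard_five
    (Runs.seq (runs_emitEach_three (B := B) _ coinAndText ?_ ?_ hl ?_)
    (Runs.seq (runs_emit_stk_nil (n := l) (B := B)
      (y := finalText l) _ ?_ ?_ hl ?_)
    (Runs.seq runs_discard_three
    (Runs.seq runs_discard_four
    (Runs.seq runs_discard_five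
    (Runs.seq runs_discard_ten
      (Runs.to (R' := stk [] y [] [] [] [] [] [] [] [] [] []) (t' := 2 * y.length + 1)
        (runs_move (by decide)) ?_ ?_))))))))))))))) rfl le_rfl
  all_goals try first
    | exact Nat.zero_le _
    | (intro z
       simp only [List.mem_append, mem_natTemplate, mem_workTemplate, mem_constTemplate]
       tauto)
    | (simp [length_template]; done)
    | (simp [textOf_append, textOf_natTemplate, textOf_workTemplate, textOf_constTemplate, coinText,
        testAndText, coinAndText, linkText, finalText]; done)
  · rw [hy]; simp [twoProofText]
  · rw [hy]; simp [twoProofText]; omega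

end Fragment

end MultiMerlin

noncomputable section

namespace MultiMerlin

open Turing

/-! ### The length of the description of the two-proof verification circuit -/

theorem length_flatMap_range_le {n c : ℕ} {f : ℕ → List Bool} (h : ∀ i < n, (f i).length ≤ c) :
    ((List.range n).flatMap f).length ≤ n * c := by
  induction n with
  | zero => simp
  | succ n ih =>
    have := ih fun i hi => h i (by omega)
    have := h n (by omega)
    simp only [List.range_succ, List.flatMap_append, List.flatMap_cons, List.flatMap_nil,
      List.append_nil, List.length_append, Nat.succ_mul]
    omega

theorem length_workText (p : ℕ) : (workText p).length = p + 2 := by simp [workText, describeNat]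

theorem length_proofText (c u : ℕ) : (proofText c u).length = c + u + 3 := by
  simp [proofText, describeNat]; ring

theorem length_describeNat (n : ℕ) : (describeNat n).length = n + 1 := by simp [describeNat]

theorem length_flatMap_le_mul {α : Type*} (w : List α) {f g : α → List Bool} {c : ℕ}
    (h : ∀ a, (f a).length ≤ (g a).length * c) :
    (w.flatMap f).length ≤ (w.flatMap g).length * c := by
  induction w with
  | nil => simp
  | cons a w ih =>
    have := h a
    simp only [List.flatMap_cons, List.length_append, Nat.add_mul]
    omega

theorem length_relabelText_le {v k m : ℕ} (N : ℕ) (q : Qubit v k m) :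
    (relabelText N q).length ≤ (describeQubit q).length * (N + 5) := by
  rcases q with i | ⟨j, i⟩
  · simp [relabelText, length_workText, describeQubit, length_describeNat]
    nlinarith
  · simp [relabelText, length_proofText, describeQubit, length_describeNat]
    nlinarith

theorem length_relabelGateText_le {v k m : ℕ} (N : ℕ) (G : Gate (Qubit v k m)) :
    (relabelGateText N G).length ≤ (describeGate G).length * (N + 5) := by
  have := length_flatMap_le_mul G.operands (length_relabelText_le N)
  rw [describeGate_eq, relabelGateText, List.length_append, List.length_append, Nat.add_mul]
  nlinarith

/-- Every piece consists of boundedly many unary numbers of size linear in `B`. The bound pays for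
the final move of the text to the output stack. -/
theorem length_twoProofText_le {N l B : ℕ} (hN : N * N ≤ B) (hl : l ≤ B) (y : List Bool) :
    (twoProofText N l y).length ≤
      l * (5 * B + 10) + N * (N * (11 * B + 60) + (15 * B + 30)) + y.length +
        N * (15 * B + 30) + l * (15 * B + 30) + (15 * B + 80) := by
  have hN' : N ≤ B := by nlinarith
  have h1 := length_flatMap_range_le (n := l) (c := 5 * B + 10) (f := coinText) fun i hi => by
    simp [coinText, length_workText, length_describeNat]; omega
  have h2 := length_flatMap_range_le (n := N) (c := N * (11 * B + 60) + (15 * B + 30))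
    (f := testText N) fun j hj => by
      have := length_flatMap_range_le (n := N) (c := 11 * B + 60)
        (f := fun i => swapText j (i + N * j)) fun i hi => by
          have : i + N * j ≤ B := by nlinarith
          simp [swapText, length_workText, length_describeNat, length_proofText]; omega
      simp only [testText, List.length_append, length_workText, length_describeNat]; omega
  have h3 := length_flatMap_range_le (n := N) (c := 15 * B + 30) (f := testAndText) fun i hi => by
    simp [testAndText, length_workText, length_describeNat]; omega
  have h4 := length_flatMap_range_le (n := l) (c := 15 * B + 30) (f := coinAndText) fun i hi => by
    simp [coinAndText, length_workText, length_describeNat]; omega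
  simp only [twoProofText, linkText, finalText, List.length_append, length_workText,
    length_describeNat]
  omega

namespace Fragment

variable {M : TM2ComputableAux Bool Bool}
variable {a b c d e f g h i j k l acc x : List Bool} {n m L : ℕ}

/-! ### Computing the description of the two-proof verification circuit -/

/-- The machine of the given verifier is called once; `L` and `N` come from the input length alone,
and the new text needs a single pass over the description that the call returns. -/
theorem polyTimeComputable_twoProofText {v k m : List Bool → ℕ}
    (C : ∀ x, Circuit (Qubit (v x) (k x) (m x)))
    (hC : PolyTimeComputable fun x => describeCircuit (C x)) (r : ℕ) :
    PolyTimeComputable fun x => twoProofText (2 ^ logParam r x.length) (4 * logParam r x.length)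
      ((C x).flatMap (relabelGateText (2 ^ logParam r x.length))) := by
  obtain ⟨h⟩ := hC
  obtain ⟨K, hK⟩ := exists_length_output_le h
  let g : List Bool → List Bool := fun x => twoProofText (2 ^ logParam r x.length)
    (4 * logParam r x.length) ((C x).flatMap (relabelGateText (2 ^ logParam r x.length)))
  let F : Fragment (Fin 12) h.toTM2ComputableAux :=
    readInput.seq <| (call 7 8).seq <| (move 8 7).seq <| (pushList 3 (ones r)).seq <|
      (logLoop r).seq <| powerLoop.seq emitTwoProof
  have hrun := fun x : List Bool => Runs.to (F := F) (S := stk x [] [] [] [] [] [] [] [] [] [] []) (Runs.seq (runs_readInput (n := 0) (m := 0))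
    (Runs.seq (Runs.to (t' := x.length + h.time.eval x.length + (describeCircuit (C x)).length + 2)
      (R' := stk [] [] [] [] [] (ones x.length) (ones x.length) []
        (describeCircuit (C x)).reverse [] [] [])
      (runs_call (a := 7) (b := 8) (h.outputsFun x) (by simp)) (by simp) (by simp))
    (Runs.seq (Runs.to (t' := 2 * (describeCircuit (C x)).length + 1)
      (R' := stk [] [] [] [] [] (ones x.length) (ones x.length)
        (describeCircuit (C x)) [] [] [] [])
      (runs_move (a := 8) (b := 7) (by decide)) (by simp) (by simp))
    (Runs.seq (Runs.to (t' := r + 1)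
      (R' := stk [] [] [] (ones r) [] (ones x.length) (ones x.length)
        (describeCircuit (C x)) [] [] [] []) (runs_pushList 3 (ones r)) (by simp) (by simp))
    (Runs.seq (runs_logLoop (r := r) (binaryLength_le _) le_rfl)
    (Runs.seq (runs_powerLoop (L := logParam r x.length))
      (runs_emitTwoProof (N := 2 ^ logParam r x.length) (l := 4 * logParam r x.length)
        (B := 2 ^ logParam r x.length * 2 ^ logParam r x.length + 4 * logParam r x.length)
        (C x) (Nat.le_add_right _ _) (Nat.le_add_left _ _) (g x) rfl))))))) rfl le_rfl
  have hl := LengthBounded.comp_length (polynomiallyBounded_logParam r)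
  have hN := LengthBounded.comp_length (polynomiallyBounded_two_pow_logParam r)
  have c := LengthBounded.const
  have hl4 := (c 4).mul hl
  have hd : LengthBounded fun x => (describeCircuit (C x)).length :=
    (LengthBounded.length.add ((LengthBounded.const K).mul (.eval h.time))).mono hK
  have hB := (hN.mul hN).add hl4
  have hE := hB.emitTime
  have hg : LengthBounded fun x => (g x).length := by
    refine LengthBounded.mono (((((hl4.mul (((c 5).mul hB).add (c 10))).add (hN.mul
      ((hN.mul (((c 11).mul hB).add (c 60))).add (((c 15).mul hB).add (c 30))))).add
      (hd.mul (hN.add (c 5)))).add (hN.mul (((c 15).mul hB).add (c 30)))).add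
      (hl4.mul (((c 15).mul hB).add (c 30))) |>.add (((c 15).mul hB).add (c 80))) fun x => ?_
    refine (length_twoProofText_le (Nat.le_add_right _ _) (Nat.le_add_left _ _) _).trans ?_
    have := length_flatMap_le_mul (C x) (length_relabelGateText_le (2 ^ logParam r x.length))
    gcongr
    exact this
  have ht : ∃ t : List Bool → ℕ, LengthBounded t ∧ ∀ x, F.Runs
      (stk x [] [] [] [] [] [] [] [] [] [] []) (stk [] (g x) [] [] [] [] [] [] [] [] [] []) (t x) := by
    -- The running time is a metavariable that `hrun` fills in. It is a sum of products of
    -- quantities already bounded, so the search follows its syntax; reducible transparency keeps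
    -- these quantities from being unfolded.
    refine ⟨_, ?_, hrun⟩
    repeat' first
      | with_reducible exact hd
      | with_reducible exact hg
      | with_reducible exact hE
      | with_reducible exact hN
      | with_reducible exact hl4
      | with_reducible exact hl
      | with_reducible exact .length
      | with_reducible exact .eval h.time
      | with_reducible exact c _
      | with_reducible refine LengthBounded.add ?_ ?_
      | with_reducible refine LengthBounded.mul ?_ ?_
  obtain ⟨t, ⟨p, hp⟩, ht⟩ := ht
  exact polyTimeComputable F 0 1 p fun x => by
    rw [oneStack_zero, oneStack_one]
    exact (ht x).mono (hp x)

end Fragment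

end MultiMerlin

/-! ### Polynomial-time computability of the new error probabilities -/

noncomputable section

namespace MultiMerlin

open Turing

/-! ### Binary arithmetic on lists of digits -/

/-- Split off a maximal initial block of `true`, together with the symbol after it. -/
def splitUnary : List Bool → ℕ × List Bool
  | [] => (0, [])
  | true :: x => ((splitUnary x).1 + 1, (splitUnary x).2)
  | false :: x => (0, x)

theorem splitUnary_ones (n : ℕ) (w : List Bool) :
    splitUnary (ones n ++ false :: w) = (n, w) := by
  induction n with
  | zero => rfl
  | succ n ih => simp [ones_succ, splitUnary, ih]

theorem length_splitUnary_le (x : List Bool) :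
    (splitUnary x).1 + (splitUnary x).2.length ≤ x.length := by
  induction x with
  | nil => simp [splitUnary]
  | cons b x ih => cases b <;> simp [splitUnary]; omega

/-- Add one to a number that is given by its binary digits. -/
def incDigits : List Bool → List Bool
  | [] => [true]
  | true :: w => false :: incDigits w
  | false :: w => true :: w

theorem binaryValue_nil : binaryValue [] = 0 := rfl

theorem binaryValue_cons (b : Bool) (w : List Bool) :
    binaryValue (b :: w) = b.toNat + 2 * binaryValue w := by
  simp [binaryValue, Nat.ofDigits_cons]

theorem binaryValue_append (w w' : List Bool) :
    binaryValue (w ++ w') = binaryValue w + 2 ^ w.length * binaryValue w' := by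
  simp [binaryValue, Nat.ofDigits_append]

theorem binaryValue_incDigits (w : List Bool) :
    binaryValue (incDigits w) = binaryValue w + 1 := by
  induction w with
  | nil => rfl
  | cons b w ih =>
    cases b
    · simp [incDigits, binaryValue_cons]; ring
    · simp [incDigits, binaryValue_cons, ih]; ring

theorem binaryValue_iterate_incDigits (q : ℕ) (w : List Bool) :
    binaryValue (incDigits^[q] w) = binaryValue w + q := by
  induction q with
  | zero => rfl
  | succ q ih => rw [Function.iterate_succ_apply', binaryValue_incDigits, ih]; rfl

theorem length_incDigits_le (w : List Bool) : (incDigits w).length ≤ w.length + 1 := by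
  induction w with
  | nil => simp [incDigits]
  | cons b w ih => cases b <;> simp [incDigits]; omega

theorem length_iterate_incDigits_le (q : ℕ) (w : List Bool) :
    (incDigits^[q] w).length ≤ w.length + q := by
  induction q with
  | zero => rfl
  | succ q ih =>
    rw [Function.iterate_succ_apply']
    exact (length_incDigits_le _).trans (by omega)

theorem binaryValue_replicate_false (m : ℕ) : binaryValue (List.replicate m false) = 0 := by
  induction m with
  | zero => rfl
  | succ m ih => simp [List.replicate_succ, binaryValue_cons, ih]

theorem binaryValue_ones_add (m : ℕ) : binaryValue (ones m) + 1 = 2 ^ m := by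
  induction m with
  | zero => rfl
  | succ m ih => rw [ones_succ, binaryValue_cons, pow_succ]; simp; omega

theorem binaryValue_drop (w : List Bool) (i : ℕ) :
    binaryValue (w.drop i) = binaryValue w / 2 ^ i := by
  rw [binaryValue, binaryValue, List.map_drop, Nat.ofDigits_div_pow_eq_ofDigits_drop _ (by simp)]
  intro l hl
  obtain ⟨b, -, rfl⟩ := List.mem_map.1 hl
  cases b <;> simp

/-- The first `n` digits of a number. -/
def fixedDigits (n : ℕ) (w : List Bool) : List Bool := (List.range n).map fun i => w.getD i false

theorem length_fixedDigits (n : ℕ) (w : List Bool) : (fixedDigits n w).length = n := by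
  simp [fixedDigits]

theorem fixedDigits_succ_cons (n : ℕ) (b : Bool) (w : List Bool) :
    fixedDigits (n + 1) (b :: w) = b :: fixedDigits n w := by
  simp [fixedDigits, List.range_succ_eq_map, Function.comp_def]

theorem fixedDigits_nil (n : ℕ) : fixedDigits n [] = List.replicate n false := by
  simp [fixedDigits, List.map_const']

theorem binaryValue_fixedDigits (n : ℕ) (w : List Bool) (hw : binaryValue w < 2 ^ n) :
    binaryValue (fixedDigits n w) = binaryValue w := by
  induction w generalizing n with
  | nil => rw [fixedDigits_nil, binaryValue_replicate_false, binaryValue_nil]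
  | cons b w ih =>
    cases n with
    | zero =>
      rw [pow_zero] at hw
      rw [show binaryValue (b :: w) = 0 by omega]; rfl
    | succ n =>
      rw [binaryValue_cons, pow_succ] at hw
      rw [fixedDigits_succ_cons, binaryValue_cons, binaryValue_cons, ih n (by omega)]

/-- The digits of `2 ^ m * x`, where `x` is the number in `[0, 1)` with the binary digits `w`
followed by `k` digits `1`, and the digits of `w` are those of a numerator over `2 ^ L`. -/
def nearOneDigits (m L : ℕ) (w : List Bool) : List Bool :=
  (List.replicate m false ++ fixedDigits L w ++ ones (4 * L)).drop (5 * L)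

/-- With `a = binaryValue w`, the number `1 - 2⁻⁴ᴸ (1 - a / 2ᴸ)` has the binary expansion `4 * L`
ones, then the `L` digits of `a`. With least significant digits first, `m` zeros in front multiply
by `2 ^ m`, and dropping `5 * L` digits divides and rounds down, at a loss of less than one unit. -/
theorem abs_sub_nearOneDigits_le (m L : ℕ) (w : List Bool) (hw : binaryValue w < 2 ^ L) :
    |1 - (1 / 2 : ℝ) ^ (4 * L) * (1 - (binaryValue w : ℝ) / 2 ^ L) -
      (binaryValue (nearOneDigits m L w) : ℝ) / 2 ^ m| ≤ (1 / 2) ^ m := by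
  have h1 := binaryValue_ones_add (4 * L)
  have hv : binaryValue (List.replicate m false ++ fixedDigits L w ++ ones (4 * L)) =
      2 ^ m * (binaryValue w + 2 ^ L * binaryValue (ones (4 * L))) := by
    rw [binaryValue_append, binaryValue_append, binaryValue_replicate_false,
      binaryValue_fixedDigits _ _ hw, List.length_append, length_fixedDigits,
      List.length_replicate, pow_add]
    ring
  set A := binaryValue w + 2 ^ L * binaryValue (ones (4 * L)) with hA
  have hx : 1 - (1 / 2 : ℝ) ^ (4 * L) * (1 - (binaryValue w : ℝ) / 2 ^ L) = A / 2 ^ (5 * L) := by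
    have h2 : (binaryValue (ones (4 * L)) : ℝ) = 2 ^ (4 * L) - 1 := by
      rw [eq_sub_iff_add_eq]; exact_mod_cast h1
    rw [hA, show 5 * L = L + 4 * L by ring, pow_add]
    push_cast
    rw [h2]
    field_simp
    simp
    field_simp
    ring
  rw [hx, nearOneDigits, binaryValue_drop, hv]
  have hp : (0 : ℝ) < 2 ^ (5 * L) := by positivity
  have hm : (0 : ℝ) < 2 ^ m := by positivity
  have h3 := Nat.div_mul_le_self (2 ^ m * A) (2 ^ (5 * L))
  have h4 := Nat.lt_div_mul_add (a := 2 ^ m * A) (b := 2 ^ (5 * L)) (by positivity)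
  generalize 2 ^ m * A / 2 ^ (5 * L) = D at *
  have h3' : (D : ℝ) * 2 ^ (5 * L) ≤ 2 ^ m * A := by exact_mod_cast h3
  have h4' : (2 ^ m * A : ℝ) ≤ D * 2 ^ (5 * L) + 2 ^ (5 * L) := by exact_mod_cast h4.le
  have e : (A : ℝ) / 2 ^ (5 * L) - D / 2 ^ m = (2 ^ m * A - D * 2 ^ (5 * L)) / 2 ^ (5 * L) / 2 ^ m := by
    field_simp
  rw [e, abs_of_nonneg (div_nonneg (div_nonneg (by linarith) hp.le) hm.le), one_div_pow]
  gcongr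
  rw [div_le_one hp]
  linarith

namespace Fragment

variable {M : TM2ComputableAux Bool Bool}
variable {a b c d e f g h i j k l acc x w : List Bool} {n m L : ℕ}

/-- Add one to the number on the stack `7`. -/
def increment : Fragment (Fin 12) M := (unary 7 (push 8 false)).seq <| (push 7 true).seq (move 8 7)

theorem runs_increment :
    (increment : Fragment (Fin 12) M).Runs (stk a b c d e f g w [] j k l)
      (stk a b c d e f g (incDigits w) [] j k l) (4 * w.length + 3) := by
  have key : ∀ (w : List Bool) (z : ℕ), ∃ z' w', (unary 7 (push 8 false) : Fragment (Fin 12) M).Runs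
      (stk a b c d e f g w (List.replicate z false) j k l)
      (stk a b c d e f g w' (List.replicate z' false) j k l) (2 * w.length + 1) ∧
      List.replicate z' false ++ true :: w' = List.replicate z false ++ incDigits w ∧
      z' ≤ z + w.length := by
    intro w
    induction w with
    | nil => exact fun z => ⟨z, [], Runs.unary_nil rfl, rfl, by simp⟩
    | cons y w ih =>
      intro z
      cases y
      · exact ⟨z, w, Runs.to (Runs.unary_false (w := w) rfl) (by simp) (by simp), rfl, by simp⟩
      · obtain ⟨z', w', h1, h2, h3⟩ := ih (z + 1)
        refine ⟨z', w', Runs.to (Runs.unary_true (w := w) rfl (Runs.to (runs_push 8 false)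
          (R' := stk a b c d e f g w (List.replicate (z + 1) false) j k l)
          (by simp [List.replicate_succ]) le_rfl) h1) rfl (by simp; omega), ?_, by simp; omega⟩
        rw [h2, incDigits, List.replicate_succ']
        simp
  obtain ⟨z, w', h1, h2, h3⟩ := key w 0
  refine Runs.to (Runs.seq h1 (Runs.seq (Runs.to (R' := stk a b c d e f g (true :: w')
    (List.replicate z false) j k l) (runs_push 7 true) (by simp) le_rfl)
    (runs_move (by decide)))) ?_ ?_
  · simpa using congrArg (fun y => stk a b c d e f g y [] j k l) h2
  · simp; omega

/-- Add `q` to the number on the stack `7`. -/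
def increase : ℕ → Fragment (Fin 12) M
  | 0 => skip
  | q + 1 => increment.seq (increase q)

theorem runs_increase (q : ℕ) :
    (increase q : Fragment (Fin 12) M).Runs (stk a b c d e f g w [] j k l)
      (stk a b c d e f g (incDigits^[q] w) [] j k l) (q * (4 * (w.length + q) + 3) + 1) := by
  induction q generalizing w with
  | zero => exact Runs.to runs_skip rfl (by simp)
  | succ q ih =>
    refine Runs.to (Runs.seq runs_increment ih) rfl ?_
    have := length_incDigits_le w
    have : q * (4 * ((incDigits w).length + q)) ≤ q * (4 * (w.length + (q + 1))) :=
      Nat.mul_le_mul_left _ (by omega)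
    nlinarith

/-- Separate the input `1ⁿ01ᵐ` into its parts. -/
def readPair : Fragment (Fin 12) M :=
  (unary 0 ((push 5 true).seq <| (push 6 true).seq <| push 7 true)).seq <|
    (push 7 false).seq (loop 0 fun _ => push 2 false)

theorem runs_readPair :
    (readPair : Fragment (Fin 12) M).Runs (stk x [] [] [] [] [] [] [] [] [] [] [])
      (stk [] [] (List.replicate (splitUnary x).2.length false) [] [] (ones (splitUnary x).1)
        (ones (splitUnary x).1) (false :: ones (splitUnary x).1) [] [] [] []) (6 * x.length + 3) := by
  have key : ∀ (x : List Bool) (z : ℕ), (unary 0 ((push 5 true).seq <| (push 6 true).seq <|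
      push 7 true) : Fragment (Fin 12) M).Runs
      (stk x [] [] [] [] (ones z) (ones z) (ones z) [] [] [] [])
      (stk (splitUnary x).2 [] [] [] [] (ones (z + (splitUnary x).1)) (ones (z + (splitUnary x).1))
        (ones (z + (splitUnary x).1)) [] [] [] []) (4 * x.length + 1) := by
    intro x
    induction x with
    | nil => exact fun z => Runs.unary_nil rfl
    | cons y x ih =>
      intro z
      cases y
      · exact Runs.to (Runs.unary_false (w := x) rfl) (by simp [splitUnary]) (by simp)
      · refine Runs.to (Runs.unary_true (w := x) rfl (Runs.to
          (R' := stk x [] [] [] [] (ones (z + 1)) (ones (z + 1)) (ones (z + 1)) [] [] [] [])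
          (Runs.seq (runs_push 5 true) (Runs.seq (runs_push 6 true) (runs_push 7 true)))
          (by simp [ones_succ]) le_rfl) (ih (z + 1))) ?_ (by simp; omega)
        simp only [splitUnary]
        rw [show z + 1 + (splitUnary x).1 = z + ((splitUnary x).1 + 1) by ring]
  have key' : ∀ (y b d e f g h i j k l : List Bool) (z : ℕ), (loop 0 fun _ => push 2 false : Fragment (Fin 12) M).Runs
      (stk y b (List.replicate z false) d e f g h i j k l)
      (stk [] b (List.replicate (z + y.length) false) d e f g h i j k l) (2 * y.length + 1) := by
    intro y b d e f g h i j k l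
    induction y with
    | nil => exact fun z => Runs.loop_nil rfl
    | cons u y ih =>
      intro z
      refine Runs.to (Runs.loop_cons (b := u) (w := y) rfl (Runs.to (R' :=
        stk y b (List.replicate (z + 1) false) d e f g h i j k l) (runs_push 2 false)
        (by simp [List.replicate_succ]) le_rfl) (ih (z + 1))) ?_ (by simp; omega)
      rw [List.length_cons, show z + 1 + y.length = z + (y.length + 1) by ring]
  have hl := length_splitUnary_le x
  refine Runs.to (Runs.seq (Runs.to (key x 0) (R' := stk (splitUnary x).2 [] [] [] []
    (ones (splitUnary x).1) (ones (splitUnary x).1) (ones (splitUnary x).1) [] [] [] [])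
    (by simp) le_rfl) (Runs.seq (Runs.to (R' := stk (splitUnary x).2 [] [] [] []
    (ones (splitUnary x).1) (ones (splitUnary x).1) (false :: ones (splitUnary x).1) [] [] [] [])
      (runs_push 7 false) (by simp) le_rfl) (key' _ _ _ _ _ _ _ _ _ _ _ 0)))
    ?_ ?_
  · simp
  · omega

/-- Write the digits of a number close to one, whose last digits are on the stack `7`. -/
def writeDigits : Fragment (Fin 12) M :=
  (forEach 3 9 (cases 7 (push 2 false) fun b => push 2 b)).seq <|
    (forEach 3 9 (pushList 2 (ones 4))).seq <| (discard 7).seq <| (move 2 1).seq <|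
    loop 3 fun _ => (cases 1 skip fun _ => skip).seq <| (cases 1 skip fun _ => skip).seq <|
      (cases 1 skip fun _ => skip).seq <| (cases 1 skip fun _ => skip).seq
      (cases 1 skip fun _ => skip)

theorem runs_drop_one :
    (cases 1 skip fun _ => skip : Fragment (Fin 12) M).Runs (stk a b c d e f g h i j k l)
      (stk a (b.drop 1) c d e f g h i j k l) 2 := by
  cases b with
  | nil => exact Runs.cases_nil rfl runs_skip
  | cons y b => exact Runs.cases_cons (b := y) (w := b) rfl (Runs.congr runs_skip (by simp) rfl le_rfl)

theorem runs_writeDigits :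
    (writeDigits : Fragment (Fin 12) M).Runs
      (stk [] [] (List.replicate m false) (ones L) [] [] [] w [] [] [] [])
      (stk [] (nearOneDigits m L w) [] [] [] [] [] [] [] [] [] [])
      (37 * L + 2 * m + 2 * w.length + 10) := by
  have h1 := runs_forEach (M := M) (k := 3) (save := 9) (c := 2) (n := L)
    (F := cases 7 (push 2 false) fun b => push 2 b) (by decide)
    (fun z r s => stk [] [] ((fixedDigits z w).reverse ++ List.replicate m false) r [] [] []
      (w.drop z) [] s [] []) (fun _ _ _ => rfl) (fun _ _ _ => rfl) (fun _ _ _ _ => by simp)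
    (fun _ _ _ _ => by simp) (fun z hz r s => by
      have e : fixedDigits (z + 1) w = fixedDigits z w ++ [w.getD z false] := by
        simp [fixedDigits, List.range_succ]
      -- Missing digits are written as zeros, in accordance with the default value in `fixedDigits`.
      rcases hw : w.drop z with _ | ⟨y, w'⟩
      · refine Runs.cases_nil rfl (Runs.to (runs_push 2 false) ?_ le_rfl)
        have hz' := List.drop_eq_nil_iff.1 hw
        rw [e, List.getD_eq_default _ _ hz']
        simp [List.drop_eq_nil_of_le (hz'.trans (Nat.le_succ z))]
      · refine Runs.cases_cons (b := y) (w := w') rfl (Runs.to (runs_push 2 y) ?_ le_rfl)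
        have h2 : w.drop (z + 1) = w' := by rw [← List.drop_drop, hw]; rfl
        have h3 : w.getD z false = y := by
          have := congrArg List.head? hw
          rw [List.head?_drop] at this
          simp [List.getD_eq_getElem?_getD, this]
        rw [e, h2, h3]
        simp)
  have h2 := runs_forEach (M := M) (k := 3) (save := 9) (c := 5) (n := L)
    (F := pushList 2 (ones 4)) (by decide)
    (fun z r s => stk [] [] (ones (4 * z) ++ ((fixedDigits L w).reverse ++ List.replicate m false))
      r [] [] [] (w.drop L) [] s [] []) (fun _ _ _ => rfl) (fun _ _ _ => rfl)
    (fun _ _ _ _ => by simp) (fun _ _ _ _ => by simp) (fun z hz r s => Runs.to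
      (runs_pushList 2 (ones 4)) (by
        simp only [update_stk_2, stk_2, List.reverse_replicate, ← List.append_assoc, ones_append]
        rw [show 4 + 4 * z = 4 * (z + 1) by ring]) (by simp))
  have h3 : ∀ (b : List Bool), (loop 3 fun _ => (cases 1 skip fun _ => skip).seq <|
      (cases 1 skip fun _ => skip).seq <| (cases 1 skip fun _ => skip).seq <|
      (cases 1 skip fun _ => skip).seq (cases 1 skip fun _ => skip) : Fragment (Fin 12) M).Runs
      (stk [] (b.drop (5 * 0)) [] (ones (L - 0)) [] [] [] [] [] [] [] [])
      (stk [] (b.drop (5 * L)) [] (ones (L - L)) [] [] [] [] [] [] [] []) (L * (10 + 1) + 1) :=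
    fun b => runs_loop_ones
      (fun z => stk [] (b.drop (5 * z)) [] (ones (L - z)) [] [] [] [] [] [] [] [])
      (fun _ _ => rfl) (fun z hz => Runs.congr (S := stk [] (b.drop (5 * z)) []
        (ones (L - z - 1)) [] [] [] [] [] [] [] []) (Runs.seq runs_drop_one (Runs.seq runs_drop_one
        (Runs.seq runs_drop_one (Runs.seq runs_drop_one runs_drop_one)))) (by simp)
        (by simp only [List.drop_drop]; congr 2) le_rfl)
  refine Runs.to (Runs.seq (Runs.congr h1 (by simp [fixedDigits]) rfl le_rfl)
    (Runs.seq (Runs.congr h2 (by simp) rfl le_rfl) (Runs.seq (Runs.to (R' := stk [] []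
      (ones (4 * L) ++ ((fixedDigits L w).reverse ++ List.replicate m false)) (ones L) [] [] [] []
      [] [] [] []) (t' := 2 * w.length + 1) (runs_discard 7) (by simp) (by simp))
    (Runs.seq (Runs.to (R' := stk [] (List.replicate m false ++ fixedDigits L w ++ ones (4 * L)) []
      (ones L) [] [] [] [] [] [] [] []) (t' := 2 * (5 * L + m) + 1) (runs_move (by decide))
      (by simp) (by simp [length_fixedDigits]; omega))
      (h3 (List.replicate m false ++ fixedDigits L w ++ ones (4 * L))))))) ?_ ?_
  · simp [nearOneDigits]
  · omega

theorem polyTimeComputable_nearOneDigits {u : List Bool → List Bool} (hu : PolyTimeComputable u)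
    (r q : ℕ) : PolyTimeComputable fun x => nearOneDigits (splitUnary x).2.length
      (logParam r (splitUnary x).1) (incDigits^[q] (u (ones (splitUnary x).1 ++
        false :: ones (logParam r (splitUnary x).1)))) := by
  obtain ⟨h⟩ := hu
  obtain ⟨K, hK⟩ := exists_length_output_le h
  let F : Fragment (Fin 12) h.toTM2ComputableAux :=
    readPair.seq <| (pushList 3 (ones r)).seq <| (logLoop r).seq <| (copy 3 8 7).seq <|
      (call 7 8).seq <| (move 8 7).seq <| (increase q).seq writeDigits
  let n : List Bool → ℕ := fun x => (splitUnary x).1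
  let L : List Bool → ℕ := fun x => logParam r (n x)
  let z : List Bool → List Bool := fun x => ones (n x) ++ false :: ones (L x)
  let y : List Bool → List Bool := fun x => u (z x)
  let m : List Bool → ℕ := fun x => (splitUnary x).2.length
  have hrun := fun x : List Bool => Runs.to (F := F)
    (S := stk x [] [] [] [] [] [] [] [] [] [] []) (Runs.seq runs_readPair
    (Runs.seq (Runs.to (t' := r + 1) (R' := stk [] [] (List.replicate (m x) false) (ones r) []
      (ones (n x)) (ones (n x)) (false :: ones (n x)) [] [] [] []) (runs_pushList 3 (ones r))
      (by simp [m, n]) (by simp))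
    (Runs.seq (runs_logLoop (r := r) (binaryLength_le _) le_rfl)
    -- The stack `7` holds the beginning of the query in reverse, and the precision is copied on top
    -- of it, so that the call reads `1ⁿ01ᴸ`.
    (Runs.seq (Runs.to (t' := 5 * L x + 2) (R' := stk [] [] (List.replicate (m x) false) (ones (L x)) []
      [] [] (ones (L x) ++ false :: ones (n x)) [] [] [] []) (runs_copy (by decide) (by decide)
      (by decide) rfl) (by simp [L, logParam]) (by simp [L, logParam]))
    (Runs.seq (Runs.to (t' := (z x).length + h.time.eval (z x).length + (y x).length + 2)
      (R' := stk [] [] (List.replicate (m x) false) (ones (L x)) [] [] [] []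
        (y x).reverse [] [] [])
      (runs_call (a := 7) (b := 8) (h.outputsFun (z x)) (by simp [z])) (by simp [y]) (by simp [y]))
    (Runs.seq (Runs.to (t' := 2 * (y x).length + 1)
      (R' := stk [] [] (List.replicate (m x) false) (ones (L x)) [] [] [] (y x) [] [] [] [])
      (runs_move (a := 8) (b := 7) (by decide)) (by simp) (by simp))
    (Runs.seq (runs_increase q) (Runs.to (t' := 37 * L x + 2 * m x + 2 * ((y x).length + q) + 10)
      runs_writeDigits rfl (by have := length_iterate_incDigits_le q (y x); omega)))))))))
      rfl le_rfl
  have c := LengthBounded.const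
  have hn : LengthBounded n := LengthBounded.length.mono fun x => by
    have := length_splitUnary_le x; simp only [n]; omega
  have hm : LengthBounded m := LengthBounded.length.mono fun x => by
    have := length_splitUnary_le x; simp only [m]; omega
  have hL : LengthBounded L := LengthBounded.comp (polynomiallyBounded_logParam r) hn
  have hz : LengthBounded fun x => (z x).length := (hn.add (hL.add (c 1))).mono fun x => by simp [z]
  have ht : LengthBounded fun x => h.time.eval (z x).length := .comp ⟨h.time, fun _ => le_rfl⟩ hz
  have hy : LengthBounded fun x => (y x).length :=
    (hz.add ((c K).mul ht)).mono fun x => hK (z x)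
  have ht : ∃ t : List Bool → ℕ, LengthBounded t ∧ ∀ x, F.Runs
      (stk x [] [] [] [] [] [] [] [] [] [] []) (stk [] (nearOneDigits (m x) (L x)
        (incDigits^[q] (y x))) [] [] [] [] [] [] [] [] [] []) (t x) := by
    refine ⟨_, ?_, hrun⟩
    repeat' first
      | with_reducible exact hy
      | with_reducible exact ht
      | with_reducible exact hz
      | with_reducible exact hL
      | with_reducible exact hn
      | with_reducible exact hm
      | with_reducible exact .length
      | with_reducible exact c _
      | with_reducible refine LengthBounded.add ?_ ?_
      | with_reducible refine LengthBounded.mul ?_ ?_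
  obtain ⟨t, ⟨p, hp⟩, ht⟩ := ht
  exact polyTimeComputable F 0 1 p fun x => by
    rw [oneStack_zero, oneStack_one]
    exact (ht x).mono (hp x)

end Fragment

/-- The machine for `u` is always queried at precision `logParam r n`, whatever the requested `m`:
the target is itself a dyadic number built from that one answer, and only its truncation depends on
`m`. -/
theorem polyTimeComputableReal_nearOne {u : List Bool → List Bool} (hu : PolyTimeComputable u)
    (r q : ℕ) (hq : ∀ n, binaryValue (u (ones n ++ false :: ones (logParam r n))) + q <
      2 ^ logParam r n) :
    PolyTimeComputableReal fun n => 1 - (1 / 2 : ℝ) ^ (4 * logParam r n) * (1 -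
      ((binaryValue (u (ones n ++ false :: ones (logParam r n))) + q : ℕ) : ℝ) /
        2 ^ logParam r n) := by
  refine ⟨_, Fragment.polyTimeComputable_nearOneDigits hu r q, fun n m => ?_⟩
  have := splitUnary_ones n (ones m)
  rw [ones] at this
  simp only [this, List.length_replicate]
  rw [← binaryValue_iterate_incDigits]
  apply abs_sub_nearOneDigits_le
  rw [binaryValue_iterate_incDigits]
  exact hq n

end MultiMerlin

/-! ### Circuits as norm-preserving operators, analysed slice by slice -/

noncomputable section

namespace MultiMerlin

/-! ### Squared norms -/

/-- The squared norm of a vector of complex numbers. -/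
def sqNorm {α : Type*} [Fintype α] (ψ : α → ℂ) : ℝ := ∑ a, ‖ψ a‖ ^ 2

section sqNorm

variable {α β : Type*} [Fintype α] [Fintype β]

theorem sqNorm_nonneg (ψ : α → ℂ) : 0 ≤ sqNorm ψ := Finset.sum_nonneg fun _ _ => by positivity

theorem norm_toLp_eq_sqrt (ψ : α → ℂ) : ‖WithLp.toLp 2 ψ‖ = √(sqNorm ψ) := by
  rw [EuclideanSpace.norm_eq]; rfl

theorem sqNorm_eq_norm_sq (φ : EuclideanSpace ℂ α) : sqNorm φ = ‖φ‖ ^ 2 := by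
  rw [EuclideanSpace.norm_sq_eq]; rfl

theorem sqrt_sqNorm_add_le (ψ φ : α → ℂ) :
    √(sqNorm (ψ + φ)) ≤ √(sqNorm ψ) + √(sqNorm φ) := by
  simp only [← norm_toLp_eq_sqrt, WithLp.toLp_add]
  exact norm_add_le _ _

theorem sqNorm_smul (c : ℂ) (ψ : α → ℂ) : sqNorm (c • ψ) = ‖c‖ ^ 2 * sqNorm ψ := by
  simp [sqNorm, mul_pow, Finset.mul_sum]

theorem sqNorm_comp_equiv (e : α ≃ β) (ψ : β → ℂ) : sqNorm (ψ ∘ e) = sqNorm ψ :=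
  e.sum_comp fun b => ‖ψ b‖ ^ 2

theorem sqNorm_eq_zero {ψ : α → ℂ} (h : sqNorm ψ = 0) : ψ = 0 := by
  funext a
  have := (Finset.sum_eq_zero_iff_of_nonneg (fun _ _ => by positivity)).1 h a (Finset.mem_univ a)
  simpa using this

end sqNorm

/-! ### Changing some of the bits -/

section extend

variable {E Q : Type} {e : E → Q} {a a' : E → Bool} {b : Q → Bool}

theorem extend_comp_self (he : e.Injective) : Function.extend e (b ∘ e) b = b := by
  funext q
  by_cases h : ∃ t, e t = q
  · obtain ⟨t, rfl⟩ := h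
    simp [he.extend_apply]
  · simp [Function.extend_apply' _ _ _ h]

theorem extend_extend (he : e.Injective) :
    Function.extend e a (Function.extend e a' b) = Function.extend e a b := by
  funext q
  by_cases h : ∃ t, e t = q
  · obtain ⟨t, rfl⟩ := h
    simp [he.extend_apply]
  · simp [Function.extend_apply' _ _ _ h]

theorem update_extend [DecidableEq E] [DecidableEq Q] (he : e.Injective) (t : E) (y : Bool) :
    Function.update (Function.extend e a b) (e t) y =
      Function.extend e (Function.update a t y) b := by
  funext q
  by_cases h : ∃ t, e t = q
  · obtain ⟨t', rfl⟩ := h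
    by_cases ht : t' = t
    · subst ht; simp [he.extend_apply]
    · simp [he.extend_apply, ht, he.eq_iff]
  · rw [Function.extend_apply' _ _ _ h, Function.update_of_ne, Function.extend_apply' _ _ _ h]
    rintro rfl
    exact h ⟨t, rfl⟩

/-- Exchange the given bits with the bits at the positions `e`. -/
def exchangeBits (he : e.Injective) : (E → Bool) × (Q → Bool) ≃ (E → Bool) × (Q → Bool) where
  toFun p := (p.2 ∘ e, Function.extend e p.1 p.2)
  invFun p := (p.2 ∘ e, Function.extend e p.1 p.2)
  left_inv p := by simp [Function.extend_comp he, extend_extend he, extend_comp_self he]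
  right_inv p := by simp [Function.extend_comp he, extend_extend he, extend_comp_self he]

/-- Since `exchangeBits` is a bijection of pairs, every assignment arises `2 ^ |E|` times. Summing
over all `b`, rather than over the bits outside the range of `e`, avoids splitting `Q` into a range
and a complement. -/
theorem sum_extend [Fintype E] [DecidableEq E] [Fintype Q] [DecidableEq Q] (he : e.Injective)
    (F : (Q → Bool) → ℝ) :
    ∑ b : Q → Bool, ∑ a : E → Bool, F (Function.extend e a b) =
      (2 : ℝ) ^ Fintype.card E * ∑ b, F b := by
  rw [Finset.sum_comm, ← Fintype.sum_prod_type' (f := fun a b => F (Function.extend e a b)),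
    show ∑ x : (E → Bool) × (Q → Bool), F (Function.extend e x.1 x.2) = _ from
      (exchangeBits he).sum_comp (fun p => F p.2), Fintype.sum_prod_type]
  simp

/-- Overwriting is injective in the new bits, and by `hF` it reaches the whole support of `F`. This
discards qubits whose values are known, such as work qubits at zero. -/
theorem sum_eq_sum_extend [Fintype E] [DecidableEq E] [Fintype Q] [DecidableEq Q]
    (he : e.Injective) (b : Q → Bool) {F : (Q → Bool) → ℝ}
    (hF : ∀ b', F b' ≠ 0 → ∀ q, (∀ t, e t ≠ q) → b' q = b q) :
    ∑ b', F b' = ∑ a : E → Bool, F (Function.extend e a b) := by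
  symm
  refine Finset.sum_of_injOn (fun a => Function.extend e a b) ?_ (by simp) ?_ (by simp)
  · intro a _ a' _ h
    have := congrArg (· ∘ e) h
    simpa [Function.extend_comp he] using this
  · intro b' _ hb'
    by_contra h0
    apply hb'
    refine ⟨b' ∘ e, by simp, ?_⟩
    funext q
    by_cases h : ∃ t, e t = q
    · obtain ⟨t, rfl⟩ := h
      simp [he.extend_apply]
    · simp only [Function.extend_apply' _ _ _ h]
      exact (hF b' h0 q (by simpa using h)).symm

end extend

/-! ### Circuits on some of the qubits -/

section map

variable {E Q : Type} [DecidableEq E] [DecidableEq Q]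

/-- Apply a gate to the qubits `e`. -/
def Gate.map {E Q : Type} (e : E → Q) (he : e.Injective) : Gate E → Gate Q
  | .pauliX t => .pauliX (e t)
  | .hadamard t => .hadamard (e t)
  | .phaseT t => .phaseT (e t)
  | .cnot c t h => .cnot (e c) (e t) (he.ne h)
  | .toffoli c₁ c₂ t h h₁ h₂ => .toffoli (e c₁) (e c₂) (e t) (he.ne h) (he.ne h₁) (he.ne h₂)

/-- Apply a circuit to the qubits `e`. -/
def Circuit.map {E Q : Type} (e : E → Q) (he : e.Injective) (C : Circuit E) : Circuit Q :=
  List.map (Gate.map e he) C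

/-- The amplitudes of the qubits `e`, for fixed values of the other qubits. -/
def slice {E Q : Type} (e : E → Q) (b : Q → Bool) (ψ : Amplitudes Q) : Amplitudes E :=
  fun a => ψ (Function.extend e a b)

variable {e : E → Q} (he : e.Injective)


/-- A gate on the qubits `e` acts on each slice separately, whatever the values of the other qubits.
Slices thus take the place of tensor decompositions. -/
theorem Gate.slice_apply_map (g : Gate E) (b : Q → Bool) (ψ : Amplitudes Q) :
    slice e b ((g.map e he).apply ψ) = g.apply (slice e b ψ) := by
  funext a
  cases g <;> simp [Gate.map, Gate.apply, slice, he.extend_apply, update_extend he]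

theorem Circuit.apply_append (C C' : Circuit Q) (ψ : Amplitudes Q) :
    Circuit.apply (C ++ C') ψ = Circuit.apply C' (Circuit.apply C ψ) := by
  simp [Circuit.apply, List.foldl_append]

theorem Circuit.apply_cons (g : Gate Q) (C : Circuit Q) (ψ : Amplitudes Q) :
    Circuit.apply (g :: C) ψ = Circuit.apply C (g.apply ψ) := rfl

theorem Circuit.slice_apply_map (C : Circuit E) (b : Q → Bool) (ψ : Amplitudes Q) :
    slice e b (Circuit.apply (Circuit.map e he C) ψ) = Circuit.apply C (slice e b ψ) := by
  induction C generalizing ψ with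
  | nil => rfl
  | cons g C ih =>
    rw [Circuit.map, List.map_cons, Circuit.apply_cons, Circuit.apply_cons,
      ← Gate.slice_apply_map he, ← ih]
    rfl

theorem Circuit.apply_map (C : Circuit E) (b : Q → Bool) (ψ : Amplitudes Q) :
    Circuit.apply (Circuit.map e he C) ψ b = Circuit.apply C (slice e b ψ) (b ∘ e) := by
  rw [← Circuit.slice_apply_map he, slice, extend_comp_self he]

end map

/-! ### Linearity and unitarity -/

section linear

variable {Q : Type} [DecidableEq Q]

theorem Gate.apply_add (g : Gate Q) (ψ φ : Amplitudes Q) :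
    g.apply (ψ + φ) = g.apply ψ + g.apply φ := by
  funext b
  cases g
  case hadamard t => simp only [Gate.apply, Pi.add_apply]; ring
  case phaseT t => simp only [Gate.apply, Pi.add_apply]; ring
  all_goals rfl

theorem Gate.apply_smul (g : Gate Q) (c : ℂ) (ψ : Amplitudes Q) :
    g.apply (c • ψ) = c • g.apply ψ := by
  funext b
  cases g
  case hadamard t => simp only [Gate.apply, Pi.smul_apply, smul_eq_mul]; ring
  case phaseT t => simp only [Gate.apply, Pi.smul_apply, smul_eq_mul]; ring
  all_goals rfl

theorem Circuit.apply_add (C : Circuit Q) (ψ φ : Amplitudes Q) :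
    Circuit.apply C (ψ + φ) = Circuit.apply C ψ + Circuit.apply C φ := by
  induction C generalizing ψ φ with
  | nil => rfl
  | cons g C ih => rw [Circuit.apply_cons, Gate.apply_add, ih]; rfl

theorem Circuit.apply_smul (C : Circuit Q) (c : ℂ) (ψ : Amplitudes Q) :
    Circuit.apply C (c • ψ) = c • Circuit.apply C ψ := by
  induction C generalizing ψ with
  | nil => rfl
  | cons g C ih => rw [Circuit.apply_cons, Gate.apply_smul, ih]; rfl

theorem update_update_involutive (t : Q) (f : (Q → Bool) → Bool)
    (hf : ∀ b y, f (Function.update b t y) = f b) :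
    Function.Involutive fun b : Q → Bool => Function.update b t (xor (b t) (f b)) := by
  intro b
  simp [hf]

variable [Fintype Q]

theorem sum_update_update (t : Q) (F : (Q → Bool) → ℝ) :
    ∑ b, (F (Function.update b t false) + F (Function.update b t true)) = 2 * ∑ b, F b := by
  have h : Function.Involutive fun b : Q → Bool => Function.update b t (!b t) := by
    intro b; simp
  rw [two_mul]
  nth_rw 2 [← Equiv.sum_comp h.toPerm F]
  rw [← Finset.sum_add_distrib]
  refine Finset.sum_congr rfl fun b _ => ?_
  have e : Function.update b t (b t) = b := Function.update_eq_self t b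
  change _ = F b + F (Function.update b t (!b t))
  cases hb : b t <;> rw [hb] at e
  · rw [e]; rfl
  · rw [e, add_comm]; rfl

theorem sqNorm_comp_involutive {f : (Q → Bool) → Q → Bool} (hf : f.Involutive)
    (ψ : Amplitudes Q) : sqNorm (fun b => ψ (f b)) = sqNorm ψ :=
  sqNorm_comp_equiv hf.toPerm ψ

/-- The Hadamard gate obeys the parallelogram law on each pair of assignments that differ at `t`,
and `sum_update_update` sums over these pairs. The other gates permute the basis or multiply by
phases. -/
theorem Gate.sqNorm_apply (g : Gate Q) (ψ : Amplitudes Q) : sqNorm (g.apply ψ) = sqNorm ψ := by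
  cases g with
  | pauliX t => exact sqNorm_comp_involutive (fun b => by simp) ψ
  | hadamard t =>
    have h := sum_update_update t fun b => ‖ψ b‖ ^ 2
    have h' := sum_update_update t fun b => ‖(Gate.hadamard t).apply ψ b‖ ^ 2
    have h2 : ‖((√2 : ℝ) : ℂ)‖ ^ 2 = 2 := by simp
    have hs : ∀ b : Q → Bool, ‖(Gate.hadamard t).apply ψ (Function.update b t false)‖ ^ 2 +
        ‖(Gate.hadamard t).apply ψ (Function.update b t true)‖ ^ 2 =
        ‖ψ (Function.update b t false)‖ ^ 2 + ‖ψ (Function.update b t true)‖ ^ 2 := by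
      intro b
      have := parallelogram_law_with_norm ℂ (ψ (Function.update b t false))
        (ψ (Function.update b t true))
      simp only [Gate.apply, Function.update_idem, Function.update_self, norm_mul, norm_inv,
        mul_pow, inv_pow, h2]
      simp only [Bool.false_eq_true, if_false, if_true, one_mul, neg_mul, ← sub_eq_add_neg]
      linarith
    simp only [hs] at h'
    rw [h] at h'
    simp only [sqNorm]
    linarith
  | phaseT t =>
    refine Finset.sum_congr rfl fun b _ => ?_
    simp only [Gate.apply]
    split_ifs
    · rw [norm_mul, Complex.norm_exp_ofReal_mul_I, one_mul]
    · simp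
  | cnot c t h =>
    exact sqNorm_comp_involutive (update_update_involutive t (fun b => b c) fun b y => by
      simp [h]) ψ
  | toffoli c₁ c₂ t h h₁ h₂ =>
    exact sqNorm_comp_involutive (update_update_involutive t (fun b => b c₁ && b c₂) fun b y => by
      simp [h₁, h₂]) ψ

theorem Circuit.sqNorm_apply (C : Circuit Q) (ψ : Amplitudes Q) :
    sqNorm (Circuit.apply C ψ) = sqNorm ψ := by
  induction C generalizing ψ with
  | nil => rfl
  | cons g C ih => rw [Circuit.apply_cons, ih, Gate.sqNorm_apply]

/-! ### The probability of measuring one -/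

/-- The part of a vector of amplitudes where the qubit `o` is one. -/
def restrictOne (o : Q) (ψ : Amplitudes Q) : Amplitudes Q := fun b => if b o then ψ b else 0

theorem probOne_eq_sqNorm (o : Q) (ψ : Amplitudes Q) : probOne o ψ = sqNorm (restrictOne o ψ) := by
  refine Finset.sum_congr rfl fun b _ => ?_
  by_cases h : b o <;> simp [restrictOne, h]

theorem probOne_nonneg (o : Q) (ψ : Amplitudes Q) : 0 ≤ probOne o ψ := by
  rw [probOne_eq_sqNorm]; exact sqNorm_nonneg _

theorem probOne_le_sqNorm (o : Q) (ψ : Amplitudes Q) : probOne o ψ ≤ sqNorm ψ := by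
  refine Finset.sum_le_sum fun b _ => ?_
  split_ifs
  · exact le_rfl
  · positivity

theorem probOne_smul (o : Q) (c : ℂ) (ψ : Amplitudes Q) :
    probOne o (c • ψ) = ‖c‖ ^ 2 * probOne o ψ := by
  rw [probOne_eq_sqNorm, probOne_eq_sqNorm, ← sqNorm_smul]
  congr 1
  funext b
  simp [restrictOne]

theorem sqrt_probOne_add_le (o : Q) (ψ φ : Amplitudes Q) :
    √(probOne o (ψ + φ)) ≤ √(probOne o ψ) + √(probOne o φ) := by
  simp only [probOne_eq_sqNorm]
  convert sqrt_sqNorm_add_le (restrictOne o ψ) (restrictOne o φ) using 3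
  funext b
  by_cases h : b o <;> simp [restrictOne, h]

variable {E : Type} [DecidableEq E] [Fintype E] {e : E → Q} (he : e.Injective)



theorem sum_sqNorm_slice {e : E → Q} (he : e.Injective) (ψ : Amplitudes Q) :
    ∑ b, sqNorm (slice e b ψ) = (2 : ℝ) ^ Fintype.card E * sqNorm ψ :=
  sum_extend he fun b => ‖ψ b‖ ^ 2

theorem sum_probOne_slice {e : E → Q} (he : e.Injective) (o : E) (ψ : Amplitudes Q) :
    ∑ b, probOne o (slice e b ψ) = (2 : ℝ) ^ Fintype.card E * probOne (e o) ψ := by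
  rw [probOne, ← sum_extend he]
  refine Finset.sum_congr rfl fun b _ => Finset.sum_congr rfl fun a _ => ?_
  rw [he.extend_apply]
  rfl

/-- Up to the common factor `2 ^ |E|`, probability and squared norm are sums over slices, so a bound
that holds on all unnormalized slices carries over. -/
theorem probOne_map_le (o : E) (C : Circuit E) (ψ : Amplitudes Q) (s : ℝ)
    (h : ∀ b, probOne o (Circuit.apply C (slice e b ψ)) ≤ s * sqNorm (slice e b ψ)) :
    probOne (e o) (Circuit.apply (Circuit.map e he C) ψ) ≤ s * sqNorm ψ := by
  have h2 : (0 : ℝ) < 2 ^ Fintype.card E := by positivity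
  refine le_of_mul_le_mul_left ?_ h2
  rw [← sum_probOne_slice he, mul_left_comm, ← sum_sqNorm_slice he, Finset.mul_sum]
  refine Finset.sum_le_sum fun b _ => ?_
  rw [Circuit.slice_apply_map he]
  exact h b

/-- When all slices are multiples of one vector, the qubits outside `e` have no influence on the
outcome. The two squared norms stand in for a normalization. -/
theorem probOne_map_eq (o : E) (C : Circuit E) (ψ : Amplitudes Q) (φ : Amplitudes E)
    (c : (Q → Bool) → ℂ) (h : ∀ b, slice e b ψ = c b • φ) :
    probOne (e o) (Circuit.apply (Circuit.map e he C) ψ) * sqNorm φ =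
      probOne o (Circuit.apply C φ) * sqNorm ψ := by
  have h2 : (0 : ℝ) < 2 ^ Fintype.card E := by positivity
  refine mul_left_cancel₀ h2.ne' ?_
  rw [← mul_assoc, ← sum_probOne_slice he, mul_left_comm, ← sum_sqNorm_slice he]
  simp only [Circuit.slice_apply_map he, h, Circuit.apply_smul, probOne_smul, sqNorm_smul,
    ← Finset.sum_mul]
  ring

end linear

end MultiMerlin

/-! ### The building blocks: reversible logic, coins and swap tests -/

noncomputable section

namespace MultiMerlin

/-! ### Qubits that a circuit does not touch -/

namespace Circuit

variable {Q : Type}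

/-- The circuit `C` does not act on the qubit `t`. -/
def Avoids {Q : Type} (C : Circuit Q) (t : Q) : Prop := ∀ g ∈ C, t ∉ g.operands

theorem Avoids.append {C C' : Circuit Q} {t : Q} (h : Avoids C t) (h' : Avoids C' t) :
    Avoids (C ++ C') t := by
  intro g hg
  rcases List.mem_append.1 hg with hg | hg
  exacts [h g hg, h' g hg]

theorem Avoids.flatMap {α : Type*} {w : List α} {C : α → Circuit Q} {t : Q}
    (h : ∀ a ∈ w, Avoids (C a) t) : Avoids (w.flatMap C) t := by
  intro g hg
  obtain ⟨a, ha, hg⟩ := List.mem_flatMap.1 hg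
  exact h a ha g hg

theorem Avoids.map {E : Type} {e : E → Q} (he : e.Injective) {C : Circuit E} {t : Q}
    (h : ∀ a, e a ≠ t) : Avoids (Circuit.map e he C) t := by
  intro g hg
  obtain ⟨g, -, rfl⟩ := List.mem_map.1 hg
  cases g <;> simp [Gate.map, Gate.operands, Ne.symm (h _)]

theorem Avoids.singleton {g : Gate Q} {t : Q} (h : t ∉ g.operands) : Avoids [g] t := by
  intro g' hg'
  rw [List.mem_singleton.1 hg']
  exact h

end Circuit

variable {Q : Type} [DecidableEq Q]

theorem Circuit.apply_singleton (g : Gate Q) (ψ : Amplitudes Q) :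
    Circuit.apply [g] ψ = g.apply ψ := rfl

/-- A gate that does not act on `t` relates only amplitudes with the same value of `t`. This keeps
track of the work qubits that are still zero. -/
theorem Gate.apply_eq_zero {g : Gate Q} {t : Q} (hg : t ∉ g.operands) {ψ : Amplitudes Q}
    (hψ : ∀ b : Q → Bool, b t = true → ψ b = 0) (b : Q → Bool) (hb : b t = true) :
    g.apply ψ b = 0 := by
  cases g <;> simp only [Gate.operands, List.mem_cons, List.not_mem_nil, or_false, not_or] at hg <;>
    simp [Gate.apply, hψ, hb, hg]

theorem Circuit.Avoids.apply_eq_zero {C : Circuit Q} {t : Q} (hC : C.Avoids t) {ψ : Amplitudes Q}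
    (hψ : ∀ b : Q → Bool, b t = true → ψ b = 0) (b : Q → Bool) (hb : b t = true) :
    Circuit.apply C ψ b = 0 := by
  induction C generalizing ψ with
  | nil => exact hψ b hb
  | cons g C ih =>
    exact ih (fun g' hg' => hC g' (List.mem_cons_of_mem _ hg'))
      (Gate.apply_eq_zero (hC g List.mem_cons_self) hψ)

/-! ### Single gates -/

/-- The circuit that consists of a controlled negation. -/
def cnotGate (c t : Q) : Circuit Q := if h : c ≠ t then [.cnot c t h] else []

/-- The circuit that consists of a doubly controlled negation. -/
def toffoliGate (c₁ c₂ t : Q) : Circuit Q :=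
  if h : c₁ ≠ c₂ ∧ c₁ ≠ t ∧ c₂ ≠ t then [.toffoli c₁ c₂ t h.1 h.2.1 h.2.2] else []

theorem apply_cnotGate {c t : Q} (h : c ≠ t) (ψ : Amplitudes Q) :
    Circuit.apply (cnotGate c t) ψ = fun b => ψ (Function.update b t (xor (b t) (b c))) := by
  simp [cnotGate, h, Circuit.apply, Gate.apply]

theorem apply_toffoliGate {c₁ c₂ t : Q} (hcc : c₁ ≠ c₂) (h₁ : c₁ ≠ t) (h₂ : c₂ ≠ t)
    (ψ : Amplitudes Q) : Circuit.apply (toffoliGate c₁ c₂ t) ψ =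
      fun b => ψ (Function.update b t (xor (b t) (b c₁ && b c₂))) := by
  simp [toffoliGate, hcc, h₁, h₂, Circuit.apply, Gate.apply]

theorem avoids_cnotGate {c t q : Q} (hc : q ≠ c) (ht : q ≠ t) : (cnotGate c t).Avoids q := by
  rw [cnotGate]
  split_ifs
  · exact .singleton (by simp [Gate.operands, hc, ht])
  · simp [Circuit.Avoids]

theorem avoids_toffoliGate {c₁ c₂ t q : Q} (hc₁ : q ≠ c₁) (hc₂ : q ≠ c₂) (ht : q ≠ t) :
    (toffoliGate c₁ c₂ t).Avoids q := by
  rw [toffoliGate]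
  split_ifs
  · exact .singleton (by simp [Gate.operands, hc₁, hc₂, ht])
  · simp [Circuit.Avoids]

/-! ### Reversible computations -/

/-- The circuit `C` acts on the probabilities as the map `f` of the computational basis. -/
def Circuit.Permutes [Fintype Q] (C : Circuit Q) (f : (Q → Bool) → Q → Bool) : Prop :=
  ∀ (F : (Q → Bool) → ℝ) (ψ : Amplitudes Q),
    ∑ b, F b * ‖Circuit.apply C ψ b‖ ^ 2 = ∑ b, F (f b) * ‖ψ b‖ ^ 2

namespace Circuit

variable [Fintype Q]

theorem Permutes.append {C C' : Circuit Q} {f f' : (Q → Bool) → Q → Bool} (h : Permutes C f)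
    (h' : Permutes C' f') : Permutes (C ++ C') fun b => f' (f b) := by
  intro F ψ
  rw [Circuit.apply_append, h' F, h fun b => F (f' b)]

theorem permutes_nil : Permutes ([] : Circuit Q) fun b => b := fun _ _ => rfl

theorem permutes_of_involutive {C : Circuit Q} {f : (Q → Bool) → Q → Bool} (hf : f.Involutive)
    (h : ∀ ψ, Circuit.apply C ψ = fun b => ψ (f b)) : Permutes C f := by
  intro F ψ
  rw [h, ← Equiv.sum_comp hf.toPerm]
  refine Finset.sum_congr rfl fun b _ => ?_
  change F (f b) * ‖ψ (f (f b))‖ ^ 2 = _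
  rw [hf b]

theorem permutes_pauliX (t : Q) : Permutes [.pauliX t] fun b => Function.update b t (!b t) :=
  permutes_of_involutive (fun b => by simp) fun _ => rfl

theorem permutes_cnotGate {c t : Q} (h : c ≠ t) :
    Permutes (cnotGate c t) fun b => Function.update b t (xor (b t) (b c)) :=
  permutes_of_involutive (update_update_involutive t (fun b => b c) fun b y => by simp [h])
    (apply_cnotGate h)

theorem permutes_toffoliGate {c₁ c₂ t : Q} (hcc : c₁ ≠ c₂) (h₁ : c₁ ≠ t) (h₂ : c₂ ≠ t) :
    Permutes (toffoliGate c₁ c₂ t) fun b => Function.update b t (xor (b t) (b c₁ && b c₂)) :=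
  permutes_of_involutive (update_update_involutive t (fun b => b c₁ && b c₂) fun b y => by
    simp [h₁, h₂]) (apply_toffoliGate hcc h₁ h₂)

end Circuit

/-- Compute the conjunction of `x 0` and the first `n` qubits `y`, on the qubit `x n`. -/
def conjunction (x y : ℕ → Q) (n : ℕ) : Circuit Q :=
  (List.range n).flatMap fun i => toffoliGate (x i) (y i) (x (i + 1))

/-- The result of the circuit `conjunction` on the computational basis. -/
def conjoin (x y : ℕ → Q) : ℕ → (Q → Bool) → Q → Bool
  | 0, b => b
  | n + 1, b => Function.update (conjoin x y n b) (x (n + 1))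
      (xor (conjoin x y n b (x (n + 1))) (conjoin x y n b (x n) && conjoin x y n b (y n)))

theorem permutes_conjunction [Fintype Q] {x y : ℕ → Q} {n : ℕ}
    (hx : ∀ i ≤ n, ∀ j ≤ n, i ≠ j → x i ≠ x j) (hxy : ∀ i ≤ n, ∀ j < n, x i ≠ y j) :
    (conjunction x y n).Permutes (conjoin x y n) := by
  induction n with
  | zero => exact Circuit.permutes_nil
  | succ n ih =>
    rw [conjunction, List.range_succ, List.flatMap_append, List.flatMap_singleton]
    exact (ih (fun i hi j hj => hx i (by omega) j (by omega))
      fun i hi j hj => hxy i (by omega) j (by omega)).append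
        (Circuit.permutes_toffoliGate (hxy _ (by omega) _ (by omega))
          (hx _ (by omega) _ (by omega) (by omega)) (hxy _ (by omega) _ (by omega)).symm)

theorem conjoin_of_ne {x y : ℕ → Q} {n : ℕ} {q : Q} (hq : ∀ i < n, x (i + 1) ≠ q) (b : Q → Bool) :
    conjoin x y n b q = b q := by
  induction n with
  | zero => rfl
  | succ n ih =>
    rw [conjoin, Function.update_of_ne (hq n (by omega)).symm, ih fun i hi => hq i (by omega)]

/-- By `hb` each target `x (i + 1)` is zero when its Toffoli gate is reached, so the exclusive or
writes the conjunction itself. -/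
theorem conjoin_apply_last {x y : ℕ → Q} {n : ℕ}
    (hx : ∀ i ≤ n, ∀ j ≤ n, i ≠ j → x i ≠ x j) (hxy : ∀ i ≤ n, ∀ j < n, x i ≠ y j)
    {b : Q → Bool} (hb : ∀ i < n, b (x (i + 1)) = false) :
    conjoin x y n b (x n) = true ↔ b (x 0) = true ∧ ∀ i < n, b (y i) = true := by
  induction n with
  | zero => simp [conjoin]
  | succ n ih =>
    rw [conjoin, Function.update_self,
      conjoin_of_ne (fun i hi => hx _ (by omega) _ (by omega) (by omega)), hb n (by omega),
      conjoin_of_ne (q := y n) (fun i hi => hxy _ (by omega) _ (by omega)), Bool.false_xor,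
      Bool.and_eq_true, ih (fun i hi j hj => hx i (by omega) j (by omega))
      (fun i hi j hj => hxy i (by omega) j (by omega)) (fun i hi => hb i (by omega)), and_assoc]
    rw [Nat.forall_lt_succ_right]

/-! ### Coins -/

/-- Set the first `n` qubits `y` to zero. -/
def clearBits (y : ℕ → Q) : ℕ → (Q → Bool) → Q → Bool
  | 0, b => b
  | n + 1, b => clearBits y n (Function.update b (y n) false)

theorem clearBits_of_ne {y : ℕ → Q} {n : ℕ} {q : Q} (hq : ∀ i < n, y i ≠ q) (b : Q → Bool) :
    clearBits y n b q = b q := by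
  induction n generalizing b with
  | zero => rfl
  | succ n ih =>
    rw [clearBits, ih fun i hi => hq i (by omega), Function.update_of_ne (hq n (by omega)).symm]

theorem clearBits_apply {y : ℕ → Q} {n i : ℕ} (hi : i < n) (b : Q → Bool) :
    clearBits y n b (y i) = false := by
  have key : ∀ (n : ℕ) (b : Q → Bool) (q : Q), b q = false → clearBits y n b q = false := by
    intro n
    induction n with
    | zero => exact fun _ _ h => h
    | succ n ih =>
      intro b q hq
      refine ih _ _ ?_
      rw [Function.update_apply]
      split_ifs
      exacts [rfl, hq]
  induction n generalizing b with
  | zero => omega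
  | succ n ih =>
    rcases Nat.lt_succ_iff_lt_or_eq.1 hi with h | rfl
    · exact ih h _
    · exact key i (Function.update b (y i) false) _ (by simp)

/-- Put the first `n` qubits `y` in uniform superposition. -/
def coins (y : ℕ → Q) (n : ℕ) : Circuit Q := (List.range n).flatMap fun i => [.hadamard (y i)]

/-- The coins start at zero, so each Hadamard gate copies the amplitude at zero to both values with
the same sign. -/
theorem apply_coins {y : ℕ → Q} {n : ℕ} (hy : ∀ i < n, ∀ j < n, i ≠ j → y i ≠ y j)
    {ψ : Amplitudes Q} (hψ : ∀ b : Q → Bool, ∀ i < n, b (y i) = true → ψ b = 0) (b : Q → Bool) :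
    Circuit.apply (coins y n) ψ b = ((√2 : ℝ) : ℂ)⁻¹ ^ n * ψ (clearBits y n b) := by
  induction n generalizing b with
  | zero => simp [coins, Circuit.apply, clearBits]
  | succ n ih =>
    have hav : (coins y n).Avoids (y n) := .flatMap fun i hi => .singleton (by
      have := List.mem_range.1 hi
      simpa [Gate.operands] using hy n (by omega) i (by omega) (by omega))
    have hz := hav.apply_eq_zero (ψ := ψ) fun b => hψ b n (by omega)
    have ih := ih (fun i hi j hj => hy i (by omega) j (by omega))
      (fun b i hi => hψ b i (by omega))
    have e : coins y (n + 1) = coins y n ++ [.hadamard (y n)] := by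
      simp [coins, List.range_succ]
    rw [e, Circuit.apply_append, Circuit.apply_singleton]
    simp only [Gate.apply]
    rw [hz (Function.update b (y n) true) (by simp), ih, clearBits]
    ring

/-! ### Swap tests -/

/-- Exchange the first `n` qubits `p` with the first `n` qubits `p'`. -/
def swapBits (p p' : ℕ → Q) : ℕ → (Q → Bool) → Q → Bool
  | 0, b => b
  | n + 1, b => swapBits p p' n
      (Function.update (Function.update b (p n) (b (p' n))) (p' n) (b (p n)))

theorem swapBits_of_ne {p p' : ℕ → Q} {n : ℕ} {q : Q} (hq : ∀ i < n, p i ≠ q ∧ p' i ≠ q)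
    (b : Q → Bool) : swapBits p p' n b q = b q := by
  induction n generalizing b with
  | zero => rfl
  | succ n ih =>
    rw [swapBits, ih fun i hi => hq i (by omega), Function.update_of_ne (hq n (by omega)).2.symm,
      Function.update_of_ne (hq n (by omega)).1.symm]

theorem swapBits_apply {p p' : ℕ → Q} {n : ℕ} (hp : ∀ i < n, ∀ j < n, i ≠ j → p i ≠ p j)
    (hp' : ∀ i < n, ∀ j < n, i ≠ j → p' i ≠ p' j) (hpp : ∀ i < n, ∀ j < n, p i ≠ p' j)
    (b : Q → Bool) {i : ℕ} (hi : i < n) :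
    swapBits p p' n b (p i) = b (p' i) ∧ swapBits p p' n b (p' i) = b (p i) := by
  induction n generalizing b with
  | zero => omega
  | succ n ih =>
    rw [swapBits]
    rcases Nat.lt_succ_iff_lt_or_eq.1 hi with h | rfl
    · have := ih (fun i hi j hj => hp i (by omega) j (by omega))
        (fun i hi j hj => hp' i (by omega) j (by omega))
        (fun i hi j hj => hpp i (by omega) j (by omega))
        (Function.update (Function.update b (p n) (b (p' n))) (p' n) (b (p n))) h
      rw [this.1, this.2]
      have h1 := hp i (by omega) n (by omega) h.ne
      have h2 := hp' i (by omega) n (by omega) h.ne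
      have h3 := hpp i (by omega) n (by omega)
      have h4 := hpp n (by omega) i (by omega)
      simp [h1, h2, h3, h4.symm]
    · have h3 := hpp i (by omega) i (by omega)
      rw [swapBits_of_ne fun j hj => ⟨hp j (by omega) i (by omega) (by omega),
          (hpp i (by omega) j (by omega)).symm⟩,
        swapBits_of_ne fun j hj => ⟨hpp j (by omega) i (by omega),
          hp' j (by omega) i (by omega) (by omega)⟩]
      simp [h3]

/-- Swap the first `n` qubits `p` and `p'`, controlled by the qubit `y`. -/
def controlledSwap (y : Q) (p p' : ℕ → Q) (n : ℕ) : Circuit Q :=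
  (List.range n).flatMap fun i =>
    cnotGate (p' i) (p i) ++ toffoliGate y (p i) (p' i) ++ cnotGate (p' i) (p i)

/-- A controlled swap of two qubits is a Toffoli gate conjugated by controlled negations, as `key`
verifies on bits. -/
theorem apply_controlledSwap {y : Q} {p p' : ℕ → Q} {n : ℕ} (hpp : ∀ i < n, p i ≠ p' i)
    (hp : ∀ i < n, y ≠ p i) (hp' : ∀ i < n, y ≠ p' i) (ψ : Amplitudes Q) (b : Q → Bool) :
    Circuit.apply (controlledSwap y p p' n) ψ b = ψ (if b y then swapBits p p' n b else b) := by
  induction n generalizing b with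
  | zero => simp [controlledSwap, Circuit.apply, swapBits]
  | succ n ih =>
    have h := hpp n (by omega)
    have h1 := hp n (by omega)
    have h2 := hp' n (by omega)
    have e : controlledSwap y p p' (n + 1) = controlledSwap y p p' n ++
        (cnotGate (p' n) (p n) ++ toffoliGate y (p n) (p' n) ++ cnotGate (p' n) (p n)) := by
      simp [controlledSwap, List.range_succ]
    rw [e, Circuit.apply_append, Circuit.apply_append, Circuit.apply_append, apply_cnotGate h.symm,
      apply_toffoliGate h1 h2 h, apply_cnotGate h.symm]
    simp only [ih (fun i hi => hpp i (by omega))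
      (fun i hi => hp i (by omega)) (fun i hi => hp' i (by omega))]
    have key : Function.update (Function.update (Function.update b (p n) (xor (b (p n)) (b (p' n))))
        (p' n) (xor (b (p' n)) (b y && xor (b (p n)) (b (p' n))))) (p n)
          (xor (xor (b (p n)) (b (p' n))) (xor (b (p' n)) (b y && xor (b (p n)) (b (p' n))))) =
        if b y then Function.update (Function.update b (p n) (b (p' n))) (p' n) (b (p n)) else b := by
      funext q
      by_cases hq : q = p n
      · subst hq
        cases b y <;> simp [h]
      · by_cases hq' : q = p' n
        · subst hq'
          cases b y <;> cases b (p n) <;> cases h4 : b (p' n) <;> simp [h.symm, h4]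
        · cases b y <;> simp [hq, hq']
    simp only [ne_eq, h, h.symm, h1, h2, not_false_eq_true, Function.update_of_ne,
      Function.update_self, key]
    cases hy : b y
    · simp
    · simp [swapBits]

/-- A swap test of the first `n` qubits `p` and `p'`, with the outcome on the qubit `y`. -/
def swapTest (y : Q) (p p' : ℕ → Q) (n : ℕ) : Circuit Q :=
  [.hadamard y] ++ controlledSwap y p p' n ++ ([.hadamard y] ++ [.pauliX y])

/-- The second Hadamard gate collects the average of the unswapped and swapped amplitudes at `y =
0`, and the final negation moves it to `y = 1`, so that one means success. Amplitudes with `y` set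
at the start vanish by `hψ`. -/
theorem apply_swapTest {y : Q} {p p' : ℕ → Q} {n : ℕ} (hpp : ∀ i < n, p i ≠ p' i)
    (hp : ∀ i < n, y ≠ p i) (hp' : ∀ i < n, y ≠ p' i) {ψ : Amplitudes Q}
    (hψ : ∀ b : Q → Bool, b y = true → ψ b = 0) {b : Q → Bool} (hb : b y = true) :
    Circuit.apply (swapTest y p p' n) ψ b = 2⁻¹ * (ψ (Function.update b y false) +
      ψ (swapBits p p' n (Function.update b y false))) := by
  have hs : ∀ (n : ℕ) (b : Q → Bool), (∀ i < n, y ≠ p i) → (∀ i < n, y ≠ p' i) →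
      swapBits p p' n b y = b y ∧ ∀ z, Function.update (swapBits p p' n b) y z =
        swapBits p p' n (Function.update b y z) := by
    intro n
    induction n with
    | zero => exact fun b _ _ => ⟨rfl, fun _ => rfl⟩
    | succ n ih =>
      intro b h1 h2
      have e1 := h1 n (by omega)
      have e2 := h2 n (by omega)
      have ih := fun b => ih b (fun i hi => h1 i (by omega)) (fun i hi => h2 i (by omega))
      simp only [swapBits, (ih _).1, (ih _).2]
      refine ⟨by simp [e1, e2], fun z => ?_⟩
      rw [Function.update_comm e2.symm, Function.update_comm e1.symm]
      simp [e1.symm, e2.symm]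
  have h2 : ((√2 : ℝ) : ℂ)⁻¹ * ((√2 : ℝ) : ℂ)⁻¹ = 2⁻¹ := by
    rw [← mul_inv, ← Complex.ofReal_mul, Real.mul_self_sqrt (by norm_num)]
    simp
  have hs' := fun b => hs n b hp hp'
  simp only [swapTest, Circuit.apply_append, Circuit.apply_singleton, Gate.apply]
  simp only [apply_controlledSwap hpp hp hp', hb, Function.update_idem,
    Function.update_self, Bool.not_true, Bool.false_eq_true, if_false, if_true, (hs' _).1,
    (hs' _).2]
  have z1 : ψ (Function.update b y true) = 0 := hψ _ (by simp)
  have z2 : ψ (swapBits p p' n (Function.update b y true)) = 0 := hψ _ (by simp [(hs' _).1])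
  rw [z1, z2, ← h2]
  ring

end MultiMerlin

noncomputable section

namespace MultiMerlin

/-! ### The two-proof verification circuit -/

/-- The qubits of the two-proof verification circuit that is made of a circuit with `v` work qubits:
the work qubits are spread out to make room for `N` swap tests and `l` coins, and each proof
consists of `N` blocks of `N` qubits. -/
abbrev TwoProofQubit (N l v : ℕ) : Type := Qubit (5 * (N + l + v) + 6) 2 (N * N)

section twoProof

variable {N l v k m : ℕ}

/-- The work qubit number `p`. -/
def workQubit (N l v p : ℕ) : TwoProofQubit N l v :=
  .inl ⟨p % (5 * (N + l + v) + 6), Nat.mod_lt _ (by omega)⟩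

/-- The qubit number `u` of the proof `c`. -/
def proofQubit (N l v : ℕ) [NeZero N] (c : Fin 2) (u : ℕ) : TwoProofQubit N l v :=
  .inr (c, ⟨u % (N * N), Nat.mod_lt _ (Nat.mul_pos (NeZero.pos N) (NeZero.pos N))⟩)

/-- Reduction modulo the register size makes the numbering total on `ℕ`; numbers name distinct
qubits only within the register. -/
theorem workQubit_ne {p p' : ℕ} (hp : p < 5 * (N + l + v) + 6) (hp' : p' < 5 * (N + l + v) + 6)
    (h : p ≠ p') : workQubit N l v p ≠ workQubit N l v p' := by
  simpa [workQubit, Nat.mod_eq_of_lt hp, Nat.mod_eq_of_lt hp'] using h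

theorem workQubit_ne_proofQubit [NeZero N] {p u : ℕ} {c : Fin 2} :
    workQubit N l v p ≠ proofQubit N l v c u := by
  simp [workQubit, proofQubit]

theorem proofQubit_ne [NeZero N] {c c' : Fin 2} {u u' : ℕ} (hu : u < N * N) (hu' : u' < N * N)
    (h : c ≠ c' ∨ u ≠ u') : proofQubit N l v c u ≠ proofQubit N l v c' u' := by
  simp only [proofQubit, Nat.mod_eq_of_lt hu, Nat.mod_eq_of_lt hu', ne_eq, Sum.inr.injEq,
    Prod.mk.injEq, Fin.mk.injEq]
  tauto

theorem describeQubit_workQubit {p : ℕ} (hp : p < 5 * (N + l + v) + 6) :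
    describeQubit (workQubit N l v p) = workText p := by
  simp [workQubit, describeQubit, workText, Nat.mod_eq_of_lt hp]

theorem describeQubit_proofQubit [NeZero N] {c : Fin 2} {u : ℕ} (hu : u < N * N) :
    describeQubit (proofQubit N l v c u) = proofText c u := by
  simp [proofQubit, describeQubit, proofText, Nat.mod_eq_of_lt hu]

theorem add_mul_lt_mul {i j : ℕ} (hi : i < N) (hj : j < N) : i + N * j < N * N := by
  have : N * (j + 1) ≤ N * N := Nat.mul_le_mul_left _ hj
  rw [Nat.mul_succ] at this
  omega

theorem add_mul_injective {i j i' j' : ℕ} (hi : i < N) (hi' : i' < N)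
    (h : i + N * j = i' + N * j') : i = i' ∧ j = j' := by
  have h1 := congrArg (· % N) h
  simp only [Nat.add_mul_mod_self_left, Nat.mod_eq_of_lt hi, Nat.mod_eq_of_lt hi'] at h1
  subst h1
  exact ⟨rfl, Nat.eq_of_mul_eq_mul_left (by omega) (Nat.add_left_cancel h)⟩

/-- The qubits on which the given circuit acts, together with all of the two proofs. -/
abbrev PairQubit (N v : ℕ) : Type := Fin v ⊕ (Fin 2 × (Fin N × Fin N))

/-- The position of a qubit in the two-proof verification circuit. -/
def pairEmbedding (N l v : ℕ) [NeZero N] : PairQubit N v → TwoProofQubit N l v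
  | .inl i => workQubit N l v (5 * i + 5)
  | .inr (c, (j, i)) => proofQubit N l v c (i + N * j)

theorem pairEmbedding_injective [NeZero N] : (pairEmbedding N l v).Injective := by
  rintro (i | ⟨c, j, i⟩) (i' | ⟨c', j', i'⟩) h
  · by_contra hne
    refine workQubit_ne (N := N) (l := l) (v := v) (p := 5 * i + 5) (p' := 5 * i' + 5) (by omega)
      (by omega) ?_ h
    intro h
    exact hne (congrArg _ (Fin.ext (by omega)))
  · exact absurd h workQubit_ne_proofQubit
  · exact absurd h.symm workQubit_ne_proofQubit
  · by_contra hne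
    refine proofQubit_ne (N := N) (l := l) (v := v) (c := c) (c' := c') (u := i + N * j)
      (u' := i' + N * j') (add_mul_lt_mul i.2 j.2) (add_mul_lt_mul i'.2 j'.2) ?_ h
    by_contra! h'
    obtain ⟨h1, h2⟩ := add_mul_injective i.2 i'.2 h'.2
    exact hne (by rw [h'.1, Fin.ext h1, Fin.ext h2])

/-- The quantum proofs of the given circuit are put in the first of the two proofs, in different
blocks. -/
def blockEmbedding (hk : k ≤ N) (hm : m ≤ N) : Qubit v k m → PairQubit N v
  | .inl i => .inl i
  | .inr (j, i) => .inr (0, (j.castLE hk, i.castLE hm))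

theorem blockEmbedding_injective (hk : k ≤ N) (hm : m ≤ N) :
    (blockEmbedding hk hm : Qubit v k m → PairQubit N v).Injective := by
  rintro (i | ⟨j, i⟩) (i' | ⟨j', i'⟩) h <;> simp_all [blockEmbedding]

/-- The two-proof verification circuit that is made of the circuit `C`: it swap tests the blocks of
the two proofs, and then, only if all of `l` coins show one, it runs `C` on the first proof. -/
def twoProofCircuit [NeZero N] (l : ℕ) (hk : k ≤ N) (hm : m ≤ N) (C : Circuit (Qubit v k m)) :
    Circuit (TwoProofQubit N l v) :=
  -- Residues modulo five separate the roles of the work qubits: `1` for tests, `2` for their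
  -- conjunctions, `3` for coins, `4` for their conjunctions, and `0` for the work qubits of `C`,
  -- shifted by five to leave qubit `0` to the output.
  coins (fun i => workQubit N l v (5 * i + 3)) l ++
  ((List.range N).flatMap fun j => swapTest (workQubit N l v (5 * j + 1))
    (fun i => proofQubit N l v 0 (i + N * j)) (fun i => proofQubit N l v 1 (i + N * j)) N) ++
  -- As a circuit, `C` is applied unconditionally; the coins only decide whether its verdict, on
  -- qubit `5`, counts.
  Circuit.map (pairEmbedding N l v) pairEmbedding_injective
    (Circuit.map (blockEmbedding hk hm) (blockEmbedding_injective hk hm) C) ++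
  ([.pauliX (workQubit N l v 2)] ++
  conjunction (fun i => workQubit N l v (5 * i + 2)) (fun i => workQubit N l v (5 * i + 1)) N ++
  (cnotGate (workQubit N l v (5 * N + 2)) (workQubit N l v 0) ++
    cnotGate (workQubit N l v (5 * N + 2)) (workQubit N l v 4)) ++
  conjunction (fun i => workQubit N l v (5 * i + 4)) (fun i => workQubit N l v (5 * i + 3)) l ++
  -- With the verdict negated, the Toffoli gate revokes acceptance exactly if the tests succeed, all
  -- coins show one and `C` rejects.
  ([.pauliX (workQubit N l v 5)] ++
    toffoliGate (workQubit N l v (5 * l + 4)) (workQubit N l v 5) (workQubit N l v 0)))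

/-! #### The description of the circuit -/

theorem describeCircuit_append {v k m : ℕ} (C C' : Circuit (Qubit v k m)) :
    describeCircuit (C ++ C') = describeCircuit C ++ describeCircuit C' := by
  simp [describeCircuit]

theorem describeCircuit_singleton {v k m : ℕ} (g : Gate (Qubit v k m)) :
    describeCircuit [g] = describeGate g := by
  simp [describeCircuit]

theorem describeCircuit_flatMap_range {v k m n : ℕ} {C : ℕ → Circuit (Qubit v k m)}
    {y : ℕ → List Bool} (h : ∀ i < n, describeCircuit (C i) = y i) :
    describeCircuit ((List.range n).flatMap C) = (List.range n).flatMap y := by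
  induction n with
  | zero => rfl
  | succ n ih =>
    simp only [List.range_succ, List.flatMap_append, describeCircuit_append,
      List.flatMap_singleton, ih fun i hi => h i (by omega), h n (by omega)]

theorem describeCircuit_cnotGate {v k m : ℕ} {c t : Qubit v k m} (h : c ≠ t) :
    describeCircuit (cnotGate c t) = describeNat 3 ++ describeQubit c ++ describeQubit t := by
  simp [cnotGate, h, describeCircuit, describeGate]

theorem describeCircuit_toffoliGate {v k m : ℕ} {c₁ c₂ t : Qubit v k m} (hcc : c₁ ≠ c₂)
    (h₁ : c₁ ≠ t) (h₂ : c₂ ≠ t) : describeCircuit (toffoliGate c₁ c₂ t) =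
      describeNat 4 ++ describeQubit c₁ ++ describeQubit c₂ ++ describeQubit t := by
  simp [toffoliGate, hcc, h₁, h₂, describeCircuit, describeGate]

theorem describeGate_map {v' k' m' : ℕ} {E : Type} {e : E → Qubit v' k' m'} (he : e.Injective)
    (g : Gate E) :
    describeGate (g.map e he) =
      describeNat g.kind ++ g.operands.flatMap fun q => describeQubit (e q) := by
  cases g <;> simp [Gate.map, describeGate, Gate.kind, Gate.operands]

theorem Circuit.map_map {E E' Q : Type} {e : E → E'} {e' : E' → Q} (he : e.Injective)
    (he' : e'.Injective) (C : Circuit E) :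
    Circuit.map e' he' (Circuit.map e he C) = Circuit.map (e' ∘ e) (he'.comp he) C := by
  simp only [Circuit.map, List.map_map]
  congr 1
  funext g
  cases g <;> rfl

/-- This links the machine with the circuit. All indices lie within their registers, so no reduction
takes effect, and all operands are distinct, so `cnotGate` and `toffoliGate` omit no gate. -/
theorem describeCircuit_twoProofCircuit [NeZero N] (hk : k ≤ N) (hm : m ≤ N)
    (C : Circuit (Qubit v k m)) : describeCircuit (twoProofCircuit l hk hm C) =
      twoProofText N l (C.flatMap (relabelGateText N)) := by
  have hN := NeZero.pos N
  have hw : ∀ p, p < 5 * (N + l + v) + 6 → describeQubit (workQubit N l v p) = workText p :=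
    fun p hp => describeQubit_workQubit hp
  have hne : ∀ p p', p < 5 * (N + l + v) + 6 → p' < 5 * (N + l + v) + 6 → p ≠ p' →
    workQubit N l v p ≠ workQubit N l v p' := fun _ _ => workQubit_ne
  have h1 : describeCircuit (coins (fun i => workQubit N l v (5 * i + 3)) l) =
      (List.range l).flatMap coinText := describeCircuit_flatMap_range fun i hi => by
    rw [describeCircuit_singleton, describeGate, hw _ (by omega)]; rfl
  have h2 : describeCircuit ((List.range N).flatMap fun j => swapTest (workQubit N l v (5 * j + 1))
      (fun i => proofQubit N l v 0 (i + N * j)) (fun i => proofQubit N l v 1 (i + N * j)) N) =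
      (List.range N).flatMap (testText N) := describeCircuit_flatMap_range fun j hj => by
    have h : describeCircuit (controlledSwap (workQubit N l v (5 * j + 1))
        (fun i => proofQubit N l v 0 (i + N * j)) (fun i => proofQubit N l v 1 (i + N * j)) N) =
        (List.range N).flatMap fun i => swapText j (i + N * j) :=
      describeCircuit_flatMap_range fun i hi => by
        have hu := add_mul_lt_mul hi hj
        have h01 := proofQubit_ne (l := l) (v := v) (c := 0) (c' := 1) hu hu (.inl (by decide))
        simp only [describeCircuit_append, describeCircuit_cnotGate h01.symm,
          describeCircuit_toffoliGate workQubit_ne_proofQubit workQubit_ne_proofQubit h01,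
          describeQubit_proofQubit hu, hw (5 * j + 1) (by omega)]
        rfl
    rw [swapTest]
    simp only [describeCircuit_append, describeCircuit_singleton, h, describeGate,
      hw (5 * j + 1) (by omega)]
    rfl
  have h3 : describeCircuit (Circuit.map (pairEmbedding N l v) pairEmbedding_injective
      (Circuit.map (blockEmbedding hk hm) (blockEmbedding_injective hk hm) C)) =
      C.flatMap (relabelGateText N) := by
    rw [Circuit.map_map, Circuit.map, describeCircuit, List.flatMap_map]
    congr 1
    funext g
    rw [describeGate_map, relabelGateText]
    congr 2
    funext q
    rcases q with i | ⟨j, i⟩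
    · exact hw _ (by omega)
    · exact describeQubit_proofQubit (add_mul_lt_mul (by simp; omega) (by simp; omega))
  have h4 : describeCircuit (conjunction (fun i => workQubit N l v (5 * i + 2))
      (fun i => workQubit N l v (5 * i + 1)) N) = (List.range N).flatMap testAndText :=
    describeCircuit_flatMap_range fun i hi => by
      rw [describeCircuit_toffoliGate (hne _ _ (by omega) (by omega) (by omega))
        (hne _ _ (by omega) (by omega) (by omega)) (hne _ _ (by omega) (by omega) (by omega)),
        hw _ (by omega), hw _ (by omega), hw _ (by omega)]
      rfl
  have h5 : describeCircuit (conjunction (fun i => workQubit N l v (5 * i + 4))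
      (fun i => workQubit N l v (5 * i + 3)) l) = (List.range l).flatMap coinAndText :=
    describeCircuit_flatMap_range fun i hi => by
      rw [describeCircuit_toffoliGate (hne _ _ (by omega) (by omega) (by omega))
        (hne _ _ (by omega) (by omega) (by omega)) (hne _ _ (by omega) (by omega) (by omega)),
        hw _ (by omega), hw _ (by omega), hw _ (by omega)]
      rfl
  rw [twoProofCircuit, twoProofText]
  simp only [describeCircuit_append, h1, h2, h3, h4, h5, describeCircuit_singleton, describeGate]
  rw [describeCircuit_cnotGate (hne _ _ (by omega) (by omega) (by omega)),
    describeCircuit_cnotGate (hne _ _ (by omega) (by omega) (by omega)),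
    describeCircuit_toffoliGate (hne _ _ (by omega) (by omega) (by omega))
      (hne _ _ (by omega) (by omega) (by omega)) (hne _ _ (by omega) (by omega) (by omega)),
    hw _ (by omega), hw _ (by omega), hw _ (by omega), hw _ (by omega), hw _ (by omega),
    hw _ (by omega)]
  simp [linkText, finalText]

end twoProof

end MultiMerlin

noncomputable section

namespace MultiMerlin

/-! ### The acceptance probability of the two-proof verification circuit -/

/-- The bits of two proofs that consist of `N` blocks of `N` bits each. -/
abbrev PairBits (N : ℕ) : Type := (Fin N → Fin N → Bool) × (Fin N → Fin N → Bool)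

section twoProof

variable {N l v k m : ℕ}

/-- The symmetrization of a state of two proofs with respect to their `j`-th blocks. -/
def symmetrize {J X : Type} [DecidableEq J] (j : J) (F : (J → X) × (J → X) → ℂ) :
    (J → X) × (J → X) → ℂ :=
  fun p => 2⁻¹ * (F p + F (Function.update p.1 j (p.2 j), Function.update p.2 j (p.1 j)))

/-- The symmetrization with respect to the first `n` blocks. -/
def symmetrizeFirst [NeZero N] : ℕ → (PairBits N → ℂ) → PairBits N → ℂ
  | 0, F => F
  | n + 1, F => symmetrize (Fin.ofNat N n) (symmetrizeFirst n F)

/-- A state of two proofs, with work qubits that are zero. -/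
def pairState (F : PairBits N → ℂ) : Amplitudes (PairQubit N v) := fun d =>
  if ∀ i : Fin v, d (.inl i) = false then
    F (fun j i => d (.inr (0, (j, i))), fun j i => d (.inr (1, (j, i)))) else 0

/-- The bits of the two proofs among the bits of the two-proof verification circuit. -/
def pairBits [NeZero N] (b : TwoProofQubit N l v → Bool) : PairBits N :=
  (fun j i => b (proofQubit N l v 0 (i + N * j)), fun j i => b (proofQubit N l v 1 (i + N * j)))

/-- The amplitudes of a quantum proof as a function of its blocks. -/
def proofAmplitudes (φ : QuantumProof (N * N)) (a : Fin N → Fin N → Bool) : ℂ :=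
  φ.1 fun u => a u.divNat u.modNat

/-- The tests that the two-proof verification circuit has performed after the first `n` swap
tests. -/
def twoProofTests [NeZero N] (l v n : ℕ) : Circuit (TwoProofQubit N l v) :=
  (List.range n).flatMap fun j => swapTest (workQubit N l v (5 * j + 1))
    (fun i => proofQubit N l v 0 (i + N * j)) (fun i => proofQubit N l v 1 (i + N * j)) N

/-- The bits of the work qubits that are not used by coins, swap tests or the given circuit are
zero. -/
def AncillaZero (b : TwoProofQubit N l v → Bool) : Prop :=
  ∀ p < 5 * (N + l + v) + 6, (∀ i < l, p ≠ 5 * i + 3) → (∀ i < N, p ≠ 5 * i + 1) →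
    (∀ i < v, p ≠ 5 * i + 5) → b (workQubit N l v p) = false

theorem AncillaZero.congr {b b' : TwoProofQubit N l v → Bool} (hb : AncillaZero b)
    (h : ∀ p < 5 * (N + l + v) + 6, (∀ i < l, p ≠ 5 * i + 3) → (∀ i < N, p ≠ 5 * i + 1) →
      (∀ i < v, p ≠ 5 * i + 5) → b' (workQubit N l v p) = b (workQubit N l v p)) :
    AncillaZero b' := fun p hp h1 h2 h3 => (h p hp h1 h2 h3).trans (hb p hp h1 h2 h3)

theorem avoids_swapTest [NeZero N] {p j : ℕ} (hj : j < N) (hp : p < 5 * (N + l + v) + 6)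
    (h : p ≠ 5 * j + 1) : (swapTest (workQubit N l v (5 * j + 1))
      (fun i => proofQubit N l v 0 (i + N * j)) (fun i => proofQubit N l v 1 (i + N * j)) N).Avoids
      (workQubit N l v p) := by
  have hne := workQubit_ne (N := N) (l := l) (v := v) hp (by omega) h
  refine .append (.append (.singleton (by simpa [Gate.operands])) (.flatMap fun i _ => ?_))
    (.append (.singleton (by simpa [Gate.operands])) (.singleton (by simpa [Gate.operands])))
  exact .append (.append (avoids_cnotGate workQubit_ne_proofQubit workQubit_ne_proofQubit)
    (avoids_toffoliGate hne workQubit_ne_proofQubit workQubit_ne_proofQubit))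
    (avoids_cnotGate workQubit_ne_proofQubit workQubit_ne_proofQubit)

theorem avoids_twoProofTests [NeZero N] {p n : ℕ} (hn : n ≤ N) (hp : p < 5 * (N + l + v) + 6)
    (h : ∀ i < n, p ≠ 5 * i + 1) : (twoProofTests (N := N) l v n).Avoids (workQubit N l v p) :=
  .flatMap fun j hj => avoids_swapTest ((List.mem_range.1 hj).trans_le hn) hp
    (h j (List.mem_range.1 hj))

theorem avoids_coins {p : ℕ} (hp : p < 5 * (N + l + v) + 6) (h : ∀ i < l, p ≠ 5 * i + 3) :
    (coins (fun i => workQubit N l v (5 * i + 3)) l).Avoids (workQubit N l v p) :=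
  .flatMap fun i hi => .singleton (by
    have := List.mem_range.1 hi
    simpa [Gate.operands] using workQubit_ne hp (by omega) (h i this))

theorem initialState_eq_zero [NeZero N] (φ : Fin 2 → QuantumProof (N * N)) {p : ℕ}
    (b : TwoProofQubit N l v → Bool) (hb : b (workQubit N l v p) = true) :
    initialState φ b = 0 := by
  rw [initialState, if_neg, zero_mul]
  intro h
  have := h ⟨p % (5 * (N + l + v) + 6), Nat.mod_lt _ (by omega)⟩
  rw [workQubit, this] at hb
  simp at hb

theorem initialState_eq [NeZero N] (φ : Fin 2 → QuantumProof (N * N))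
    (b : TwoProofQubit N l v → Bool) : initialState φ b =
      if ∀ p < 5 * (N + l + v) + 6, b (workQubit N l v p) = false then
        proofAmplitudes (φ 0) (pairBits b).1 * proofAmplitudes (φ 1) (pairBits b).2 else 0 := by
  have h1 : (∀ i : Fin (5 * (N + l + v) + 6), b (.inl i) = false) ↔
      ∀ p < 5 * (N + l + v) + 6, b (workQubit N l v p) = false := by
    refine ⟨fun h p _ => h _, fun h i => ?_⟩
    have := h i i.2
    rwa [workQubit, show (⟨i % (5 * (N + l + v) + 6), _⟩ : Fin (5 * (N + l + v) + 6)) = i from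
      Fin.ext (Nat.mod_eq_of_lt i.2)] at this
  have h2 : ∀ c : Fin 2, (φ c).1 (fun i => b (.inr (c, i))) =
      proofAmplitudes (φ c) fun j i => b (proofQubit N l v c (i + N * j)) := by
    intro c
    refine congrArg (fun f => (φ c).1 f) (funext fun u =>
      congrArg b (congrArg Sum.inr (Prod.ext rfl (Fin.ext ?_))))
    change (u : ℕ) = (u % N + N * (u / N)) % (N * N)
    rw [Nat.mod_add_div, Nat.mod_eq_of_lt u.2]
  rw [initialState, Fin.prod_univ_two, h2, h2]
  simp only [h1]
  split_ifs <;> simp [pairBits]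

/-- The amplitudes after the coin tosses and the swap tests, when the first `n` swap tests
succeed. -/
theorem apply_twoProofTests [NeZero N] (φ : Fin 2 → QuantumProof (N * N)) {n : ℕ} (hn : n ≤ N)
    (b : TwoProofQubit N l v → Bool) (hb : AncillaZero b)
    (hy : ∀ i < N, b (workQubit N l v (5 * i + 1)) = decide (i < n)) :
    Circuit.apply (coins (fun i => workQubit N l v (5 * i + 3)) l ++ twoProofTests l v n)
      (initialState φ) b = ((√2 : ℝ) : ℂ)⁻¹ ^ l *
        if ∀ i < v, b (workQubit N l v (5 * i + 5)) = false then
          symmetrizeFirst n (fun p => proofAmplitudes (φ 0) p.1 * proofAmplitudes (φ 1) p.2)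
            (pairBits b) else 0 := by
  have hne := fun {p p' : ℕ} => workQubit_ne (N := N) (l := l) (v := v) (p := p) (p' := p')
  induction n generalizing b with
  | zero =>
    have e : twoProofTests (N := N) l v 0 = [] := rfl
    rw [e, List.append_nil, apply_coins (fun i hi j hj h => hne (by omega) (by omega) (by omega))
      fun b i hi => initialState_eq_zero φ b, initialState_eq]
    have h1 : (∀ p < 5 * (N + l + v) + 6,
        clearBits (fun i => workQubit N l v (5 * i + 3)) l b (workQubit N l v p) = false) ↔
        ∀ i < v, b (workQubit N l v (5 * i + 5)) = false := by
      constructor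
      · intro h i hi
        rw [← h (5 * i + 5) (by omega)]
        exact (clearBits_of_ne (fun j hj => hne (by omega) (by omega) (by omega)) b).symm
      · intro h p hp
        by_cases h3 : ∃ i < l, p = 5 * i + 3
        · obtain ⟨i, hi, rfl⟩ := h3
          exact clearBits_apply (y := fun i => workQubit N l v (5 * i + 3)) hi b
        · push Not at h3
          rw [clearBits_of_ne fun j hj => (hne hp (by omega) (h3 j hj)).symm]
          by_cases h1 : ∃ i < N, p = 5 * i + 1
          · obtain ⟨i, hi, rfl⟩ := h1
            simpa using hy i hi
          by_cases h5 : ∃ i < v, p = 5 * i + 5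
          · obtain ⟨i, hi, rfl⟩ := h5
            exact h i hi
          push Not at h1 h5
          exact hb p hp h3 h1 h5
    have h2 : pairBits (clearBits (fun i => workQubit N l v (5 * i + 3)) l b) = pairBits b := by
      simp only [pairBits, clearBits_of_ne fun _ _ => workQubit_ne_proofQubit]
    simp only [h1, h2]
    rfl
  | succ n ih =>
    have e : twoProofTests (N := N) l v (n + 1) = twoProofTests l v n ++
        swapTest (workQubit N l v (5 * n + 1)) (fun i => proofQubit N l v 0 (i + N * n))
          (fun i => proofQubit N l v 1 (i + N * n)) N := by
      simp [twoProofTests, List.range_succ]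
    have h01 : ∀ i < N, ∀ j < N,
        proofQubit N l v 0 (i + N * n) ≠ proofQubit N l v 1 (j + N * n) := fun i hi j hj =>
      proofQubit_ne (add_mul_lt_mul hi hn) (add_mul_lt_mul hj hn) (.inl (by decide))
    have hcc : ∀ c, ∀ i < N, ∀ j < N, i ≠ j →
        proofQubit N l v c (i + N * n) ≠ proofQubit N l v c (j + N * n) := fun c i hi j hj h =>
      proofQubit_ne (add_mul_lt_mul hi hn) (add_mul_lt_mul hj hn) (.inr (by omega))
    have hz := Circuit.Avoids.apply_eq_zero (ψ := initialState φ) ((avoids_coins (N := N) (l := l)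
      (v := v) (p := 5 * n + 1) (by omega) (by omega)).append (avoids_twoProofTests (n := n)
        (by omega) (by omega) (by omega))) fun b => initialState_eq_zero φ b
    rw [e, ← List.append_assoc, Circuit.apply_append,
      apply_swapTest (fun i hi => h01 i hi i hi) (fun _ _ => workQubit_ne_proofQubit)
        (fun _ _ => workQubit_ne_proofQubit) hz (by simpa using hy n hn)]
    -- The last swap test averages the amplitudes at `b0` and `b1`: its test qubit is still zero,
    -- and block `n` is kept in one and exchanged in the other.
    set b0 := Function.update b (workQubit N l v (5 * n + 1)) false with hb0
    set b1 := swapBits (fun i => proofQubit N l v 0 (i + N * n))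
      (fun i => proofQubit N l v 1 (i + N * n)) N b0 with hb1
    have w0 : ∀ p < 5 * (N + l + v) + 6, p ≠ 5 * n + 1 →
        b0 (workQubit N l v p) = b (workQubit N l v p) := fun p hp h =>
      Function.update_of_ne (hne hp (by omega) h) _ _
    have w1 : ∀ p, b1 (workQubit N l v p) = b0 (workQubit N l v p) := fun p =>
      swapBits_of_ne (fun i hi => ⟨workQubit_ne_proofQubit.symm, workQubit_ne_proofQubit.symm⟩) _
    have y0 : ∀ i < N, b0 (workQubit N l v (5 * i + 1)) = decide (i < n) := by
      intro i hi
      by_cases h : i = n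
      · subst h; simp [hb0]
      · rw [w0 _ (by omega) (by omega), hy i hi]
        simp only [decide_eq_decide]
        omega
    have a0 : AncillaZero b0 := hb.congr fun p hp _ h _ => w0 p hp (h n hn)
    have q0 : pairBits b0 = pairBits b := by
      simp only [pairBits, hb0, Function.update_of_ne workQubit_ne_proofQubit.symm]
    have q1 : pairBits b1 = (Function.update (pairBits b).1 (Fin.ofNat N n)
        ((pairBits b).2 (Fin.ofNat N n)), Function.update (pairBits b).2 (Fin.ofNat N n)
        ((pairBits b).1 (Fin.ofNat N n))) := by
      have hval : ((Fin.ofNat N n : Fin N) : ℕ) = n := Nat.mod_eq_of_lt hn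
      have hval' : ∀ j : Fin N, j ≠ Fin.ofNat N n → (j : ℕ) ≠ n := fun j hj h =>
        hj (Fin.ext (h.trans hval.symm))
      rw [← q0]
      refine Prod.ext (funext fun j => ?_) (funext fun j => ?_)
      all_goals
        dsimp only
        by_cases hj : j = Fin.ofNat N n
        · subst hj
          rw [Function.update_self]
          funext i
          have := swapBits_apply (hcc 0) (hcc 1) h01 b0 i.2
          simp only [pairBits, hval, hb1, this]
        · rw [Function.update_of_ne hj]
          funext i
          refine swapBits_of_ne (fun i' hi' => ⟨?_, ?_⟩) b0 <;>
          exact proofQubit_ne (add_mul_lt_mul hi' hn) (add_mul_lt_mul i.2 j.2)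
            (.inr fun h => hval' j hj (add_mul_injective hi' i.2 h).2.symm)
    rw [ih (by omega) b0 a0 y0, ih (by omega) b1 (a0.congr fun p _ _ _ _ => w1 p)
      (fun i hi => (w1 _).trans (y0 i hi))]
    have c0 : (∀ i < v, b0 (workQubit N l v (5 * i + 5)) = false) ↔
        ∀ i < v, b (workQubit N l v (5 * i + 5)) = false :=
      forall₂_congr fun i hi => by rw [w0 _ (by omega) (by omega)]
    simp only [w1, c0, q0, q1, symmetrizeFirst, symmetrize]
    split_ifs <;> ring

/-- The probability with which the two-proof verification circuit accepts, if the swap tests leave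
the state `Ψ` of the proofs and the work qubits of the given circuit `C`. -/
def coinAcceptance [NeZero v] (l : ℕ) (C : Circuit (PairQubit N v))
    (Ψ : Amplitudes (PairQubit N v)) : ℝ :=
  (1 - (1 / 2) ^ l) * sqNorm Ψ + (1 / 2) ^ l * probOne (.inl 0) (Circuit.apply C Ψ)

theorem sum_ite_forall_eq_true (c : ℝ) :
    ∑ a : Fin l → Bool, (if ∀ i, a i = true then c else 0) = c := by
  rw [Finset.sum_eq_single fun _ => true]
  · simp
  · intro a _ ha
    rw [if_neg]
    exact fun h => ha (funext h)
  · simp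

/-- The result of the last gates of the two-proof verification circuit on the computational
basis. -/
theorem exists_permutes_conclusion [NeZero N] (l v : ℕ) :
    ∃ f : (TwoProofQubit N l v → Bool) → TwoProofQubit N l v → Bool, Circuit.Permutes
      ([.pauliX (workQubit N l v 2)] ++ conjunction (fun i => workQubit N l v (5 * i + 2))
        (fun i => workQubit N l v (5 * i + 1)) N ++
      (cnotGate (workQubit N l v (5 * N + 2)) (workQubit N l v 0) ++
        cnotGate (workQubit N l v (5 * N + 2)) (workQubit N l v 4)) ++
      conjunction (fun i => workQubit N l v (5 * i + 4)) (fun i => workQubit N l v (5 * i + 3)) l ++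
      ([.pauliX (workQubit N l v 5)] ++ toffoliGate (workQubit N l v (5 * l + 4))
        (workQubit N l v 5) (workQubit N l v 0))) f ∧
      ∀ b, AncillaZero b → (f b (workQubit N l v 0) = true ↔
        (∀ i < N, b (workQubit N l v (5 * i + 1)) = true) ∧
        (b (workQubit N l v 5) = true ∨ ¬ ∀ i < l, b (workQubit N l v (5 * i + 3)) = true)) := by
  have hne := fun {p p' : ℕ} => workQubit_ne (N := N) (l := l) (v := v) (p := p) (p' := p')
  have x1 : ∀ i ≤ N, ∀ j ≤ N, i ≠ j → workQubit N l v (5 * i + 2) ≠ workQubit N l v (5 * j + 2) :=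
    fun i hi j hj h => hne (by omega) (by omega) (by omega)
  have x2 : ∀ i ≤ N, ∀ j < N, workQubit N l v (5 * i + 2) ≠ workQubit N l v (5 * j + 1) :=
    fun i hi j hj => hne (by omega) (by omega) (by omega)
  have c1 : ∀ i ≤ l, ∀ j ≤ l, i ≠ j → workQubit N l v (5 * i + 4) ≠ workQubit N l v (5 * j + 4) :=
    fun i hi j hj h => hne (by omega) (by omega) (by omega)
  have c2 : ∀ i ≤ l, ∀ j < l, workQubit N l v (5 * i + 4) ≠ workQubit N l v (5 * j + 3) :=
    fun i hi j hj => hne (by omega) (by omega) (by omega)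
  refine ⟨_, ((((Circuit.permutes_pauliX _).append (permutes_conjunction x1 x2)).append
    ((Circuit.permutes_cnotGate (hne (by omega) (by omega) (by omega))).append
    (Circuit.permutes_cnotGate (hne (by omega) (by omega) (by omega))))).append
    (permutes_conjunction c1 c2)).append ((Circuit.permutes_pauliX _).append
    (Circuit.permutes_toffoliGate (hne (by omega) (by omega) (by omega))
      (hne (by omega) (by omega) (by omega)) (hne (by omega) (by omega) (by omega)))), ?_⟩
  intro b hb
  -- `b1` to `b5` follow a basis state up to the last negation and Toffoli gate; `e1` to `e5` record
  -- which work qubits each stage leaves alone.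
  set b1 := Function.update b (workQubit N l v 2) (!b (workQubit N l v 2)) with hb1
  set b2 := conjoin (fun i => workQubit N l v (5 * i + 2)) (fun i => workQubit N l v (5 * i + 1)) N
    b1 with hb2
  set b3 := Function.update b2 (workQubit N l v 0)
    (xor (b2 (workQubit N l v 0)) (b2 (workQubit N l v (5 * N + 2)))) with hb3
  set b4 := Function.update b3 (workQubit N l v 4)
    (xor (b3 (workQubit N l v 4)) (b3 (workQubit N l v (5 * N + 2)))) with hb4
  set b5 := conjoin (fun i => workQubit N l v (5 * i + 4)) (fun i => workQubit N l v (5 * i + 3)) l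
    b4 with hb5
  have e1 : ∀ p < 5 * (N + l + v) + 6, p ≠ 2 → b1 (workQubit N l v p) = b (workQubit N l v p) :=
    fun p hp h => Function.update_of_ne (hne hp (by omega) h) _ _
  have e2 : ∀ p < 5 * (N + l + v) + 6, (∀ i < N, p ≠ 5 * (i + 1) + 2) →
      b2 (workQubit N l v p) = b1 (workQubit N l v p) :=
    fun p hp h => conjoin_of_ne (fun i hi => (hne hp (by omega) (h i hi)).symm) _
  have e3 : ∀ p < 5 * (N + l + v) + 6, p ≠ 0 → b3 (workQubit N l v p) = b2 (workQubit N l v p) :=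
    fun p hp h => Function.update_of_ne (hne hp (by omega) h) _ _
  have e4 : ∀ p < 5 * (N + l + v) + 6, p ≠ 4 → b4 (workQubit N l v p) = b3 (workQubit N l v p) :=
    fun p hp h => Function.update_of_ne (hne hp (by omega) h) _ _
  have e5 : ∀ p < 5 * (N + l + v) + 6, (∀ i < l, p ≠ 5 * (i + 1) + 4) →
      b5 (workQubit N l v p) = b4 (workQubit N l v p) :=
    fun p hp h => conjoin_of_ne (fun i hi => (hne hp (by omega) (h i hi)).symm) _
  have hx : b2 (workQubit N l v (5 * N + 2)) = true ↔
      ∀ i < N, b (workQubit N l v (5 * i + 1)) = true := by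
    have := conjoin_apply_last x1 x2 (b := b1) fun i hi => by
      rw [e1 _ (by omega) (by omega)]
      exact hb _ (by omega) (by omega) (by omega) (by omega)
    rw [hb2, this]
    have h0 : b1 (workQubit N l v (5 * 0 + 2)) = true := by
      simp [hb1, hb 2 (by omega) (by omega) (by omega) (by omega)]
    rw [and_iff_right h0]
    exact forall₂_congr fun i hi => by rw [e1 _ (by omega) (by omega)]
  have z0 : b2 (workQubit N l v 0) = false := by
    rw [e2 _ (by omega) (by omega), e1 _ (by omega) (by omega)]
    exact hb _ (by omega) (by omega) (by omega) (by omega)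
  have z4 : b3 (workQubit N l v 4) = false := by
    rw [e3 _ (by omega) (by omega), e2 _ (by omega) (by omega), e1 _ (by omega) (by omega)]
    exact hb _ (by omega) (by omega) (by omega) (by omega)
  have hc : b5 (workQubit N l v (5 * l + 4)) = true ↔
      b2 (workQubit N l v (5 * N + 2)) = true ∧
      ∀ i < l, b (workQubit N l v (5 * i + 3)) = true := by
    have := conjoin_apply_last c1 c2 (b := b4) fun i hi => by
      rw [e4 _ (by omega) (by omega), e3 _ (by omega) (by omega), e2 _ (by omega) (by omega),
        e1 _ (by omega) (by omega)]
      exact hb _ (by omega) (by omega) (by omega) (by omega)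
    rw [hb5, this]
    refine and_congr ?_ (forall₂_congr fun i hi => ?_)
    · rw [hb4, Function.update_self, z4, Bool.false_xor, e3 _ (by omega) (by omega)]
    · rw [e4 _ (by omega) (by omega), e3 _ (by omega) (by omega), e2 _ (by omega) (by omega),
        e1 _ (by omega) (by omega)]
  have h5 : b5 (workQubit N l v 5) = b (workQubit N l v 5) := by
    rw [e5 _ (by omega) (by omega), e4 _ (by omega) (by omega), e3 _ (by omega) (by omega),
      e2 _ (by omega) (by omega), e1 _ (by omega) (by omega)]
  have h0 : b5 (workQubit N l v 0) = b2 (workQubit N l v (5 * N + 2)) := by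
    rw [e5 _ (by omega) (by omega), e4 _ (by omega) (by omega), hb3, Function.update_self, z0,
      Bool.false_xor]
  rw [Function.update_self, Function.update_self,
    Function.update_of_ne (hne (p := 0) (by omega) (by omega) (by omega)),
    Function.update_of_ne (hne (p := 5 * l + 4) (by omega) (by omega) (by omega)), h0, h5, ← hx]
  -- With `t` for the success of all tests, the output is the exclusive or of `t` and the
  -- conjunction of `t`, the coins and the negated verdict.
  by_cases h : b2 (workQubit N l v (5 * N + 2)) = true
  · rw [and_iff_right h] at hc
    rw [← hc]
    simp only [h, Bool.true_xor]
    cases b5 (workQubit N l v (5 * l + 4)) <;> simp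
  · have hc' : b5 (workQubit N l v (5 * l + 4)) = false := by
      rw [Bool.eq_false_iff]
      exact fun h' => h (hc.1 h').1
    simp [h, hc']

/-- The last gates permute the basis, so acceptance is the weight of the basis states that they map
to output one. There all tests have succeeded, and by `apply_twoProofTests` the amplitude is a
constant coin factor times that of `D` applied to the symmetrized state. Only one of the `2 ^ l`
coin patterns lets `D` decide. -/
theorem probOne_twoProofCircuit [NeZero N] [NeZero v] (l : ℕ) (hk : k ≤ N) (hm : m ≤ N)
    (C : Circuit (Qubit v k m)) (φ : Fin 2 → QuantumProof (N * N)) :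
    probOne (workQubit N l v 0) (Circuit.apply (twoProofCircuit l hk hm C) (initialState φ)) =
      coinAcceptance l (Circuit.map (blockEmbedding hk hm) (blockEmbedding_injective hk hm) C)
        (pairState (symmetrizeFirst N fun p =>
          proofAmplitudes (φ 0) p.1 * proofAmplitudes (φ 1) p.2)) := by
  have hne := fun {p p' : ℕ} => workQubit_ne (N := N) (l := l) (v := v) (p := p) (p' := p')
  obtain ⟨f, hf, hfb⟩ := exists_permutes_conclusion (N := N) l v
  set D := Circuit.map (blockEmbedding hk hm) (blockEmbedding_injective hk hm) C with hD
  set Ψ : Amplitudes (PairQubit N v) := pairState (symmetrizeFirst N fun p =>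
    proofAmplitudes (φ 0) p.1 * proofAmplitudes (φ 1) p.2) with hΨ
  set ψ := Circuit.apply (coins (fun i => workQubit N l v (5 * i + 3)) l ++ twoProofTests l v N)
    (initialState φ) with hψ
  set χ := Circuit.apply (Circuit.map (pairEmbedding N l v) pairEmbedding_injective D) ψ with hχ
  -- The formula for the last gates is known only if the remaining work qubits are zero; all other
  -- basis states carry no amplitude.
  have hzero : ∀ b, χ b ≠ 0 → AncillaZero b := by
    intro b hb p hp h3 h1 h5
    by_contra hbp
    refine hb (Circuit.Avoids.apply_eq_zero (t := workQubit N l v p) (Circuit.Avoids.map _ ?_)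
      (Circuit.Avoids.apply_eq_zero ((avoids_coins hp h3).append (avoids_twoProofTests le_rfl hp h1))
        fun b => initialState_eq_zero φ b) b (by simpa using hbp))
    rintro (i | ⟨c, j, i⟩)
    · exact hne (by omega) hp (h5 i i.2).symm
    · exact workQubit_ne_proofQubit.symm
  have hval : ∀ b, AncillaZero b → (∀ i < N, b (workQubit N l v (5 * i + 1)) = true) →
      χ b = ((√2 : ℝ) : ℂ)⁻¹ ^ l * Circuit.apply D Ψ (b ∘ pairEmbedding N l v) := by
    intro b hb hy
    have : slice (pairEmbedding N l v) b ψ = (((√2 : ℝ) : ℂ)⁻¹ ^ l) • Ψ := by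
      funext d
      have he : ∀ q, Function.extend (pairEmbedding N l v) d b (pairEmbedding N l v q) = d q :=
        fun q => pairEmbedding_injective.extend_apply _ _ _
      have hn : ∀ p < 5 * (N + l + v) + 6, (∀ i < v, p ≠ 5 * i + 5) →
          Function.extend (pairEmbedding N l v) d b (workQubit N l v p) = b (workQubit N l v p) := by
        intro p hp h
        refine Function.extend_apply' _ _ _ ?_
        rintro ⟨i | ⟨c, j, i⟩, h'⟩
        · exact hne (by omega) hp (h i i.2).symm h'
        · exact workQubit_ne_proofQubit h'.symm
      rw [slice, hψ, apply_twoProofTests φ le_rfl _ (hb.congr fun p hp _ _ h => hn p hp h)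
        fun i hi => by rw [hn _ (by omega) (by omega), hy i hi]; simp [hi]]
      have h1 : (∀ i < v, Function.extend (pairEmbedding N l v) d b (workQubit N l v (5 * i + 5)) =
          false) ↔ ∀ i : Fin v, d (.inl i) = false :=
        ⟨fun h i => by rw [← he]; exact h i i.2, fun h i hi => by
          rw [← h ⟨i, hi⟩]; exact he (.inl ⟨i, hi⟩)⟩
      have h2 : pairBits (Function.extend (pairEmbedding N l v) d b) =
          (fun j i => d (.inr (0, (j, i))), fun j i => d (.inr (1, (j, i)))) :=
        Prod.ext (funext fun j => funext fun i => he (.inr (0, (j, i))))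
          (funext fun j => funext fun i => he (.inr (1, (j, i))))
      simp only [h1, h2]
      rfl
    rw [hχ, Circuit.apply_map, this, Circuit.apply_smul]
    rfl
  let e : Fin l ⊕ PairQubit N v → TwoProofQubit N l v :=
    Sum.elim (fun i => workQubit N l v (5 * i + 3)) (pairEmbedding N l v)
  have he : e.Injective := by
    refine Function.Injective.sumElim ?_ pairEmbedding_injective ?_
    · intro i j h
      by_contra h'
      exact hne (by omega) (by omega) (fun h => h' (Fin.ext (by omega))) h
    · rintro i (j | ⟨c, j, j'⟩)
      · exact hne (by omega) (by omega) (by omega)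
      · exact workQubit_ne_proofQubit
  classical
  -- In an accepted basis state the test qubits are one and the remaining ancillas zero. `β` fixes
  -- these values, and the sum runs over coins, proofs and the work qubits of `C`.
  let β : TwoProofQubit N l v → Bool := fun q => decide (∃ i < N, q = workQubit N l v (5 * i + 1))
  have hacc : probOne (workQubit N l v 0)
      (Circuit.apply (twoProofCircuit l hk hm C) (initialState φ)) =
      ∑ b, (if f b (workQubit N l v 0) = true then 1 else 0) * ‖χ b‖ ^ 2 := by
    rw [← hf fun b => if b (workQubit N l v 0) = true then 1 else 0, probOne, twoProofCircuit,
      List.append_assoc]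
    refine Finset.sum_congr rfl fun b _ => ?_
    rw [hχ, hψ, ← Circuit.apply_append, ← Circuit.apply_append, hD]
    simp only [ite_mul, one_mul, zero_mul]
    rfl
  rw [hacc, sum_eq_sum_extend he β]
  -- Every coin pattern has weight `(1 / 2) ^ l`, and all of its amplitude counts, except where all
  -- coins show one and `D` rejects.
  · have hterm : ∀ a : Fin l ⊕ PairQubit N v → Bool,
        (if f (Function.extend e a β) (workQubit N l v 0) = true then 1 else 0) *
          ‖χ (Function.extend e a β)‖ ^ 2 =
        (1 / 2) ^ l * (‖Circuit.apply D Ψ (a ∘ Sum.inr)‖ ^ 2 -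
          if ∀ i, (a ∘ Sum.inl) i = true then (‖Circuit.apply D Ψ (a ∘ Sum.inr)‖ ^ 2 -
            if (a ∘ Sum.inr) (.inl 0) = true then ‖Circuit.apply D Ψ (a ∘ Sum.inr)‖ ^ 2 else 0)
          else 0) := by
      intro a
      have hae : ∀ q, Function.extend e a β (e q) = a q := fun q => he.extend_apply _ _ _
      have hout : ∀ p < 5 * (N + l + v) + 6, (∀ i < l, p ≠ 5 * i + 3) → (∀ i < v, p ≠ 5 * i + 5) →
          Function.extend e a β (workQubit N l v p) = β (workQubit N l v p) := by
        intro p hp h3 h5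
        refine Function.extend_apply' _ _ _ ?_
        rintro ⟨i | i | ⟨c, j, i⟩, h'⟩
        · exact hne (by omega) hp (h3 i i.2).symm h'
        · exact hne (by omega) hp (h5 i i.2).symm h'
        · exact workQubit_ne_proofQubit h'.symm
      have ha : AncillaZero (Function.extend e a β) := by
        intro p hp h3 h1 h5
        rw [hout p hp h3 h5, decide_eq_false_iff_not]
        rintro ⟨i, hi, h⟩
        exact hne hp (by omega) (h1 i hi) h
      have hy : ∀ i < N, Function.extend e a β (workQubit N l v (5 * i + 1)) = true := by
        intro i hi
        rw [hout _ (by omega) (by omega) (by omega), decide_eq_true_iff]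
        exact ⟨i, hi, rfl⟩
      have hc : (∀ i < l, Function.extend e a β (workQubit N l v (5 * i + 3)) = true) ↔
          ∀ i, (a ∘ Sum.inl) i = true :=
        ⟨fun h i => by rw [Function.comp, ← hae]; exact h i i.2, fun h i hi => by
          rw [← h ⟨i, hi⟩]; exact hae (.inl ⟨i, hi⟩)⟩
      have hw : Function.extend e a β (workQubit N l v 5) = (a ∘ Sum.inr) (.inl 0) :=
        hae (.inr (.inl 0))
      have hd : Function.extend e a β ∘ pairEmbedding N l v = a ∘ Sum.inr :=
        funext fun q => hae (.inr q)
      have h2 : ‖((√2 : ℝ) : ℂ)⁻¹ ^ l‖ ^ 2 = (1 / 2) ^ l := by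
        rw [norm_pow, norm_inv, pow_right_comm, inv_pow]
        simp
      rw [hval _ ha hy, hd, norm_mul, mul_pow, h2]
      have hfa := hfb _ ha
      rw [hc, hw, and_iff_right hy] at hfa
      simp only [hfa]
      generalize ‖Circuit.apply D Ψ (a ∘ Sum.inr)‖ ^ 2 = x
      by_cases h3 : ∀ i, (a ∘ Sum.inl) i = true <;>
        by_cases h4 : (a ∘ Sum.inr) (.inl 0) = true <;>
        simp only [h3, h4, not_true_eq_false, not_false_eq_true, or_false, or_true,
          if_true, if_false, one_mul, zero_mul, sub_self, sub_zero, mul_zero, implies_true,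
          Bool.false_eq_true]
    simp only [hterm]
    rw [← Finset.mul_sum, ← (Equiv.sumArrowEquivProdArrow (Fin l) (PairQubit N v) Bool).symm.sum_comp,
      Fintype.sum_prod_type_right]
    have hcomp : ∀ p : (Fin l → Bool) × (PairQubit N v → Bool),
        (Equiv.sumArrowEquivProdArrow (Fin l) (PairQubit N v) Bool).symm p ∘ Sum.inl = p.1 ∧
        (Equiv.sumArrowEquivProdArrow (Fin l) (PairQubit N v) Bool).symm p ∘ Sum.inr = p.2 :=
      fun _ => ⟨rfl, rfl⟩
    simp only [hcomp, Finset.sum_sub_distrib, sum_ite_forall_eq_true]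
    rw [coinAcceptance, ← Circuit.sqNorm_apply D Ψ, probOne, sqNorm]
    simp only [Finset.sum_const, Finset.card_univ, Fintype.card_pi, Fintype.card_bool,
      Finset.prod_const, Fintype.card_fin, nsmul_eq_mul, ← Finset.mul_sum]
    push_cast
    have h2 : (1 / 2 : ℝ) ^ l * 2 ^ l = 1 := by rw [← mul_pow]; norm_num
    linear_combination (∑ x, ‖Circuit.apply D Ψ x‖ ^ 2) * h2
  · intro b hb q hq
    have h1 : f b (workQubit N l v 0) = true := by
      by_contra h
      exact hb (by simp [h])
    have h2 : χ b ≠ 0 := fun h => hb (by simp [h])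
    have ha := hzero b h2
    have hy := ((hfb b ha).1 h1).1
    rcases q with p | ⟨c, u⟩
    · have hp : workQubit N l v p = .inl p := by
        rw [workQubit]; exact congrArg _ (Fin.ext (Nat.mod_eq_of_lt p.2))
      rw [← hp]
      by_cases h : ∃ i < N, (p : ℕ) = 5 * i + 1
      · obtain ⟨i, hi, h⟩ := h
        rw [h, hy i hi]
        exact (decide_eq_true ⟨i, hi, rfl⟩).symm
      · push Not at h
        rw [ha p p.2 (fun i hi h' => hq (.inl ⟨i, hi⟩) (by rw [← hp, h']; rfl)) h
          fun i hi h' => hq (.inr (.inl ⟨i, hi⟩)) (by rw [← hp, h']; rfl)]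
        refine (decide_eq_false ?_).symm
        rintro ⟨i, hi, h'⟩
        exact hne p.2 (by omega) (h i hi) h'
    · refine absurd ?_ (hq (.inr (.inr (c, (u.divNat, u.modNat)))))
      change proofQubit N l v c _ = _
      rw [proofQubit]
      refine congrArg Sum.inr (Prod.ext rfl (Fin.ext ?_))
      change (u % N + N * (u / N)) % (N * N) = (u : ℕ)
      rw [Nat.mod_add_div, Nat.mod_eq_of_lt u.2]

end twoProof

end MultiMerlin

noncomputable section

namespace MultiMerlin

/-! ### Symmetrized states -/

section symmetrize

variable {J X : Type} [DecidableEq J]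

/-- The exchange of the `j`-th components of two families. -/
def exchangeBlock (j : J) : Equiv.Perm ((J → X) × (J → X)) :=
  Function.Involutive.toPerm
    (fun p => (Function.update p.1 j (p.2 j), Function.update p.2 j (p.1 j)))
    fun p => by simp

theorem symmetrize_apply (j : J) (F : (J → X) × (J → X) → ℂ) (p : (J → X) × (J → X)) :
    symmetrize j F p = 2⁻¹ * (F p + F (exchangeBlock j p)) := rfl

theorem symmetrize_sub (j : J) (F G : (J → X) × (J → X) → ℂ) :
    symmetrize j (F - G) = symmetrize j F - symmetrize j G := by
  funext p
  simp only [symmetrize, Pi.sub_apply]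
  ring

theorem symmetrize_comm (i j : J) (F : (J → X) × (J → X) → ℂ) :
    symmetrize i (symmetrize j F) = symmetrize j (symmetrize i F) := by
  by_cases h : i = j
  · rw [h]
  funext p
  simp only [symmetrize, Function.update_of_ne h, Function.update_of_ne (Ne.symm h)]
  have e1 : Function.update (Function.update p.1 i (p.2 i)) j (p.2 j) =
    Function.update (Function.update p.1 j (p.2 j)) i (p.2 i) := Function.update_comm h _ _ _
  have e2 : Function.update (Function.update p.2 i (p.1 i)) j (p.1 j) =
    Function.update (Function.update p.2 j (p.1 j)) i (p.1 i) := Function.update_comm h _ _ _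
  rw [e1, e2]
  ring

variable [Fintype J] [Fintype X]

/-- `symmetrize j` is the orthogonal projection on the states invariant under exchange of the `j`-th
blocks; the parallelogram law at each point gives the Pythagorean identity. -/
theorem sqNorm_sub_symmetrize (j : J) (F : (J → X) × (J → X) → ℂ) :
    sqNorm (F - symmetrize j F) = sqNorm F - sqNorm (symmetrize j F) := by
  have h := sqNorm_comp_equiv (exchangeBlock (X := X) j) F
  have h1 : ∀ p, ‖(F - symmetrize j F) p‖ ^ 2 + ‖symmetrize j F p‖ ^ 2 =
      2⁻¹ * ‖F p‖ ^ 2 + 2⁻¹ * ‖(F ∘ exchangeBlock j) p‖ ^ 2 := by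
    intro p
    have e : (F - symmetrize j F) p = 2⁻¹ * (F p - F (exchangeBlock j p)) := by
      rw [Pi.sub_apply, symmetrize_apply]; ring
    have := parallelogram_law_with_norm ℂ (F p) (F (exchangeBlock j p))
    rw [e, symmetrize_apply, norm_mul, norm_mul, mul_pow, mul_pow]
    simp only [norm_inv, Complex.norm_ofNat, Function.comp]
    linarith
  rw [eq_sub_iff_add_eq, sqNorm, sqNorm, ← Finset.sum_add_distrib, Finset.sum_congr rfl fun p _ => h1 p,
    Finset.sum_add_distrib, ← Finset.mul_sum, ← Finset.mul_sum]
  change 2⁻¹ * sqNorm F + 2⁻¹ * sqNorm (F ∘ exchangeBlock j) = sqNorm F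
  rw [h]
  ring

theorem sqNorm_symmetrize_le (j : J) (F : (J → X) × (J → X) → ℂ) :
    sqNorm (symmetrize j F) ≤ sqNorm F := by
  have := sqNorm_sub_symmetrize j F
  have := sqNorm_nonneg (F - symmetrize j F)
  linarith

/-- If each of the contractions `T i` moves `F` only a little, then so does their product. -/
theorem sqrt_sqNorm_sub_le {α : Type*} [Fintype α] {T : ℕ → (α → ℂ) → α → ℂ}
    (hT : ∀ i F G, T i (F - G) = T i F - T i G) (hT' : ∀ i F, sqNorm (T i F) ≤ sqNorm F)
    {F : ℕ → α → ℂ} (hF : ∀ i, F (i + 1) = T i (F i)) {ε : ℝ} {n : ℕ}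
    (h : ∀ i < n, sqNorm (F 0 - T i (F 0)) ≤ ε) : √(sqNorm (F 0 - F n)) ≤ n * √ε := by
  induction n with
  | zero => simp [sqNorm]
  | succ n ih =>
    -- The contraction `T n` does not enlarge the error accumulated so far, so the errors add up.
    have e : F 0 - F (n + 1) = (F 0 - T n (F 0)) + T n (F 0 - F n) := by
      rw [hT, hF]; abel
    rw [e]
    refine (sqrt_sqNorm_add_le _ _).trans ?_
    have h1 := Real.sqrt_le_sqrt (h n (by omega))
    have h2 := Real.sqrt_le_sqrt (hT' n (F 0 - F n))
    have h3 := ih fun i hi => h i (by omega)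
    push_cast
    linarith

theorem symmetrizeFirst_symmetrize {N : ℕ} [NeZero N] (n : ℕ) (j : Fin N) (F : PairBits N → ℂ) :
    symmetrizeFirst n (symmetrize j F) = symmetrize j (symmetrizeFirst n F) := by
  induction n with
  | zero => rfl
  | succ n ih => rw [symmetrizeFirst, symmetrizeFirst, ih, symmetrize_comm]

theorem sqNorm_symmetrizeFirst_le {N : ℕ} [NeZero N] (n : ℕ) (F : PairBits N → ℂ) :
    sqNorm (symmetrizeFirst n F) ≤ sqNorm F := by
  induction n with
  | zero => exact le_rfl
  | succ n ih => exact (sqNorm_symmetrize_le _ _).trans ih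

/-- Symmetrizations commute, so any one of them may be applied first, and the others only decrease
the norm: passing all tests is no likelier than passing a given one. -/
theorem sqNorm_symmetrizeFirst_le_symmetrize {N : ℕ} [NeZero N] {n i : ℕ} (hi : i < n)
    (F : PairBits N → ℂ) :
    sqNorm (symmetrizeFirst n F) ≤ sqNorm (symmetrize (Fin.ofNat N i) F) := by
  induction n with
  | zero => omega
  | succ n ih =>
    rcases Nat.lt_succ_iff_lt_or_eq.1 hi with h | rfl
    · exact (sqNorm_symmetrize_le _ _).trans (ih h)
    · rw [symmetrizeFirst, ← symmetrizeFirst_symmetrize]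
      exact sqNorm_symmetrizeFirst_le _ _

/-! ### Projecting on a state of one block -/

/-- Exchanging `a j` with `x` is a bijection of pairs. Counting every family once for each `x`
replaces sums over the components other than `j`, and explains the factors `Fintype.card X` below.
-/
theorem sum_update {M : Type*} [AddCommMonoid M] (j : J) (h : (J → X) → M) :
    ∑ a : J → X, ∑ x, h (Function.update a j x) = Fintype.card X • ∑ a, h a := by
  let e : Equiv.Perm ((J → X) × X) := Function.Involutive.toPerm
    (fun p => (Function.update p.1 j p.2, p.1 j)) fun p => by simp
  rw [← Fintype.sum_prod_type' (f := fun a x => h (Function.update a j x))]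
  rw [show ∑ p : (J → X) × X, h (Function.update p.1 j p.2) =
    ∑ p : (J → X) × X, h p.1 from Equiv.sum_comp e fun p => h p.1, Fintype.sum_prod_type]
  simp [Finset.smul_sum]

/-- The inner product of the vector `φ` and a function of the `j`-th component of `a`. -/
def blockInner (j : J) (φ : X → ℂ) (A : (J → X) → ℂ) (a : J → X) : ℂ :=
  ∑ x, starRingEnd ℂ (φ x) * A (Function.update a j x)

/-- The projection on the vector `φ` in the `j`-th component. -/
def blockProj (j : J) (φ : X → ℂ) (A : (J → X) → ℂ) (a : J → X) : ℂ :=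
  φ (a j) * blockInner j φ A a

theorem blockInner_update {J X : Type} [DecidableEq J] [Fintype X] (j : J) (φ : X → ℂ) (A : (J → X) → ℂ) (a : J → X) (x : X) :
    blockInner j φ A (Function.update a j x) = blockInner j φ A a := by
  simp [blockInner]

theorem blockProj_sub {J X : Type} [DecidableEq J] [Fintype X] (j : J) (φ : X → ℂ) (A B : (J → X) → ℂ) :
    blockProj j φ (A - B) = blockProj j φ A - blockProj j φ B := by
  funext a
  simp [blockProj, blockInner, mul_sub]

theorem card_mul_sqNorm (j : J) (A : (J → X) → ℂ) :
    ∑ a, sqNorm (fun x => A (Function.update a j x)) = Fintype.card X * sqNorm A := by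
  rw [sqNorm, ← nsmul_eq_mul, ← sum_update j]
  rfl

theorem sqNorm_sub_proj {φ : X → ℂ} (hφ : sqNorm φ = 1) (u : X → ℂ) :
    sqNorm (fun x => u x - φ x * ∑ y, starRingEnd ℂ (φ y) * u y) =
      sqNorm u - ‖∑ y, starRingEnd ℂ (φ y) * u y‖ ^ 2 := by
  set c := ∑ y, starRingEnd ℂ (φ y) * u y with hc
  have h1 : ∀ x, ((‖u x - φ x * c‖ ^ 2 : ℝ) : ℂ) = ((‖u x‖ ^ 2 : ℝ) : ℂ) -
      starRingEnd ℂ c * (starRingEnd ℂ (φ x) * u x) -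
      c * starRingEnd ℂ (starRingEnd ℂ (φ x) * u x) +
      ((‖φ x‖ ^ 2 : ℝ) : ℂ) * (c * starRingEnd ℂ c) := by
    intro x
    push_cast
    rw [← Complex.mul_conj', ← Complex.mul_conj', ← Complex.mul_conj']
    simp only [map_sub, map_mul, Complex.conj_conj]
    ring
  have h2 : ((sqNorm (fun x => u x - φ x * c) : ℝ) : ℂ) = ((sqNorm u - ‖c‖ ^ 2 : ℝ) : ℂ) := by
    rw [sqNorm, Complex.ofReal_sum, Finset.sum_congr rfl fun x _ => h1 x, Finset.sum_add_distrib,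
      Finset.sum_sub_distrib, Finset.sum_sub_distrib, ← Finset.mul_sum, ← Finset.mul_sum,
      ← Finset.sum_mul, ← map_sum, ← hc, ← Complex.ofReal_sum, ← Complex.ofReal_sum]
    change ((sqNorm u : ℝ) : ℂ) - _ - _ + ((sqNorm φ : ℝ) : ℂ) * _ = _
    rw [hφ]
    push_cast
    rw [← Complex.mul_conj']
    ring
  exact_mod_cast h2

/-- Along each line in direction `j` the projected function is a multiple of the unit vector `φ`,
with the inner product as coefficient. -/
theorem sqNorm_blockProj {j : J} {φ : X → ℂ} (hφ : sqNorm φ = 1) (A : (J → X) → ℂ) :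
    Fintype.card X * sqNorm (blockProj j φ A) = ∑ a, ‖blockInner j φ A a‖ ^ 2 := by
  rw [← card_mul_sqNorm j]
  refine Finset.sum_congr rfl fun a _ => ?_
  have : (fun x => blockProj j φ A (Function.update a j x)) = blockInner j φ A a • φ := by
    funext x
    simp [blockProj, blockInner_update, mul_comm]
  rw [this, sqNorm_smul, hφ, mul_one]

theorem sqNorm_sub_blockProj [Nonempty X] {j : J} {φ : X → ℂ} (hφ : sqNorm φ = 1)
    (A : (J → X) → ℂ) :
    sqNorm (A - blockProj j φ A) = sqNorm A - sqNorm (blockProj j φ A) := by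
  have h0 : (0 : ℝ) < Fintype.card X := by exact_mod_cast Fintype.card_pos
  refine mul_left_cancel₀ h0.ne' ?_
  rw [mul_sub, sqNorm_blockProj hφ, ← card_mul_sqNorm j, ← card_mul_sqNorm j,
    ← Finset.sum_sub_distrib]
  refine Finset.sum_congr rfl fun a _ => ?_
  rw [blockInner, ← sqNorm_sub_proj hφ]
  congr 1
  funext x
  simp only [blockProj, blockInner_update, Pi.sub_apply, Function.update_self]
  rfl

theorem sqNorm_blockProj_le [Nonempty X] {j : J} {φ : X → ℂ} (hφ : sqNorm φ = 1)
    (A : (J → X) → ℂ) : sqNorm (blockProj j φ A) ≤ sqNorm A := by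
  have := sqNorm_sub_blockProj (j := j) hφ A
  have := sqNorm_nonneg (A - blockProj j φ A)
  linarith

/-- The product of two states. -/
def tensor {α β : Type} (A : α → ℂ) (B : β → ℂ) : α × β → ℂ := fun p => A p.1 * B p.2

theorem sqNorm_tensor {α β : Type} [Fintype α] [Fintype β] (A : α → ℂ) (B : β → ℂ) :
    sqNorm (tensor A B) = sqNorm A * sqNorm B := by
  simp only [sqNorm, tensor, norm_mul, mul_pow, Fintype.sum_prod_type, ← Finset.mul_sum,
    ← Finset.sum_mul]

/-- The swap test measures an overlap. -/
theorem sqNorm_symmetrize_tensor (j : J) (A B : (J → X) → ℂ) :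
    (Fintype.card X : ℝ) ^ 2 * (2 * sqNorm (symmetrize j (tensor A B)) - sqNorm A * sqNorm B) =
      ∑ b, ∑ a, ‖blockInner j (fun x => B (Function.update b j x)) A a‖ ^ 2 := by
  set F := tensor A B with hF
  have hswap : sqNorm (fun p => F (exchangeBlock j p)) = sqNorm F :=
    sqNorm_comp_equiv (exchangeBlock j) F
  -- The exchange preserves norms, so twice the squared norm of the symmetrization is `sqNorm F`
  -- plus the real part of the inner product of `F` with its exchanged version.
  have h1 : (2 * sqNorm (symmetrize j F) - sqNorm A * sqNorm B : ℝ) =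
      ∑ p, (starRingEnd ℂ (F p) * F (exchangeBlock j p)).re := by
    have e : ∀ p, ‖symmetrize j F p‖ ^ 2 = 4⁻¹ * ‖F p‖ ^ 2 + 4⁻¹ * ‖F (exchangeBlock j p)‖ ^ 2 +
        2⁻¹ * (starRingEnd ℂ (F p) * F (exchangeBlock j p)).re := by
      intro p
      rw [symmetrize_apply, norm_mul, mul_pow, Complex.sq_norm (_ + _), Complex.normSq_add,
        ← Complex.sq_norm, ← Complex.sq_norm]
      simp
      ring
    rw [← sqNorm_tensor, sqNorm, Finset.sum_congr rfl fun p _ => e p, Finset.sum_add_distrib,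
      Finset.sum_add_distrib, ← Finset.mul_sum, ← Finset.mul_sum, ← Finset.mul_sum]
    change 2 * (4⁻¹ * sqNorm F + 4⁻¹ * sqNorm (fun p => F (exchangeBlock j p)) + _) - sqNorm F = _
    rw [hswap]
    ring
  -- For a product state, the double sum over the `j`-th components factors into a block inner
  -- product and its conjugate. The families `a` and `b` contribute one factor `Fintype.card X`
  -- each.
  have h2 : ((Fintype.card X : ℂ) ^ 2 * ∑ p, starRingEnd ℂ (F p) * F (exchangeBlock j p)) =
      ∑ b, ∑ a, ((‖blockInner j (fun x => B (Function.update b j x)) A a‖ ^ 2 : ℝ) : ℂ) := by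
    rw [Fintype.sum_prod_type_right, pow_two, mul_assoc, ← nsmul_eq_mul, ← nsmul_eq_mul,
      ← sum_update j, Finset.smul_sum]
    refine Finset.sum_congr rfl fun b _ => ?_
    rw [Finset.smul_sum, Finset.sum_congr rfl fun x _ => (sum_update j _).symm, Finset.sum_comm]
    refine Finset.sum_congr rfl fun a _ => ?_
    push_cast
    rw [← Complex.mul_conj', blockInner, map_sum, Finset.sum_mul_sum]
    refine Finset.sum_congr rfl fun x _ => Finset.sum_congr rfl fun y _ => ?_
    have e : exchangeBlock j (Function.update a j y, Function.update b j x) =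
        (Function.update a j x, Function.update b j y) := by
      change (Function.update (Function.update a j y) j (Function.update b j x j),
        Function.update (Function.update b j x) j (Function.update a j y j)) = _
      simp
    simp only [e, hF, tensor, map_mul, Complex.conj_conj]
    ring
  have h3 := congrArg Complex.re h2
  rw [← Nat.cast_pow, ← nsmul_eq_mul, Complex.re_nsmul, nsmul_eq_mul, Complex.re_sum] at h3
  rw [h1, ← Nat.cast_pow, h3]
  simp only [Complex.re_sum, Complex.ofReal_re]

/-- If the swap test of the `j`-th blocks succeeds with high probability, then the first state is
close to a product of a state of the `j`-th block and a state of the other blocks. -/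
theorem exists_sqNorm_sub_blockProj_le [Nonempty X] (j : J) {A B : (J → X) → ℂ}
    (hA : sqNorm A = 1) (hB : sqNorm B = 1) {δ : ℝ}
    (h : 1 - δ ≤ sqNorm (symmetrize j (tensor A B))) :
    ∃ φ : X → ℂ, sqNorm φ = 1 ∧ sqNorm (A - blockProj j φ A) ≤ 2 * δ := by
  have h0 : (0 : ℝ) < Fintype.card X := by exact_mod_cast Fintype.card_pos
  have h1 := sqNorm_symmetrize_tensor j A B
  have h2 := card_mul_sqNorm j B
  rw [hA, hB] at h1
  rw [hB] at h2
  let β : (J → X) → ℝ := fun b => sqNorm fun x => B (Function.update b j x)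
  -- By averaging, some slice of `B` at fixed values of the other blocks has at least the mean
  -- overlap with `A`. Slices of weight zero contribute nothing and are excluded, because the slice
  -- is normalized below.
  obtain ⟨b, hb0, hb⟩ : ∃ b, β b ≠ 0 ∧ Fintype.card X * (1 - 2 * δ) * β b ≤
      ∑ a, ‖blockInner j (fun x => B (Function.update b j x)) A a‖ ^ 2 := by
    by_contra! hcon
    have hle : ∀ b, ∑ a, ‖blockInner j (fun x => B (Function.update b j x)) A a‖ ^ 2 ≤
        Fintype.card X * (1 - 2 * δ) * β b := by
      intro b
      by_cases hb : β b = 0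
      · have := sqNorm_eq_zero hb
        rw [hb, mul_zero]
        refine (Finset.sum_eq_zero fun a _ => ?_).le
        have hz : blockInner j (fun x => B (Function.update b j x)) A a = 0 :=
          Finset.sum_eq_zero fun x _ => by
            have := congrFun this x
            simp only [Pi.zero_apply] at this
            simp only [this, map_zero, zero_mul]
        rw [hz]
        simp
      · exact (hcon b hb).le
    obtain ⟨b, hb⟩ : ∃ b, β b ≠ 0 := by
      by_contra! hz
      rw [show ∑ a, sqNorm (fun x => B (Function.update a j x)) = 0 from
        Finset.sum_eq_zero fun b _ => hz b] at h2
      linarith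
    have hlt := Finset.sum_lt_sum (fun b _ => hle b) ⟨b, Finset.mem_univ b, hcon b hb⟩
    rw [← Finset.mul_sum, h2, ← h1] at hlt
    nlinarith [mul_le_mul_of_nonneg_left h (sq_nonneg (Fintype.card X : ℝ))]
  have hβ : 0 < β b := lt_of_le_of_ne (sqNorm_nonneg _) hb0.symm
  have hr : ‖(((√(β b))⁻¹ : ℝ) : ℂ)‖ ^ 2 = (β b)⁻¹ := by
    rw [Complex.norm_real, Real.norm_eq_abs, sq_abs, inv_pow, Real.sq_sqrt hβ.le]
  have hφ : sqNorm ((((√(β b))⁻¹ : ℝ) : ℂ) • fun x => B (Function.update b j x)) = 1 := by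
    rw [sqNorm_smul, hr]
    exact inv_mul_cancel₀ hb0
  refine ⟨_, hφ, ?_⟩
  have h3 := sqNorm_blockProj (j := j) hφ A
  have h4 : ∀ a, blockInner j ((((√(β b))⁻¹ : ℝ) : ℂ) • fun x => B (Function.update b j x)) A a =
      (((√(β b))⁻¹ : ℝ) : ℂ) * blockInner j (fun x => B (Function.update b j x)) A a := by
    intro a
    simp only [blockInner, Pi.smul_apply, smul_eq_mul, map_mul, Complex.conj_ofReal, mul_assoc,
      Finset.mul_sum]
  simp only [h4, norm_mul, mul_pow, hr, ← Finset.mul_sum] at h3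
  rw [sqNorm_sub_blockProj hφ, hA]
  have h5 : Fintype.card X * (1 - 2 * δ) ≤ Fintype.card X * sqNorm (blockProj j
      ((((√(β b))⁻¹ : ℝ) : ℂ) • fun x => B (Function.update b j x)) A) := by
    rw [h3, le_inv_mul_iff₀ hβ, mul_comm]
    exact hb
  have := le_of_mul_le_mul_left h5 h0
  linarith

/-- A product of projections yields a product state. -/
theorem exists_eq_mul_prod {N : ℕ} [NeZero N] (φ : Fin N → X → ℂ) {F : ℕ → (Fin N → X) → ℂ}
    (hF : ∀ i, F (i + 1) = blockProj (Fin.ofNat N i) (φ (Fin.ofNat N i)) (F i)) [Nonempty X] :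
    ∃ c : ℂ, ∀ a, F N a = c * ∏ j, φ j (a j) := by
  have hof : ∀ n (hn : n < N), Fin.ofNat N n = ⟨n, hn⟩ := fun n hn =>
    Fin.ext (Nat.mod_eq_of_lt hn)
  -- After `n` projections the first `n` components have split off, and the remaining factor `G`
  -- does not depend on them.
  have key : ∀ n ≤ N, ∃ G : (Fin N → X) → ℂ, (∀ a (j : Fin N) x, (j : ℕ) < n →
      G (Function.update a j x) = G a) ∧
      ∀ a, F n a = G a * ∏ j : Fin N, if (j : ℕ) < n then φ j (a j) else 1 := by
    intro n
    induction n with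
    | zero => exact fun _ => ⟨F 0, by simp, by simp⟩
    | succ n ih =>
      intro hn
      obtain ⟨G, hG, hFG⟩ := ih (by omega)
      rw [hF, hof n hn]
      refine ⟨blockInner ⟨n, hn⟩ (φ ⟨n, hn⟩) G, ?_, ?_⟩
      · intro a j x hj
        by_cases h : j = ⟨n, hn⟩
        · rw [h, blockInner_update]
        · have hj' : (j : ℕ) < n := by
            have : (j : ℕ) ≠ n := fun h' => h (Fin.ext h')
            omega
          simp only [blockInner]
          refine Finset.sum_congr rfl fun y _ => ?_
          rw [Function.update_comm h, hG _ _ _ hj']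
      · intro a
        have h1 : ∀ x, (∏ j : Fin N, if (j : ℕ) < n then
            φ j (Function.update a ⟨n, hn⟩ x j) else 1) =
            ∏ j : Fin N, if (j : ℕ) < n then φ j (a j) else 1 := by
          intro x
          refine Finset.prod_congr rfl fun j _ => ?_
          split_ifs with h
          · rw [Function.update_of_ne]
            rintro rfl
            simp at h
          · rfl
        have h2 : (∏ j : Fin N, if (j : ℕ) < n + 1 then φ j (a j) else 1) =
            φ ⟨n, hn⟩ (a ⟨n, hn⟩) * ∏ j : Fin N, if (j : ℕ) < n then φ j (a j) else 1 := by
          rw [← Finset.mul_prod_erase _ _ (Finset.mem_univ (⟨n, hn⟩ : Fin N)),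
            ← Finset.mul_prod_erase _ (fun j : Fin N => if (j : ℕ) < n then φ j (a j) else 1)
              (Finset.mem_univ (⟨n, hn⟩ : Fin N))]
          simp only [lt_add_iff_pos_right, zero_lt_one, if_true, lt_irrefl, if_false, one_mul]
          congr 1
          refine Finset.prod_congr rfl fun j hj => ?_
          have : (j : ℕ) ≠ n := fun h => (Finset.mem_erase.1 hj).1 (Fin.ext h)
          simp only [show (j : ℕ) < n + 1 ↔ (j : ℕ) < n by omega]
        rw [blockProj, h2, blockInner]
        simp only [hFG, h1, blockInner, ← mul_assoc, ← Finset.sum_mul]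
        ring
  obtain ⟨G, hG, hFG⟩ := key N le_rfl
  obtain ⟨a₀⟩ : Nonempty (Fin N → X) := inferInstance
  -- Now `G` depends on no component, as one sees by changing them one at a time.
  have hconst : ∀ a, G a = G a₀ := by
    have : ∀ n ≤ N, ∀ a, G (fun j : Fin N => if (j : ℕ) < n then a₀ j else a j) = G a := by
      intro n
      induction n with
      | zero => simp
      | succ n ih =>
        intro hn a
        have e : (fun j : Fin N => if (j : ℕ) < n + 1 then a₀ j else a j) =
            Function.update (fun j : Fin N => if (j : ℕ) < n then a₀ j else a j) ⟨n, hn⟩ (a₀ ⟨n, hn⟩) := by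
          funext j
          by_cases h : j = ⟨n, hn⟩
          · subst h; simp
          · have : (j : ℕ) ≠ n := fun h' => h (Fin.ext h')
            rw [Function.update_of_ne h]
            simp only [show (j : ℕ) < n + 1 ↔ (j : ℕ) < n by omega]
        rw [e, hG _ ⟨n, hn⟩ _ hn, ih (by omega)]
    intro a
    rw [← this N le_rfl a]
    simp
  exact ⟨G a₀, fun a => by rw [hFG, hconst]; simp⟩

end symmetrize

end MultiMerlin

noncomputable section

namespace MultiMerlin

/-! ### Soundness and completeness of the two-proof verification circuit -/

section pairState

variable {N v : ℕ}

theorem pairState_add (F G : PairBits N → ℂ) :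
    (pairState (F + G) : Amplitudes (PairQubit N v)) = pairState F + pairState G := by
  funext d
  simp only [pairState, Pi.add_apply]
  split_ifs <;> simp

theorem sqNorm_pairState (F : PairBits N → ℂ) :
    sqNorm (pairState F : Amplitudes (PairQubit N v)) = sqNorm F := by
  have he : (Sum.inr : Fin 2 × (Fin N × Fin N) → PairQubit N v).Injective := Sum.inr_injective
  rw [sqNorm, sum_eq_sum_extend he fun _ => false]
  · let e : PairBits N ≃ (Fin 2 × (Fin N × Fin N) → Bool) :=
      { toFun := fun p q => if q.1 = 0 then p.1 q.2.1 q.2.2 else p.2 q.2.1 q.2.2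
        invFun := fun d => (fun j i => d (0, (j, i)), fun j i => d (1, (j, i)))
        left_inv := fun p => by simp
        right_inv := fun d => by
          funext ⟨c, j, i⟩
          fin_cases c <;> simp }
    rw [← Equiv.sum_comp e, sqNorm]
    refine Finset.sum_congr rfl fun p _ => ?_
    rw [pairState, if_pos]
    · simp only [he.extend_apply]
      rfl
    · intro i
      exact Function.extend_apply' _ _ _ (by simp)
  · intro d hd q hq
    rcases q with i | q
    · by_contra h
      refine hd ?_
      rw [pairState, if_neg fun h' => h (h' i)]
      simp
    · exact absurd rfl (hq q)

variable [NeZero N] [NeZero v]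

/-- Here `y ^ 2` is the probability that the tests fail. Divided by `p`, the failure term is `(n ^ 4
- 1) * y ^ 2`, which pays for the excess `6 * n * y + 9 * n ^ 2 * y ^ 2` up to `1 / n`. This is the
reason for the fourth power; `64` is a convenient threshold. -/
theorem acceptance_bound {n s y p : ℝ} (hn : 64 ≤ n) (hy : 0 ≤ y) (hp : p = 1 / n ^ 4) {x : ℝ}
    (hx : x ≤ (√s + 3 * n * y) ^ 2) (hs : 0 ≤ s) (hs1 : s ≤ 1) :
    (1 - p) * (1 - y ^ 2) + p * x ≤ 1 - p * (1 - (s + 1 / n)) := by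
  have hn0 : 0 < n := by linarith
  have hp0 : 0 < p := by rw [hp]; positivity
  have h1 : (√s + 3 * n * y) ^ 2 ≤ s + 6 * n * y + 9 * n ^ 2 * y ^ 2 := by
    have h2 := Real.sq_sqrt hs
    have h3 : √s ≤ 1 := Real.sqrt_le_one.2 hs1
    have h4 : √s * (6 * n * y) ≤ 1 * (6 * n * y) := by gcongr
    nlinarith
  have h5 : 6 * n * y + 9 * n ^ 2 * y ^ 2 ≤ (n ^ 4 - 1) * y ^ 2 + 1 / n := by
    have h6 : n * (6 * n * y + 9 * n ^ 2 * y ^ 2) ≤ n * ((n ^ 4 - 1) * y ^ 2 + 1 / n) := by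
      have h7 : n * ((n ^ 4 - 1) * y ^ 2 + 1 / n) = (n ^ 5 - n) * y ^ 2 + 1 := by
        field_simp
      rw [h7]
      have h8 : 9 * n ^ 4 + 9 * n ^ 3 + n ≤ n ^ 5 := by
        have h9 : (1 : ℝ) ≤ n := by linarith
        have h10 : n ≤ n ^ 4 := le_self_pow₀ h9 (by norm_num)
        have h11 : n ^ 3 ≤ n ^ 4 := pow_le_pow_right₀ h9 (by norm_num)
        have h12 : n ^ 5 = n * n ^ 4 := by ring
        nlinarith [pow_pos hn0 4]
      have h13 := mul_le_mul_of_nonneg_right h8 (sq_nonneg y)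
      nlinarith [sq_nonneg (3 * n ^ 2 * y - 1)]
    exact le_of_mul_le_mul_left h6 hn0
  have h14 : p * x ≤ p * (s + ((n ^ 4 - 1) * y ^ 2 + 1 / n)) := by
    gcongr
    linarith
  have h15 : p * n ^ 4 = 1 := by rw [hp]; field_simp
  nlinarith

/-- The soundness of the two-proof verification circuit. -/
theorem coinAcceptance_le {l : ℕ} {D : Circuit (PairQubit N v)} {s : ℝ} (hs : 0 ≤ s) (hs1 : s ≤ 1)
    (hN : 64 ≤ N) (hl : (1 / 2 : ℝ) ^ l = 1 / (N : ℝ) ^ 4)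
    (hD : ∀ (c : ℂ) (φ : Fin N → (Fin N → Bool) → ℂ) (B : (Fin N → Fin N → Bool) → ℂ),
      probOne (.inl 0) (Circuit.apply D (pairState (tensor (fun a : Fin N → Fin N → Bool => c * ∏ j, φ j (a j)) B))) ≤
        s * sqNorm (tensor (fun a : Fin N → Fin N → Bool => c * ∏ j, φ j (a j)) B))
    {A B : (Fin N → Fin N → Bool) → ℂ} (hA : sqNorm A = 1) (hB : sqNorm B = 1) :
    coinAcceptance l D (pairState (symmetrizeFirst N (tensor A B))) ≤
      1 - (1 / 2) ^ l * (1 - (s + 1 / N)) := by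
  set F := tensor A B with hF
  have hF1 : sqNorm F = 1 := by rw [hF, sqNorm_tensor, hA, hB, one_mul]
  set G := symmetrizeFirst N F with hG
  set δ := 1 - sqNorm G with hδ
  have hδ0 : 0 ≤ δ := by
    have := sqNorm_symmetrizeFirst_le N F
    linarith
  have hsym : ∀ i < N, 1 - δ ≤ sqNorm (symmetrize (Fin.ofNat N i) F) := fun i hi => by
    have := sqNorm_symmetrizeFirst_le_symmetrize hi F
    linarith
  have h1 : √(sqNorm (F - G)) ≤ N * √δ :=
    sqrt_sqNorm_sub_le (T := fun i => symmetrize (Fin.ofNat N i))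
      (F := fun i => symmetrizeFirst i F) (fun _ => symmetrize_sub _)
      (fun _ => sqNorm_symmetrize_le _) (fun _ => rfl) fun i hi => by
        have := sqNorm_sub_symmetrize (Fin.ofNat N i) F
        have := hsym i hi
        simp only [symmetrizeFirst]
        linarith
  have hφ : ∀ j : Fin N, ∃ φ : (Fin N → Bool) → ℂ, sqNorm φ = 1 ∧
      sqNorm (A - blockProj j φ A) ≤ 2 * δ := fun j => by
    refine exists_sqNorm_sub_blockProj_le j hA hB ?_
    have := hsym j j.2
    rwa [show Fin.ofNat N (j : ℕ) = j from Fin.ext (Nat.mod_eq_of_lt j.2)] at this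
  choose φ hφ1 hφ2 using hφ
  -- `H n` is `A` projected in its first `n` blocks. `H N` is a product vector of norm at most one,
  -- to which `hD` applies.
  let H : ℕ → (Fin N → Fin N → Bool) → ℂ := fun n =>
    Nat.rec A (fun i K => blockProj (Fin.ofNat N i) (φ (Fin.ofNat N i)) K) n
  have h2 : √(sqNorm (A - H N)) ≤ N * √(2 * δ) :=
    sqrt_sqNorm_sub_le (T := fun i => blockProj (Fin.ofNat N i) (φ (Fin.ofNat N i)))
      (F := H) (fun _ => blockProj_sub _ _) (fun _ => sqNorm_blockProj_le (hφ1 _)) (fun _ => rfl)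
      fun i _ => hφ2 _
  have hH : ∀ n, sqNorm (H n) ≤ 1 := by
    intro n
    induction n with
    | zero => exact hA.le
    | succ n ih => exact (sqNorm_blockProj_le (hφ1 _) _).trans ih
  obtain ⟨c, hc⟩ := exists_eq_mul_prod φ (F := H) fun _ => rfl
  have hHN : H N = fun a => c * ∏ j, φ j (a j) := funext hc
  have h3 : √(probOne (.inl 0) (Circuit.apply D (pairState (tensor (H N) B)))) ≤ √s := by
    refine Real.sqrt_le_sqrt ?_
    have := hD c φ B
    rw [← hHN, sqNorm_tensor, hB, mul_one] at this
    exact this.trans (mul_le_of_le_one_right hs (hH N))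
  have hsmall : ∀ K : PairBits N → ℂ, √(probOne (.inl 0) (Circuit.apply D (pairState K))) ≤
      √(sqNorm K) := fun K => Real.sqrt_le_sqrt <| by
    have := probOne_le_sqNorm (.inl 0) (Circuit.apply D (pairState K))
    rwa [Circuit.sqNorm_apply, sqNorm_pairState] at this
  -- Since `hD` admits an arbitrary second factor, only `A` has to be replaced by a product.
  have h4 : G = tensor (H N) B + (tensor (A - H N) B + (G - F)) := by
    funext p
    simp only [hF, tensor, Pi.add_apply, Pi.sub_apply]
    ring
  -- The factor `3` is `1` for the tests plus `√2 ≤ 2` for the projections.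
  have h5 : √(probOne (.inl 0) (Circuit.apply D (pairState G))) ≤ √s + 3 * N * √δ := by
    rw [h4, pairState_add, Circuit.apply_add, pairState_add, Circuit.apply_add]
    refine (sqrt_probOne_add_le _ _ _).trans (add_le_add h3 ((sqrt_probOne_add_le _ _ _).trans ?_))
    have h6 := hsmall (tensor (A - H N) B)
    have h7 := hsmall (G - F)
    have h8 : sqNorm (G - F) = sqNorm (F - G) := by
      rw [← neg_sub, ← neg_one_smul ℂ, sqNorm_smul]
      simp
    have h9 : √2 ≤ 2 := by
      rw [Real.sqrt_le_left (by norm_num)]; norm_num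
    rw [sqNorm_tensor, hB, mul_one] at h6
    rw [h8] at h7
    rw [Real.sqrt_mul (by norm_num)] at h2
    have h10 : (N : ℝ) * (√2 * √δ) ≤ N * (2 * √δ) := by gcongr
    linarith
  have h6 : probOne (.inl 0) (Circuit.apply D (pairState G)) ≤ (√s + 3 * N * √δ) ^ 2 := by
    rw [← Real.sq_sqrt (probOne_nonneg _ _)]
    exact pow_le_pow_left₀ (Real.sqrt_nonneg _) h5 2
  have h7 := acceptance_bound (p := (1 / 2) ^ l) (by exact_mod_cast hN) (Real.sqrt_nonneg δ) hl h6
    hs hs1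
  rw [Real.sq_sqrt hδ0, hδ, sub_sub_cancel] at h7
  rw [coinAcceptance, sqNorm_pairState]
  exact h7

/-- Exchanging a block between two equal product states merely commutes two factors, so honest
proofs pass every test. -/
theorem symmetrizeFirst_tensor_self (φ : Fin N → (Fin N → Bool) → ℂ) (n : ℕ) :
    symmetrizeFirst n (tensor (fun a => ∏ j, φ j (a j)) fun a => ∏ j, φ j (a j)) =
      tensor (fun a => ∏ j, φ j (a j)) fun a => ∏ j, φ j (a j) := by
  induction n with
  | zero => rfl
  | succ n ih =>
    rw [symmetrizeFirst, ih]
    funext p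
    have : tensor (fun a => ∏ j, φ j (a j)) (fun a => ∏ j, φ j (a j))
        (Function.update p.1 (Fin.ofNat N n) (p.2 (Fin.ofNat N n)),
          Function.update p.2 (Fin.ofNat N n) (p.1 (Fin.ofNat N n))) =
        tensor (fun a => ∏ j, φ j (a j)) (fun a => ∏ j, φ j (a j)) p := by
      simp only [tensor, ← Finset.prod_mul_distrib]
      refine Finset.prod_congr rfl fun j _ => ?_
      by_cases h : j = Fin.ofNat N n
      · subst h; simp only [Function.update_self, mul_comm]
      · simp only [Function.update_of_ne h]
    rw [symmetrize, this]
    ring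

/-- The completeness of the two-proof verification circuit. -/
theorem coinAcceptance_eq {l : ℕ} (D : Circuit (PairQubit N v)) (φ : Fin N → (Fin N → Bool) → ℂ)
    (hφ : sqNorm (fun a : Fin N → Fin N → Bool => ∏ j, φ j (a j)) = 1) :
    coinAcceptance l D (pairState (symmetrizeFirst N
      (tensor (fun a => ∏ j, φ j (a j)) fun a => ∏ j, φ j (a j)))) =
      1 - (1 / 2) ^ l * (1 - probOne (.inl 0) (Circuit.apply D (pairState
        (tensor (fun a => ∏ j, φ j (a j)) fun a => ∏ j, φ j (a j))))) := by
  rw [symmetrizeFirst_tensor_self, coinAcceptance, sqNorm_pairState, sqNorm_tensor, hφ]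
  ring

end pairState

end MultiMerlin

noncomputable section

namespace MultiMerlin

/-! ### Product states -/

theorem sqNorm_prod {J X : Type} [Fintype J] [DecidableEq J] [Fintype X] (f : J → X → ℂ) :
    sqNorm (fun a : J → X => ∏ j, f j (a j)) = ∏ j, sqNorm (f j) := by
  simp only [sqNorm, norm_prod, ← Finset.prod_pow]
  rw [Finset.prod_univ_sum, Fintype.piFinset_univ]

theorem QuantumProof.sqNorm_eq_one {m : ℕ} (φ : QuantumProof m) : sqNorm (φ.1 : (Fin m → Bool) → ℂ) = 1 := by
  rw [sqNorm_eq_norm_sq, φ.2, one_pow]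

/-- The quantum proof `|0…0⟩`. -/
def zeroProof (m : ℕ) : QuantumProof m :=
  ⟨EuclideanSpace.single (fun _ => false) 1, by simp⟩

/-- The quantum proof with the given amplitudes. -/
def proofOfAmplitudes {m : ℕ} (f : (Fin m → Bool) → ℂ) (hf : sqNorm f = 1) : QuantumProof m :=
  ⟨WithLp.toLp 2 f, by rw [norm_toLp_eq_sqrt, hf, Real.sqrt_one]⟩

section productState

variable {v k m K N : ℕ}

/-- A multiple of a product state of the witness registers, with work qubits that are zero. -/
def productState (c : ℂ) (f : Fin k → (Fin m → Bool) → ℂ) : Amplitudes (Qubit v k m) := fun b =>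
  if ∀ i : Fin v, b (.inl i) = false then c * ∏ j, f j (fun i => b (.inr (j, i))) else 0

theorem initialState_eq_productState (φ : Fin k → QuantumProof m) :
    (initialState φ : Amplitudes (Qubit v k m)) = productState 1 fun j => (φ j).1 := by
  funext b
  simp only [initialState, productState, ite_mul, one_mul, zero_mul]

theorem productState_smul (c : ℂ) (r : Fin k → ℂ) (f : Fin k → (Fin m → Bool) → ℂ) :
    (productState c (fun j => r j • f j) : Amplitudes (Qubit v k m)) =
      (c * ∏ j, r j) • productState 1 f := by
  funext b
  simp only [productState, Pi.smul_apply, smul_eq_mul, Finset.prod_mul_distrib, mul_ite, mul_zero,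
    one_mul, mul_assoc]

theorem sqNorm_initialState (φ : Fin k → QuantumProof m) :
    sqNorm (initialState φ : Amplitudes (Qubit v k m)) = 1 := by
  have he : (Sum.inr : Fin k × Fin m → Qubit v k m).Injective := Sum.inr_injective
  rw [sqNorm, sum_eq_sum_extend he fun _ => false]
  · rw [← Equiv.sum_comp (Equiv.curry (Fin k) (Fin m) Bool).symm]
    have h := sqNorm_prod fun j => (φ j).1
    simp only [QuantumProof.sqNorm_eq_one, Finset.prod_const_one] at h
    rw [← h, sqNorm]
    refine Finset.sum_congr rfl fun a _ => ?_
    rw [initialState, if_pos, one_mul]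
    · simp only [he.extend_apply]
      rfl
    · intro i
      exact Function.extend_apply' _ _ _ (by simp)
  · intro d hd q hq
    rcases q with i | q
    · by_contra h
      refine hd ?_
      rw [initialState, if_neg fun h' => h (h' i)]
      simp
    · exact absurd rfl (hq q)

/-- Soundness extends to product states that are not normalized. -/
theorem probOne_productState_le {C : Circuit (Qubit v k m)} {o : Qubit v k m} {s : ℝ}
    (hs : ∀ φ : Fin k → QuantumProof m, probOne o (Circuit.apply C (initialState φ)) ≤ s)
    (c : ℂ) (f : Fin k → (Fin m → Bool) → ℂ) :
    probOne o (Circuit.apply C (productState c f)) ≤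
      s * sqNorm (productState c f : Amplitudes (Qubit v k m)) := by
  have hs0 : 0 ≤ s := (probOne_nonneg _ _).trans (hs fun _ => zeroProof m)
  have h : ∀ j, ∃ (r : ℂ) (φ : QuantumProof m), f j = r • (φ.1 : (Fin m → Bool) → ℂ) := by
    intro j
    by_cases h : sqNorm (f j) = 0
    -- A vanishing factor cannot be normalized, but any proof serves with coefficient zero.
    · exact ⟨0, zeroProof m, by rw [sqNorm_eq_zero h, zero_smul]⟩
    · have h0 : 0 < sqNorm (f j) := lt_of_le_of_ne (sqNorm_nonneg _) (Ne.symm h)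
      have hr : ((√(sqNorm (f j)) : ℝ) : ℂ) ≠ 0 := by
        exact_mod_cast (Real.sqrt_pos.2 h0).ne'
      refine ⟨((√(sqNorm (f j)) : ℝ) : ℂ), proofOfAmplitudes
        ((((√(sqNorm (f j)) : ℝ) : ℂ))⁻¹ • f j) ?_, ?_⟩
      · rw [sqNorm_smul, norm_inv, Complex.norm_real, Real.norm_eq_abs, inv_pow, sq_abs,
          Real.sq_sqrt h0.le, inv_mul_cancel₀ h]
      · change f j = _ • _ • f j
        rw [smul_smul, mul_inv_cancel₀ hr, one_smul]
  choose r φ hf using h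
  have e : (productState c f : Amplitudes (Qubit v k m)) = (c * ∏ j, r j) • initialState φ := by
    rw [initialState_eq_productState, ← productState_smul]
    congr 1
    funext j
    exact hf j
  rw [e, Circuit.apply_smul, probOne_smul, sqNorm_smul, sqNorm_initialState, mul_one, mul_comm s]
  exact mul_le_mul_of_nonneg_left (hs φ) (by positivity)

theorem prod_eq_prod_castLE_mul (hk : k ≤ N) (u : Fin N → ℂ) :
    ∏ j, u j = (∏ j : Fin k, u (j.castLE hk)) * ∏ j : Fin N, if (j : ℕ) < k then 1 else u j := by
  have h1 : ∏ j : Fin k, u (j.castLE hk) = ∏ j : Fin N, if (j : ℕ) < k then u j else 1 := by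
    refine Fintype.prod_of_injective (Fin.castLE hk) (Fin.castLE_injective hk) _ _ ?_ ?_
    · intro j hj
      rw [if_neg]
      exact fun h => hj ⟨⟨j, h⟩, rfl⟩
    · intro j
      simp
  rw [h1, ← Finset.prod_mul_distrib]
  refine Finset.prod_congr rfl fun j _ => ?_
  split_ifs <;> simp

/-! #### More witness registers -/

/-- The embedding of the qubits of a verification circuit with `k` proofs among those of one with
`K` proofs. -/
def registerEmbedding (hk : k ≤ K) : Qubit v k m → Qubit v K m
  | .inl i => .inl i
  | .inr (j, i) => .inr (j.castLE hk, i)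

theorem registerEmbedding_injective (hk : k ≤ K) :
    (registerEmbedding hk : Qubit v k m → Qubit v K m).Injective := by
  rintro (i | ⟨j, i⟩) (i' | ⟨j', i'⟩) h <;> simp_all [registerEmbedding]

/-- A description names a qubit by register and position, regardless of the number of registers, so
the same machine also describes the enlarged circuit. -/
theorem describeCircuit_map_registerEmbedding (hk : k ≤ K) (C : Circuit (Qubit v k m)) :
    describeCircuit (Circuit.map (registerEmbedding hk) (registerEmbedding_injective hk) C) =
      describeCircuit C := by
  rw [Circuit.map, describeCircuit, describeCircuit, List.flatMap_map]
  congr 1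
  funext g
  rw [describeGate_map, describeGate_eq]
  congr 2
  funext q
  rcases q with i | ⟨j, i⟩ <;> rfl

/-- The additional registers are in a product state with the rest and are not acted upon, so
`probOne_map_eq` applies. -/
theorem probOne_map_registerEmbedding (hk : k ≤ K) (C : Circuit (Qubit v k m)) (o : Qubit v k m)
    (φ : Fin K → QuantumProof m) :
    probOne (registerEmbedding hk o) (Circuit.apply (Circuit.map (registerEmbedding hk)
      (registerEmbedding_injective hk) C) (initialState φ)) =
      probOne o (Circuit.apply C (initialState fun j => φ (j.castLE hk))) := by
  have he := registerEmbedding_injective (v := v) (m := m) hk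
  have h := probOne_map_eq he o C (initialState φ) (initialState fun j => φ (j.castLE hk))
    (fun b => ∏ j : Fin K, if (j : ℕ) < k then 1 else (φ j).1 fun i => b (.inr (j, i))) ?_
  · rwa [sqNorm_initialState, sqNorm_initialState, mul_one, mul_one] at h
  · intro b
    funext a
    have h1 : ∀ i, Function.extend (registerEmbedding hk) a b (.inl i) = a (.inl i) :=
      fun i => he.extend_apply a b (.inl i)
    have h2 : ∀ j i, Function.extend (registerEmbedding hk) a b (.inr (Fin.castLE hk j, i)) =
        a (.inr (j, i)) := fun j i => he.extend_apply a b (.inr (j, i))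
    have h3 : ∀ (j : Fin K) i, ¬ (j : ℕ) < k →
        Function.extend (registerEmbedding hk) a b (.inr (j, i)) = b (.inr (j, i)) := by
      intro j i hj
      refine Function.extend_apply' _ _ _ ?_
      rintro ⟨i' | ⟨j', i'⟩, h⟩
      · simp [registerEmbedding] at h
      · simp only [registerEmbedding, Sum.inr.injEq, Prod.mk.injEq] at h
        exact hj (by rw [← h.1]; exact j'.2)
    simp only [slice, initialState, h1, Pi.smul_apply, smul_eq_mul]
    rw [prod_eq_prod_castLE_mul hk]
    simp only [h2]
    have h4 : (∏ j : Fin K, if (j : ℕ) < k then (1 : ℂ) else (φ j).1 fun i =>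
        Function.extend (registerEmbedding hk) a b (.inr (j, i))) =
        ∏ j : Fin K, if (j : ℕ) < k then 1 else (φ j).1 fun i => b (.inr (j, i)) := by
      refine Finset.prod_congr rfl fun j _ => ?_
      split_ifs with h
      · rfl
      · simp only [h3 j _ h]
    rw [h4]
    ring

/-! #### Witness registers as blocks of a proof -/

variable (hk : k ≤ N) (hm : m ≤ N)

/-- Fixing the unused blocks, the unused qubits of the used blocks and the second proof leaves an
unnormalized product over the `k` registers. So entanglement within a block, between its used and
unused qubits, does no harm. -/
theorem slice_pairState_tensor (c : ℂ) (φ : Fin N → (Fin N → Bool) → ℂ)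
    (B : (Fin N → Fin N → Bool) → ℂ) (b : PairQubit N v → Bool) :
    slice (blockEmbedding hk hm) b
      (pairState (tensor (fun a : Fin N → Fin N → Bool => c * ∏ j, φ j (a j)) B)) =
      (productState (c * (∏ j : Fin N, if (j : ℕ) < k then 1 else φ j fun i => b (.inr (0, (j, i)))) *
        B fun j i => b (.inr (1, (j, i)))) (fun j x => φ (j.castLE hk)
          (Function.extend (Fin.castLE hm) x fun i => b (.inr (0, (j.castLE hk, i))))) :
      Amplitudes (Qubit v k m)) := by
  have he := blockEmbedding_injective (v := v) hk hm
  funext a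
  have h1 : ∀ i, Function.extend (blockEmbedding hk hm) a b (.inl i) = a (.inl i) :=
    fun i => he.extend_apply a b (.inl i)
  have h2 : ∀ (j : Fin k), (fun i => Function.extend (blockEmbedding hk hm) a b
      (.inr (0, (j.castLE hk, i)))) = Function.extend (Fin.castLE hm) (fun i => a (.inr (j, i)))
        fun i => b (.inr (0, (j.castLE hk, i))) := by
    intro j
    funext i
    by_cases h : ∃ i', Fin.castLE hm i' = i
    · obtain ⟨i', rfl⟩ := h
      rw [(Fin.castLE_injective hm).extend_apply]
      exact he.extend_apply a b (.inr (j, i'))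
    · rw [Function.extend_apply' _ _ _ h]
      refine Function.extend_apply' _ _ _ ?_
      rintro ⟨i' | ⟨j', i'⟩, h'⟩
      · simp [blockEmbedding] at h'
      · simp only [blockEmbedding, Sum.inr.injEq, Prod.mk.injEq] at h'
        exact h ⟨i', h'.2.2⟩
  have h3 : ∀ (j : Fin N) i, ¬ (j : ℕ) < k →
      Function.extend (blockEmbedding hk hm) a b (.inr (0, (j, i))) = b (.inr (0, (j, i))) := by
    intro j i hj
    refine Function.extend_apply' _ _ _ ?_
    rintro ⟨i' | ⟨j', i'⟩, h⟩
    · simp [blockEmbedding] at h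
    · simp only [blockEmbedding, Sum.inr.injEq, Prod.mk.injEq] at h
      exact hj (by rw [← h.2.1]; exact j'.2)
  have h4 : ∀ q, Function.extend (blockEmbedding hk hm) a b (.inr (1, q)) = b (.inr (1, q)) := by
    intro q
    refine Function.extend_apply' _ _ _ ?_
    rintro ⟨i' | ⟨j', i'⟩, h⟩ <;> simp [blockEmbedding] at h
  have h5 : (∏ j : Fin N, if (j : ℕ) < k then (1 : ℂ) else φ j fun i =>
      Function.extend (blockEmbedding hk hm) a b (.inr (0, (j, i)))) =
      ∏ j : Fin N, if (j : ℕ) < k then 1 else φ j fun i => b (.inr (0, (j, i))) := by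
    refine Finset.prod_congr rfl fun j _ => ?_
    split_ifs with h
    · rfl
    · simp only [h3 j _ h]
  simp only [slice, pairState, productState, tensor, h1, h4]
  split_ifs
  · rw [prod_eq_prod_castLE_mul hk, h5]
    simp only [h2]
    ring
  · rfl

/-- This supplies the hypothesis `hD` of `coinAcceptance_le`: soundness on unnormalized product
states holds in every slice. -/
theorem probOne_map_blockEmbedding_le [NeZero v] {C : Circuit (Qubit v k m)} {s : ℝ}
    (hs : ∀ φ : Fin k → QuantumProof m, probOne (.inl 0) (Circuit.apply C (initialState φ)) ≤ s)
    (c : ℂ) (φ : Fin N → (Fin N → Bool) → ℂ) (B : (Fin N → Fin N → Bool) → ℂ) :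
    probOne (.inl 0) (Circuit.apply (Circuit.map (blockEmbedding hk hm)
      (blockEmbedding_injective hk hm) C)
      (pairState (tensor (fun a : Fin N → Fin N → Bool => c * ∏ j, φ j (a j)) B))) ≤
      s * sqNorm (tensor (fun a : Fin N → Fin N → Bool => c * ∏ j, φ j (a j)) B) := by
  rw [← sqNorm_pairState (v := v)]
  refine probOne_map_le (blockEmbedding_injective hk hm) (.inl 0) C _ s fun b => ?_
  rw [slice_pairState_tensor]
  exact probOne_productState_le hs _ _

/-- A state of a block whose last qubits are zero. -/
def padState (f : (Fin m → Bool) → ℂ) : (Fin N → Bool) → ℂ := fun x =>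
  if ∀ i : Fin N, m ≤ i → x i = false then f fun i => x (i.castLE hm) else 0

theorem padState_extend (f : (Fin m → Bool) → ℂ) (x : Fin m → Bool) (y : Fin N → Bool) :
    padState hm f (Function.extend (Fin.castLE hm) x y) =
      (if ∀ i : Fin N, m ≤ i → y i = false then 1 else 0) * f x := by
  have h : ∀ i : Fin N, m ≤ i → Function.extend (Fin.castLE hm) x y i = y i := by
    intro i hi
    refine Function.extend_apply' _ _ _ ?_
    rintro ⟨i', rfl⟩
    simp at hi
    omega
  have h' : (∀ i : Fin N, m ≤ i → Function.extend (Fin.castLE hm) x y i = false) ↔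
      ∀ i : Fin N, m ≤ i → y i = false := forall₂_congr fun i hi => by rw [h i hi]
  simp only [padState, h', (Fin.castLE_injective hm).extend_apply, ite_mul, one_mul, zero_mul]

theorem sqNorm_padState (f : (Fin m → Bool) → ℂ) : sqNorm (padState hm f) = sqNorm f := by
  rw [sqNorm, sum_eq_sum_extend (Fin.castLE_injective hm) fun _ => false]
  · simp [padState_extend, sqNorm]
  · intro x hx i hi
    by_contra h
    refine hx ?_
    rw [padState, if_neg]
    · simp
    · intro h'
      refine h (h' i ?_)
      by_contra hlt
      exact hi ⟨i, by omega⟩ rfl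

/-- The blocks of an honest proof. -/
def honestBlock (φ : Fin k → QuantumProof m) (j : Fin N) : (Fin N → Bool) → ℂ :=
  padState hm (if h : (j : ℕ) < k then φ ⟨j, h⟩ else zeroProof m).1

theorem sqNorm_prod_honestBlock (φ : Fin k → QuantumProof m) :
    sqNorm (fun a : Fin N → Fin N → Bool => ∏ j, honestBlock hm φ j (a j)) = 1 := by
  simp [sqNorm_prod, honestBlock, sqNorm_padState, QuantumProof.sqNorm_eq_one]

/-- An honest block is a proof followed by zeros, so every slice is a possibly vanishing multiple of
the initial state of `C`. -/
theorem probOne_map_blockEmbedding_eq [NeZero v] (C : Circuit (Qubit v k m))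
    (φ : Fin k → QuantumProof m) :
    probOne (.inl 0) (Circuit.apply (Circuit.map (blockEmbedding hk hm)
      (blockEmbedding_injective hk hm) C)
      (pairState (tensor (fun a : Fin N → Fin N → Bool => ∏ j, honestBlock hm φ j (a j))
        fun a => ∏ j, honestBlock hm φ j (a j)))) =
      probOne (.inl 0) (Circuit.apply C (initialState φ)) := by
  have h := probOne_map_eq (blockEmbedding_injective hk hm) (.inl 0) C (pairState
    (tensor (fun a : Fin N → Fin N → Bool => 1 * ∏ j, honestBlock hm φ j (a j))
      fun a => ∏ j, honestBlock hm φ j (a j))) (initialState φ) _ fun b => by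
    rw [slice_pairState_tensor]
    rw [show (fun (j : Fin k) (x : Fin m → Bool) => honestBlock hm φ (j.castLE hk)
        (Function.extend (Fin.castLE hm) x fun i => b (.inr (0, (j.castLE hk, i))))) =
        fun j => (if ∀ i : Fin N, m ≤ i → b (.inr (0, (j.castLE hk, i))) = false then (1 : ℂ)
          else 0) • ((φ j).1 : (Fin m → Bool) → ℂ) by
      funext j x
      rw [honestBlock, padState_extend]
      simp,
      productState_smul, ← initialState_eq_productState]
  rw [sqNorm_initialState, sqNorm_pairState, sqNorm_tensor] at h
  simp only [one_mul, sqNorm_prod_honestBlock, mul_one] at h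
  exact h

end productState

end MultiMerlin

/-! ### The two inclusions and the choice of error probabilities -/

noncomputable section

namespace MultiMerlin

/-! ### Quantum proofs as families of blocks -/

/-- The basis states of a quantum proof of `N * N` qubits, as families of `N` blocks. -/
def blockEquiv (N : ℕ) : (Fin N → Fin N → Bool) ≃ (Fin (N * N) → Bool) :=
  (Equiv.curry (Fin N) (Fin N) Bool).symm.trans (Equiv.arrowCongr finProdFinEquiv (Equiv.refl _))

theorem proofAmplitudes_eq {N : ℕ} (φ : QuantumProof (N * N)) :
    proofAmplitudes φ = fun a => φ.1 (blockEquiv N a) := rfl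

theorem sqNorm_proofAmplitudes {N : ℕ} (φ : QuantumProof (N * N)) :
    sqNorm (proofAmplitudes φ) = 1 := by
  rw [proofAmplitudes_eq]
  exact (sqNorm_comp_equiv (blockEquiv N) φ.1).trans φ.sqNorm_eq_one

theorem exists_proofAmplitudes_eq {N : ℕ} {A : (Fin N → Fin N → Bool) → ℂ} (hA : sqNorm A = 1) :
    ∃ φ : QuantumProof (N * N), proofAmplitudes φ = A := by
  refine ⟨proofOfAmplitudes (fun w => A ((blockEquiv N).symm w)) ?_, ?_⟩
  · exact (sqNorm_comp_equiv (blockEquiv N).symm A).trans hA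
  · funext a
    rw [proofAmplitudes_eq]
    exact congrArg A ((blockEquiv N).symm_apply_apply a)

/-! ### More proofs -/

theorem QMA_two_subset {k : ℕ → ℕ} (hk : ∀ n, 2 ≤ k n) (c s : ℕ → ℝ) :
    QMA (fun _ => 2) c s ⊆ QMA k c s := by
  rintro A ⟨V, hyes, hno⟩
  let W : QuantumVerifier k :=
    { qV := V.qV
      qM := V.qM
      qV_pos := V.qV_pos
      qM_pos := V.qM_pos
      qV_bounded := V.qV_bounded
      qM_bounded := V.qM_bounded
      circuit := fun x => Circuit.map (registerEmbedding (hk x.length))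
        (registerEmbedding_injective _) (V.circuit x)
      polyTime := by
        simp only [describeCircuit_map_registerEmbedding]
        exact V.polyTime }
  have hW : ∀ x φ, W.acceptProb x φ = V.acceptProb x fun j => φ (j.castLE (hk x.length)) :=
    fun x φ => probOne_map_registerEmbedding (hk x.length) (V.circuit x) (V.output x.length) φ
  refine ⟨W, fun x hx => ?_, fun x hx φ => (hW x φ).trans_le (hno x hx _)⟩
  obtain ⟨φ, hφ⟩ := hyes x hx
  -- The ignored registers may hold anything.
  refine ⟨fun j => if h : (j : ℕ) < 2 then φ ⟨j, h⟩ else zeroProof _, hφ.trans_eq ?_⟩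
  rw [hW]
  congr 1
  funext j
  have h : ((j.castLE (hk x.length) : Fin (k x.length)) : ℕ) < 2 := j.2
  rw [dif_pos h]
  rfl

/-! ### Two proofs -/

/-- The two-proof verifier that simulates the verifier `V`. -/
def QuantumVerifier.twoProof {k : ℕ → ℕ} (V : QuantumVerifier k) (r : ℕ)
    (hk : ∀ n, k n ≤ 2 ^ logParam r n) (hm : ∀ n, V.qM n ≤ 2 ^ logParam r n) :
    QuantumVerifier fun _ => 2 where
  qV n := 5 * (2 ^ logParam r n + 4 * logParam r n + V.qV n) + 6
  qM n := 2 ^ logParam r n * 2 ^ logParam r n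
  qV_pos _ := by omega
  qM_pos _ := by positivity
  qV_bounded := by
    obtain ⟨p₁, h₁⟩ := polynomiallyBounded_two_pow_logParam r
    obtain ⟨p₂, h₂⟩ := polynomiallyBounded_logParam r
    obtain ⟨p₃, h₃⟩ := V.qV_bounded
    refine ⟨5 * (p₁ + 4 * p₂ + p₃) + 6, fun n => ?_⟩
    have h₁ : 2 ^ logParam r n ≤ p₁.eval n := h₁ n
    have := h₂ n
    have := h₃ n
    simp only [Polynomial.eval_add, Polynomial.eval_mul, Polynomial.eval_ofNat]
    omega
  qM_bounded := by
    obtain ⟨p, h⟩ := polynomiallyBounded_two_pow_logParam r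
    exact ⟨p * p, fun n => by rw [Polynomial.eval_mul]; exact Nat.mul_le_mul (h n) (h n)⟩
  circuit x := twoProofCircuit (4 * logParam r x.length) (hk x.length) (hm x.length) (V.circuit x)
  polyTime := by
    simp only [describeCircuit_twoProofCircuit]
    exact Fragment.polyTimeComputable_twoProofText V.circuit V.polyTime r

section twoProof

variable {k : ℕ → ℕ} (V : QuantumVerifier k) (r : ℕ) (hk : ∀ n, k n ≤ 2 ^ logParam r n)
  (hm : ∀ n, V.qM n ≤ 2 ^ logParam r n) (x : List Bool)

theorem QuantumVerifier.acceptProb_twoProof [NeZero (V.qV x.length)]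
    (φ : Fin 2 → QuantumProof (2 ^ logParam r x.length * 2 ^ logParam r x.length)) :
    (V.twoProof r hk hm).acceptProb x φ =
      coinAcceptance (4 * logParam r x.length) (Circuit.map
        (blockEmbedding (hk x.length) (hm x.length)) (blockEmbedding_injective _ _) (V.circuit x))
        (pairState (symmetrizeFirst (2 ^ logParam r x.length)
          (tensor (proofAmplitudes (φ 0)) (proofAmplitudes (φ 1))))) := by
  refine Eq.trans ?_ (probOne_twoProofCircuit (4 * logParam r x.length) (hk x.length)
    (hm x.length) (V.circuit x) φ)
  congr 1

theorem two_pow_logParam_pow_four (r n : ℕ) :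
    (1 / 2 : ℝ) ^ (4 * logParam r n) = 1 / ((2 ^ logParam r n : ℕ) : ℝ) ^ 4 := by
  push_cast
  rw [mul_comm, pow_mul, one_div_pow, one_div_pow]

theorem QuantumVerifier.acceptProb_twoProof_le {s : ℝ} (hs0 : 0 ≤ s) (hs1 : s ≤ 1)
    (hr : 64 ≤ 2 ^ logParam r x.length) (hs : ∀ φ, V.acceptProb x φ ≤ s)
    (φ : Fin 2 → QuantumProof (2 ^ logParam r x.length * 2 ^ logParam r x.length)) :
    (V.twoProof r hk hm).acceptProb x φ ≤
      1 - (1 / 2) ^ (4 * logParam r x.length) * (1 - (s + 1 / 2 ^ logParam r x.length)) := by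
  have : NeZero (V.qV x.length) := ⟨(V.qV_pos _).ne'⟩
  rw [V.acceptProb_twoProof]
  have h := coinAcceptance_le hs0 hs1 hr (two_pow_logParam_pow_four r x.length)
    (probOne_map_blockEmbedding_le (hk x.length) (hm x.length) hs)
    (sqNorm_proofAmplitudes (φ 0)) (sqNorm_proofAmplitudes (φ 1))
  push_cast at h
  exact h

/-- The honest strategy submits the same product of padded proofs twice. -/
theorem QuantumVerifier.exists_acceptProb_twoProof_eq
    (φ : Fin (k x.length) → QuantumProof (V.qM x.length)) :
    ∃ ψ : Fin 2 → QuantumProof (2 ^ logParam r x.length * 2 ^ logParam r x.length),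
      (V.twoProof r hk hm).acceptProb x ψ =
        1 - (1 / 2) ^ (4 * logParam r x.length) * (1 - V.acceptProb x φ) := by
  have : NeZero (V.qV x.length) := ⟨(V.qV_pos _).ne'⟩
  obtain ⟨ψ, hψ⟩ := exists_proofAmplitudes_eq (sqNorm_prod_honestBlock (hm x.length) φ)
  refine ⟨fun _ => ψ, ?_⟩
  rw [V.acceptProb_twoProof, hψ, coinAcceptance_eq _ _ (sqNorm_prod_honestBlock (hm x.length) φ),
    probOne_map_blockEmbedding_eq]
  rfl

end twoProof

/-! ### The error probabilities of the simulation -/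

/-- The base is at least two even for `n = 0`, so its powers absorb the coefficients. -/
theorem eval_le_add_two_pow (p : Polynomial ℕ) : ∃ r, ∀ n, p.eval n ≤ (n + 2) ^ r := by
  induction p using Polynomial.induction_on' with
  | add p q hp hq =>
    obtain ⟨a, ha⟩ := hp
    obtain ⟨b, hb⟩ := hq
    refine ⟨a + b + 1, fun n => ?_⟩
    have h₁ : (n + 2) ^ a ≤ (n + 2) ^ (a + b) := Nat.pow_le_pow_right (by omega) (by omega)
    have h₂ : (n + 2) ^ b ≤ (n + 2) ^ (a + b) := Nat.pow_le_pow_right (by omega) (by omega)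
    rw [Polynomial.eval_add, pow_succ]
    nlinarith [ha n, hb n]
  | monomial d c =>
    refine ⟨c + d, fun n => ?_⟩
    rw [Polynomial.eval_monomial, pow_add]
    exact Nat.mul_le_mul (c.lt_two_pow_self.le.trans (Nat.pow_le_pow_left (by omega) c))
      (Nat.pow_le_pow_left (by omega) d)

/-- One has `n + 2 ≤ 2 ^ (binaryLength n + 1)`, and the additional `r` in `logParam` provides the `+
1`. -/
theorem add_two_pow_le_two_pow_logParam (r n : ℕ) : (n + 2) ^ r ≤ 2 ^ logParam r n := by
  rw [logParam, show r * binaryLength n + r = (binaryLength n + 1) * r by ring, pow_mul]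
  refine Nat.pow_le_pow_left ?_ r
  have := lt_two_pow_binaryLength n
  rw [pow_succ]
  omega

theorem PolynomiallyBounded.exists_le_two_pow_logParam {f : ℕ → ℕ} (hf : PolynomiallyBounded f) :
    ∃ r, ∀ n, f n ≤ 2 ^ logParam r n := by
  obtain ⟨p, hp⟩ := hf
  obtain ⟨r, hr⟩ := eval_le_add_two_pow p
  exact ⟨r, fun n => (hp n).trans ((hr n).trans (add_two_pow_le_two_pow_logParam r n))⟩

/-- With `x = 2⁻ᴸ` and the queried approximation `y`, the pair is `1 - x⁴ (1 - y - 3 x)` and `1 - x⁴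
(1 - y - 2 x)`. The gap is exactly `x⁵`, and `y + 7 x ≤ 1` keeps the first at distance at least `4
x⁵` from one. -/
theorem nearOne_mem_strictBoundedErrors {u : List Bool → List Bool} (hu : PolyTimeComputable u)
    {r : ℕ} (h : ∀ n, binaryValue (u (ones n ++ false :: ones (logParam r n))) + 7 ≤
      2 ^ logParam r n) :
    ((fun n => 1 - (1 / 2 : ℝ) ^ (4 * logParam r n) * (1 -
        ((binaryValue (u (ones n ++ false :: ones (logParam r n))) + 3 : ℕ) : ℝ) /
          2 ^ logParam r n),
      fun n => 1 - (1 / 2 : ℝ) ^ (4 * logParam r n) * (1 -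
        ((binaryValue (u (ones n ++ false :: ones (logParam r n))) + 2 : ℕ) : ℝ) /
          2 ^ logParam r n)) : (ℕ → ℝ) × (ℕ → ℝ)) ∈ strictBoundedErrors := by
  have hx : ∀ n, ∃ x y : ℝ, 0 < x ∧ 0 ≤ y ∧ y + 7 * x ≤ 1 ∧
      (1 / 2 : ℝ) ^ (4 * logParam r n) = x ^ 4 ∧ (1 / 2 : ℝ) ^ (5 * logParam r n) = x ^ 5 ∧
      1 / (((2 ^ logParam r n) ^ 5 : ℕ) : ℝ) = x ^ 5 ∧
      ∀ d : ℕ, ((binaryValue (u (ones n ++ false :: ones (logParam r n))) + d : ℕ) : ℝ) /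
        2 ^ logParam r n = y + d * x := by
    intro n
    have hN : (0 : ℝ) < 2 ^ logParam r n := by positivity
    refine ⟨(1 / 2) ^ logParam r n,
      binaryValue (u (ones n ++ false :: ones (logParam r n))) / 2 ^ logParam r n, by positivity, by positivity, ?_,
      by rw [mul_comm, pow_mul], by rw [mul_comm, pow_mul], ?_, fun d => ?_⟩
    · rw [one_div_pow, mul_one_div, ← add_div, div_le_one hN]
      exact_mod_cast h n
    · push_cast
      rw [one_div_pow, one_div_pow]
    · push_cast
      rw [one_div_pow, mul_one_div, add_div]
  refine ⟨⟨polyTimeComputableReal_nearOne hu r 3 fun n => lt_of_lt_of_le (by omega) (h n),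
    polyTimeComputableReal_nearOne hu r 2 fun n => lt_of_lt_of_le (by omega) (h n), fun n => ?_,
    fun n => (2 ^ logParam r n) ^ 5, ?_, fun n => ⟨by positivity, ?_⟩⟩,
    fun n => 5 * logParam r n, ?_, fun n => ?_⟩
  · obtain ⟨x, y, hx, hy, hxy, e₄, -, -, e⟩ := hx n
    have h₄ : x ^ 4 ≤ 1 := pow_le_one₀ hx.le (by linarith)
    have h₀ : 0 < x ^ 4 := by positivity
    simp only [e₄, e]
    push_cast
    constructor <;> nlinarith
  · obtain ⟨p, hp⟩ := polynomiallyBounded_two_pow_logParam r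
    exact ⟨p ^ 5, fun n => by rw [Polynomial.eval_pow]; exact Nat.pow_le_pow_left (hp n) 5⟩
  · obtain ⟨x, y, -, -, -, e₄, -, e₅, e⟩ := hx n
    simp only [e₄, e, e₅]
    push_cast
    linarith [pow_succ x 4]
  · obtain ⟨p, hp⟩ := polynomiallyBounded_logParam r
    exact ⟨5 * p, fun n => by
      rw [Polynomial.eval_mul, Polynomial.eval_ofNat]
      exact Nat.mul_le_mul_left 5 (hp n)⟩
  · obtain ⟨x, y, hx, hy, hxy, e₄, e₅, -, e⟩ := hx n
    have h₄ : x ^ 4 ≤ 1 / 2 := (pow_le_of_le_one hx.le (by linarith) (by norm_num)).trans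
      (by linarith)
    have h₀ : 0 < x ^ 4 := by positivity
    simp only [e₄, e, e₅, pow_succ x 4]
    push_cast
    constructor <;> nlinarith

/-- With `N = 2ᴸ` and `|s - a / N| ≤ 1 / N`, soundness needs `s + 1 / N ≤ (a + 2) / N` and
completeness `(a + 3) / N ≤ c`; the latter follows from `c ≥ s + 8 / N`. Only `s` is ever
approximated, never `c`. -/
theorem exists_mem_QMA_two {k : ℕ → ℕ} (hk : PolynomiallyBounded k) {c s : ℕ → ℝ}
    (h : (c, s) ∈ boundedErrors) {A : PromiseProblem} (hA : A ∈ QMA k c s) :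
    ∃ c' s', (c', s') ∈ strictBoundedErrors ∧ A ∈ QMA (fun _ => 2) c' s' := by
  obtain ⟨V, hyes, hno⟩ := hA
  obtain ⟨-, ⟨u, hu, hus⟩, h01, q, ⟨pq, hpq⟩, hq⟩ := h
  obtain ⟨pk, hpk⟩ := hk
  obtain ⟨pm, hpm⟩ := V.qM_bounded
  -- The blocks must hold all the proofs; `8 * q` turns the gap into eight units of `1 / N`, and
  -- `64` is the threshold in `acceptance_bound`.
  obtain ⟨r, hr⟩ := PolynomiallyBounded.exists_le_two_pow_logParam
    (f := fun n => k n + V.qM n + 8 * q n + 64) ⟨pk + pm + 8 * pq + 64, fun n => by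
      have := hpk n
      have := hpm n
      have := hpq n
      simp only [Polynomial.eval_add, Polynomial.eval_mul, Polynomial.eval_ofNat]
      omega⟩
  have hrk : ∀ n, k n ≤ 2 ^ logParam r n := fun n => le_trans (by omega) (hr n)
  have hrm : ∀ n, V.qM n ≤ 2 ^ logParam r n := fun n => le_trans (by omega) (hr n)
  have hr64 : ∀ n, 64 ≤ 2 ^ logParam r n := fun n => le_trans (by omega) (hr n)
  set a : ℕ → ℕ := fun n => binaryValue (u (ones n ++ false :: ones (logParam r n))) with ha
  have hN : ∀ n, (0 : ℝ) < 2 ^ logParam r n := fun n => by positivity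
  have hN' : ∀ n, (0 : ℝ) ≤ 1 / 2 ^ logParam r n := fun n => by positivity
  have hc : ∀ n, s n + 8 * (1 / 2 ^ logParam r n) ≤ c n := by
    intro n
    have h₁ : (8 * q n : ℝ) ≤ 2 ^ logParam r n := by
      exact_mod_cast le_trans (by omega) (hr n)
    have h₂ : (0 : ℝ) < q n := by exact_mod_cast (hq n).1
    have h₃ : 8 * (1 / (2 : ℝ) ^ logParam r n) ≤ 1 / q n := by
      rw [mul_one_div, div_le_div_iff₀ (hN n) h₂]
      linarith
    linarith [(hq n).2]
  have has : ∀ n, (a n : ℝ) / 2 ^ logParam r n - 1 / 2 ^ logParam r n ≤ s n ∧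
      s n ≤ (a n : ℝ) / 2 ^ logParam r n + 1 / 2 ^ logParam r n := by
    intro n
    have h := abs_le.1 (hus n (logParam r n))
    rw [one_div_pow] at h
    exact ⟨by linarith [h.2, show (binaryValue (u (List.replicate n true ++ false ::
      List.replicate (logParam r n) true)) : ℝ) = a n from rfl], by
      linarith [h.1, show (binaryValue (u (List.replicate n true ++ false ::
        List.replicate (logParam r n) true)) : ℝ) = a n from rfl]⟩
  -- Of the eight units between `s` and `c ≤ 1`, the error of approximation takes one.
  have haN : ∀ n, a n + 7 ≤ 2 ^ logParam r n := by
    intro n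
    have h₁ : (a n : ℝ) / 2 ^ logParam r n + 7 * (1 / 2 ^ logParam r n) ≤ 1 := by
      linarith [(has n).1, hc n, (h01 n).2]
    rw [mul_one_div, ← add_div, div_le_one (hN n)] at h₁
    exact_mod_cast h₁
  have hd : ∀ n d : ℕ, ((a n + d : ℕ) : ℝ) / 2 ^ logParam r n =
      a n / 2 ^ logParam r n + d * (1 / 2 ^ logParam r n) := fun n d => by
    push_cast
    ring
  refine ⟨_, _, nearOne_mem_strictBoundedErrors hu haN, V.twoProof r hrk hrm, fun x hx => ?_,
    fun x hx φ => ?_⟩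
  · obtain ⟨φ, hφ⟩ := hyes x hx
    obtain ⟨ψ, hψ⟩ := V.exists_acceptProb_twoProof_eq r hrk hrm x φ
    refine ⟨ψ, ?_⟩
    rw [hψ]
    refine le_trans ?_ (sub_le_sub_left (mul_le_mul_of_nonneg_left (sub_le_sub_left hφ 1)
      (by positivity)) 1)
    refine sub_le_sub_left (mul_le_mul_of_nonneg_left (sub_le_sub_left ?_ 1) (by positivity)) 1
    refine (hd x.length 3).trans_le ?_
    push_cast
    linarith [(has x.length).1, hc x.length, hN' x.length]
  · have hs1 : s x.length ≤ 1 := by linarith [hc x.length, (h01 x.length).2, hN' x.length]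
    refine (V.acceptProb_twoProof_le r hrk hrm x (h01 x.length).1 hs1 (hr64 _) (hno x hx) φ).trans ?_
    refine sub_le_sub_left (mul_le_mul_of_nonneg_left (sub_le_sub_left ?_ 1) (by positivity)) 1
    refine le_of_le_of_eq ?_ (hd x.length 2).symm
    push_cast
    linarith [(has x.length).2]

/-- The simulation always ends in the strict class, which lies in both choices of `E`, so (∗) for
`E` applies to its error probabilities. -/
theorem QMA_subset_of_twoProofAmplification {E : Set ((ℕ → ℝ) × (ℕ → ℝ))}
    (hE : strictBoundedErrors ⊆ E) (hE' : E ⊆ boundedErrors) (h : TwoProofAmplification E)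
    {k : ℕ → ℕ} (hk : PolynomiallyBounded k) {c s : ℕ → ℝ} (hcs : (c, s) ∈ E) :
    QMA k c s ⊆ QMA (fun _ => 2) (fun _ => 2 / 3) (fun _ => 1 / 3) := by
  intro A hA
  obtain ⟨c', s', h', hA'⟩ := exists_mem_QMA_two hk (hE' hcs) hA
  rwa [← h c' s' (hE h')]

end MultiMerlin

/-! ### The equivalence -/

theorem mainTheorem1 (E : Set ((ℕ → ℝ) × (ℕ → ℝ)))
    (hE : E = MultiMerlin.boundedErrors ∨ E = MultiMerlin.strictBoundedErrors) :
    (∀ k : ℕ → ℕ, MultiMerlin.PolynomiallyBounded k → (∀ n, 2 ≤ k n) →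
      ∀ c s : ℕ → ℝ, (c, s) ∈ E →
        MultiMerlin.QMA k c s =
          MultiMerlin.QMA (fun _ => 2) (fun _ => 2 / 3) (fun _ => 1 / 3)) ↔
      MultiMerlin.TwoProofAmplification E := by
  have h₁ : MultiMerlin.strictBoundedErrors ⊆ E := by
    rcases hE with rfl | rfl
    exacts [fun _ h => h.1, le_rfl]
  have h₂ : E ⊆ MultiMerlin.boundedErrors := by
    rcases hE with rfl | rfl
    exacts [le_rfl, fun _ h => h.1]
  refine ⟨fun h c s hcs => h _ ⟨2, fun _ => by simp⟩ (fun _ => le_rfl) c s hcs,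
    fun h k hk hk2 c s hcs => Set.Subset.antisymm
      (MultiMerlin.QMA_subset_of_twoProofAmplification h₁ h₂ h hk hcs) ?_⟩
  -- Condition (∗) at `(c, s)` itself reduces the remaining inclusion to ignoring proofs.
  rw [← h c s hcs]
  exact MultiMerlin.QMA_two_subset hk2 c s
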